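/- Work in the two-sorted language of second-order arithmetic, and let $\mathsf{RCA}_0$ be the theory axiomatized by the basic (discretely ordered semiring) axioms for $0,1,+,\cdot,<$, induction for $\Sigma^0_1$-formulas and comprehension for $\Delta^0_1$-formulas, both with arbitrary number and set parameters. A (countable) linear order $X$ is given by a set of pairs of natural numbers. It is called a well order if there is no infinite sequence $x_0>_X x_1>_X\cdots$ in $X$, and a weak well order if no initial segment $I\subseteq X$ admits an embedding (i.e. a strictly order preserving map) $f:I\to I_0$ into a proper initial segment $I_0\subsetneq I$. For a linear order $X$, let $\omega(X)$ be the set of (codes of) finite sequences $\langle x_0,\dots,x_{n-1}\rangle$ with $x_i\in X$ and $x_0\geq_X\dots\geq_X x_{n-1}$, ordered lexicographically: $\sigma\leq_{\omega(X)}\tau$ holds iff either $l(\sigma)\leq l(\tau)$ and $\sigma_i=\tau_i$ for all $i<l(\sigma)$ (where $l$ denotes length), or there is $j<\min\{l(\sigma),l(\tau)\}$ with $\sigma_j<_X\tau_j$ and $\sigma_i=\tau_i$ for all $i<j$. Write $\omega$ for the natural numbers with their usual order and $\omega^\omega=\omega(\omega)$. Then $\mathsf{RCA}_0$ proves that the order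 $\omega^\omega$ exists and is a weak well order, while $\mathsf{RCA}_0$ does not prove that $\omega^\omega$ exists and is a well order. -/

import Mathlib

namespace SOA

/-! ### Two-sorted language of second-order arithmetic

Formulas use de Bruijn indices, with one index space for number variables and a separate one for
set variables. -/

/-- Number terms; `var i` is the `i`-th number variable. -/
inductive Tm : Type
  | var (i : ℕ)
  | zero
  | one
  | add (s t : Tm)
  | mul (s t : Tm)

/-- Formulas. `mem t X` says that the number `t` is in the `X`-th set variable; `allN` quantifies
over numbers and `allS` over sets, both binding the variable with index `0` of their sort. -/
inductive Fm : Type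
  | falsum
  | eq (s t : Tm)
  | lt (s t : Tm)
  | mem (t : Tm) (X : ℕ)
  | imp (φ ψ : Fm)
  | allN (φ : Fm)
  | allS (φ : Fm)

instance : Zero Tm := ⟨Tm.zero⟩
instance : One Tm := ⟨Tm.one⟩
instance : Add Tm := ⟨Tm.add⟩
instance : Mul Tm := ⟨Tm.mul⟩

/-- Simultaneous substitution of terms for number variables. -/
def Tm.subst (σ : ℕ → Tm) : Tm → Tm
  | .var i => σ i
  | .zero => .zero
  | .one => .one
  | .add s t => .add (s.subst σ) (t.subst σ)
  | .mul s t => .mul (s.subst σ) (t.subst σ)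

/-- Shift all number variables by `k` (used to place a term below `k` number quantifiers). -/
def Tm.lift (k : ℕ) (t : Tm) : Tm := t.subst fun i => .var (i + k)

/-- The number substitution `σ`, adapted to the scope of a number quantifier. -/
def upN (σ : ℕ → Tm) : ℕ → Tm
  | 0 => .var 0
  | i + 1 => (σ i).lift 1

/-- The set renaming `ρ`, adapted to the scope of a set quantifier. -/
def upS (ρ : ℕ → ℕ) : ℕ → ℕ
  | 0 => 0
  | i + 1 => ρ i + 1

/-- Simultaneous capture-avoiding substitution of terms for number variables and of set variables
for set variables. -/
def Fm.subst (σ : ℕ → Tm) (ρ : ℕ → ℕ) : Fm → Fm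
  | .falsum => .falsum
  | .eq s t => .eq (s.subst σ) (t.subst σ)
  | .lt s t => .lt (s.subst σ) (t.subst σ)
  | .mem t X => .mem (t.subst σ) (ρ X)
  | .imp φ ψ => .imp (φ.subst σ ρ) (ψ.subst σ ρ)
  | .allN φ => .allN (φ.subst (upN σ) ρ)
  | .allS φ => .allS (φ.subst σ (upS ρ))

/-- Shift all free number variables by one. -/
def Fm.liftN (φ : Fm) : Fm := φ.subst (fun i => .var (i + 1)) id

/-- Shift all free set variables by one. -/
def Fm.liftS (φ : Fm) : Fm := φ.subst .var Nat.succ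

/-- `φ[t/0]`: instantiate number variable `0` by `t` and lower the other number variables. -/
def Fm.instN (φ : Fm) (t : Tm) : Fm :=
  φ.subst (fun | 0 => t | i + 1 => .var i) id

/-- `φ[X/0]`: instantiate set variable `0` by `X` and lower the other set variables. -/
def Fm.instS (φ : Fm) (X : ℕ) : Fm :=
  φ.subst .var (fun | 0 => X | i + 1 => i)

/-- `φ(x + 1)`, where `x` is number variable `0`; all other variables stay as they are. -/
def Fm.instSucc (φ : Fm) : Fm :=
  φ.subst (fun | 0 => .var 0 + 1 | i + 1 => .var (i + 1)) id

/-! Defined connectives and quantifiers -/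

def Fm.neg (φ : Fm) : Fm := .imp φ .falsum
def Fm.and (φ ψ : Fm) : Fm := (φ.imp ψ.neg).neg
def Fm.or (φ ψ : Fm) : Fm := φ.neg.imp ψ
def Fm.iff (φ ψ : Fm) : Fm := (φ.imp ψ).and (ψ.imp φ)
def Fm.exN (φ : Fm) : Fm := φ.neg.allN.neg
def Fm.exS (φ : Fm) : Fm := φ.neg.allS.neg

prefix:max "♯" => Tm.var
infix:60 " ≐ " => Fm.eq
infix:60 " ≺ " => Fm.lt
infix:60 " ∊ " => Fm.mem
prefix:55 "∼ₐ" => Fm.neg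
infixr:50 " ⋏ " => Fm.and
infixr:45 " ⋎ " => Fm.or
infixr:40 " ⟹ₐ " => Fm.imp
infix:35 " ⟺ₐ " => Fm.iff

/-- `s ≤ t` for numbers. -/
def Fm.le (s t : Tm) : Fm := s ≺ t ⋎ s ≐ t

/-! ### Provability: classical natural deduction with equality -/

/-- `Prf T Γ φ`: the formula `φ` is derivable from the finitely many hypotheses `Γ` in the theory
with axioms `T`. Free variables of an axiom in `T` are read as universally quantified (axioms stay
available when a quantifier is introduced); those of `Γ` are fixed. -/
inductive Prf (T : Set Fm) : List Fm → Fm → Prop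
  | ax {Γ φ} : φ ∈ T → Prf T Γ φ
  | hyp {Γ φ} : φ ∈ Γ → Prf T Γ φ
  | impI {Γ φ ψ} : Prf T (φ :: Γ) ψ → Prf T Γ (.imp φ ψ)
  | impE {Γ φ ψ} : Prf T Γ (.imp φ ψ) → Prf T Γ φ → Prf T Γ ψ
  | byContra {Γ φ} : Prf T (φ.neg :: Γ) .falsum → Prf T Γ φ
  | allNI {Γ φ} : Prf T (Γ.map Fm.liftN) φ → Prf T Γ (.allN φ)
  | allNE {Γ φ} (t : Tm) : Prf T Γ (.allN φ) → Prf T Γ (φ.instN t)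
  | allSI {Γ φ} : Prf T (Γ.map Fm.liftS) φ → Prf T Γ (.allS φ)
  | allSE {Γ φ} (X : ℕ) : Prf T Γ (.allS φ) → Prf T Γ (φ.instS X)
  | eqRefl {Γ} (t : Tm) : Prf T Γ (t ≐ t)
  | eqSubst {Γ} (φ : Fm) {s t : Tm} :
      Prf T Γ (s ≐ t) → Prf T Γ (φ.instN s) → Prf T Γ (φ.instN t)

/-- The theory with axioms `T` proves `φ`. -/
def Proves (T : Set Fm) (φ : Fm) : Prop := Prf T [] φ

/-! ### The axiom system `RCA₀` -/

/-- Bounded quantification `∀ x < t, φ x`; the bound `t` does not contain the bound variable. -/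
def Fm.ballN (t : Tm) (φ : Fm) : Fm := .allN (♯0 ≺ t.lift 1 ⟹ₐ φ)

/-- Bounded formulas, possibly with free number and set variables. (A bounded existential
quantifier is `∼ₐ Fm.ballN t (∼ₐ φ)`.) -/
inductive IsBounded : Fm → Prop
  | falsum : IsBounded .falsum
  | eq (s t : Tm) : IsBounded (s ≐ t)
  | lt (s t : Tm) : IsBounded (s ≺ t)
  | mem (t : Tm) (X : ℕ) : IsBounded (t ∊ X)
  | imp {φ ψ : Fm} : IsBounded φ → IsBounded ψ → IsBounded (φ ⟹ₐ ψ)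
  | ballN (t : Tm) {φ : Fm} : IsBounded φ → IsBounded (.ballN t φ)

/-- `Σ⁰₁`-formulas. -/
def IsSigma1 (φ : Fm) : Prop := ∃ θ, IsBounded θ ∧ φ = .exN θ

/-- `Π⁰₁`-formulas. -/
def IsPi1 (φ : Fm) : Prop := ∃ θ, IsBounded θ ∧ φ = .allN θ

/-- Induction for `φ`, along number variable `0`. -/
def induction (φ : Fm) : Fm :=
  (φ.instN 0 ⋏ .allN (φ ⟹ₐ φ.instSucc)) ⟹ₐ .allN φ

/-- Comprehension for `φ` (in number variable `0`), provided that `φ` is equivalent to `ψ`. The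
shift `φ.liftS` ensures that the new set is not a parameter of `φ`. -/
def comprehension (φ ψ : Fm) : Fm :=
  .allN (φ ⟺ₐ ψ) ⟹ₐ .exS (.allN (♯0 ∊ 0 ⟺ₐ φ.liftS))

/-- The axioms of `RCA₀`: the basic axioms on numbers, `Σ⁰₁`-induction and `Δ⁰₁`-comprehension,
the last two with arbitrary number and set parameters. -/
inductive RCA₀ : Fm → Prop
  | succ_ne_zero : RCA₀ (∼ₐ (♯0 + 1 ≐ 0))
  | succ_inj : RCA₀ (♯0 + 1 ≐ ♯1 + 1 ⟹ₐ ♯0 ≐ ♯1)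
  | add_zero : RCA₀ (♯0 + 0 ≐ ♯0)
  | add_succ : RCA₀ (♯0 + (♯1 + 1) ≐ (♯0 + ♯1) + 1)
  | mul_zero : RCA₀ (♯0 * 0 ≐ 0)
  | mul_succ : RCA₀ (♯0 * (♯1 + 1) ≐ ♯0 * ♯1 + ♯0)
  | not_lt_zero : RCA₀ (∼ₐ (♯0 ≺ 0))
  | lt_succ : RCA₀ (♯0 ≺ ♯1 + 1 ⟺ₐ (♯0 ≺ ♯1 ⋎ ♯0 ≐ ♯1))
  | induction {φ : Fm} : IsSigma1 φ → RCA₀ (induction φ)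
  | comprehension {φ ψ : Fm} : IsSigma1 φ → IsPi1 ψ → RCA₀ (comprehension φ ψ)

/-! ### Pairs and finite sequences, inside second-order arithmetic -/

/-- The pairing function `(i, j) ↦ (i + j)² + i`. -/
def pair (s t : Tm) : Tm := (s + t) * (s + t) + s

/-- A number `c = (l, (m, n))` represents the sequence of length `l` with entries
`n mod (m * (i + 1) + 1)` for `i < l`. This formula says that `c` is of this form, with length `l`. -/
def hasLength (c l : Tm) : Fm :=
  .exN (.exN (c.lift 2 ≐ pair (l.lift 2) (pair ♯1 ♯0)))

/-- The sequence represented by `c` has an `i`-th entry, and that entry is `x`. The variables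
`3`, `2`, `1`, `0` are `l`, `m`, `n` and the quotient of the division of `n`. -/
def hasEntry (c i x : Tm) : Fm :=
  .exN (.exN (.exN (.exN (
    c.lift 4 ≐ pair ♯3 (pair ♯2 ♯1) ⋏
    i.lift 4 ≺ ♯3 ⋏
    x.lift 4 ≺ ♯2 * (i.lift 4 + 1) + 1 ⋏
    ♯1 ≐ ♯0 * (♯2 * (i.lift 4 + 1) + 1) + x.lift 4))))

/-- `c` and `d` represent the same sequence. -/
def sameSeq (c d : Tm) : Fm :=
  .allN (hasLength (c.lift 1) ♯0 ⟺ₐ hasLength (d.lift 1) ♯0) ⋏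
  .allN (.allN (hasEntry (c.lift 2) ♯1 ♯0 ⟺ₐ hasEntry (d.lift 2) ♯1 ♯0))

/-- `c` is the code of a finite sequence, i.e. the least number that represents it. -/
def isSeq (c : Tm) : Fm :=
  .exN (hasLength (c.lift 1) ♯0) ⋏
  .allN (♯0 ≺ c.lift 1 ⟹ₐ ∼ₐ sameSeq (c.lift 1) ♯0)

/-! ### Linear orders, inside second-order arithmetic

An order is a set `X` of pairs; `(s, t) ∈ X` means `s ≤ t`, and the underlying set of the order
consists of the numbers `t` with `(t, t) ∈ X`. -/

def inField (X : ℕ) (t : Tm) : Fm := pair t t ∊ X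
def leIn (X : ℕ) (s t : Tm) : Fm := pair s t ∊ X
def ltIn (X : ℕ) (s t : Tm) : Fm := leIn X s t ⋏ ∼ₐ (s ≐ t)

/-- `X` is a linear order. -/
def isLinearOrder (X : ℕ) : Fm :=
  .allN (♯0 ∊ X ⟹ₐ .exN (.exN (♯2 ≐ pair ♯1 ♯0))) ⋏
  .allN (.allN (leIn X ♯1 ♯0 ⟹ₐ inField X ♯1 ⋏ inField X ♯0)) ⋏
  .allN (.allN (.allN (leIn X ♯2 ♯1 ⋏ leIn X ♯1 ♯0 ⟹ₐ leIn X ♯2 ♯0))) ⋏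
  .allN (.allN (leIn X ♯1 ♯0 ⋏ leIn X ♯0 ♯1 ⟹ₐ ♯1 ≐ ♯0)) ⋏
  .allN (.allN (inField X ♯1 ⋏ inField X ♯0 ⟹ₐ leIn X ♯1 ♯0 ⋎ leIn X ♯0 ♯1))

/-- The set `F` is (the graph of) a function with domain `A` and values in `B`, where `A` and `B`
are given by formulas with a number argument. -/
def isFunction (F : ℕ) (A B : Tm → Fm) : Fm :=
  .allN (♯0 ∊ F ⟹ₐ .exN (.exN (♯2 ≐ pair ♯1 ♯0 ⋏ A ♯1 ⋏ B ♯0))) ⋏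
  .allN (A ♯0 ⟹ₐ .exN (pair ♯1 ♯0 ∊ F)) ⋏
  .allN (.allN (.allN (pair ♯2 ♯1 ∊ F ⋏ pair ♯2 ♯0 ∊ F ⟹ₐ ♯1 ≐ ♯0)))

/-- The set `I` is an initial segment of the order `X`. -/
def isInitialSegment (X I : ℕ) : Fm :=
  .allN (♯0 ∊ I ⟹ₐ inField X ♯0) ⋏
  .allN (.allN (♯0 ∊ I ⋏ ltIn X ♯1 ♯0 ⟹ₐ ♯1 ∊ I))

/-- `J` is a proper subset of `I`. -/
def isProperSubset (J I : ℕ) : Fm :=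
  .allN (♯0 ∊ J ⟹ₐ ♯0 ∊ I) ⋏ .exN (♯0 ∊ I ⋏ ∼ₐ (♯0 ∊ J))

/-- `F` is an embedding, i.e. an order preserving map, from `I` to `J`, both with the order of
`X`. -/
def isEmbedding (X F I J : ℕ) : Fm :=
  isFunction F (fun t => t ∊ I) (fun t => t ∊ J) ⋏
  .allN (.allN (.allN (.allN (
    pair ♯3 ♯2 ∊ F ⋏ pair ♯1 ♯0 ∊ F ⋏ ltIn X ♯3 ♯1 ⟹ₐ ltIn X ♯2 ♯0))))

/-- `X` is a weak well order: a linear order such that no initial segment `I` of `X` embeds into an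
initial segment `J ⊊ I`. The set variables `2`, `1`, `0` are `I`, `J` and the embedding. -/
def isWeakWellOrder (X : ℕ) : Fm :=
  isLinearOrder X ⋏
  ∼ₐ (.exS (.exS (.exS (
    isInitialSegment (X + 3) 2 ⋏ isInitialSegment (X + 3) 1 ⋏ isProperSubset 1 2 ⋏
    isEmbedding (X + 3) 0 2 1))))

/-- `X` is a well order: a linear order without infinite descending sequences. -/
def isWellOrder (X : ℕ) : Fm :=
  isLinearOrder X ⋏
  ∼ₐ (.exS (
    isFunction 0 (fun t => t ≐ t) (inField (X + 1)) ⋏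
    .allN (.allN (.allN (
      pair ♯2 ♯1 ∊ 0 ⋏ pair (♯2 + 1) ♯0 ∊ 0 ⟹ₐ ltIn (X + 1) ♯0 ♯1)))))

/-! ### The orders `ω` and `ω(X)`, inside second-order arithmetic -/

/-- `X` is the order `ω`, i.e. the natural numbers with their usual order. -/
def isOmega (X : ℕ) : Fm :=
  .allN (♯0 ∊ X ⟺ₐ .exN (.exN (♯2 ≐ pair ♯1 ♯0 ⋏ .le ♯1 ♯0)))

/-- `c` is (the code of) a sequence `⟨x₀, …, xₙ₋₁⟩` with entries in `X` and `x₀ ≥ … ≥ xₙ₋₁`. -/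
def inOmegaPow (X : ℕ) (c : Tm) : Fm :=
  isSeq c ⋏
  .allN (.allN (hasEntry (c.lift 2) ♯1 ♯0 ⟹ₐ inField X ♯0)) ⋏
  .allN (.allN (.allN (
    hasEntry (c.lift 3) ♯2 ♯1 ⋏ hasEntry (c.lift 3) (♯2 + 1) ♯0 ⟹ₐ leIn X ♯0 ♯1)))

/-- Lexicographic comparison `c ≤ d`: either `l(c) ≤ l(d)` and `cᵢ = dᵢ` for all `i < l(c)`, or
there is a `j < min {l(c), l(d)}` with `cⱼ < dⱼ` in `X` and `cᵢ = dᵢ` for all `i < j`. -/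
def lexLe (X : ℕ) (c d : Tm) : Fm :=
  (.exN (.exN (hasLength (c.lift 2) ♯1 ⋏ hasLength (d.lift 2) ♯0 ⋏ .le ♯1 ♯0)) ⋏
    .allN (.allN (hasEntry (c.lift 2) ♯1 ♯0 ⟹ₐ hasEntry (d.lift 2) ♯1 ♯0))) ⋎
  .exN (.exN (.exN (
    hasEntry (c.lift 3) ♯2 ♯1 ⋏ hasEntry (d.lift 3) ♯2 ♯0 ⋏ ltIn X ♯1 ♯0 ⋏
    .allN (.allN (♯1 ≺ ♯4 ⟹ₐ
      (hasEntry (c.lift 5) ♯1 ♯0 ⟺ₐ hasEntry (d.lift 5) ♯1 ♯0))))))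

/-- `Y` is the order `ω(X)` of non-increasing finite sequences in `X`, compared
lexicographically. -/
def isOmegaPow (X Y : ℕ) : Fm :=
  .allN (♯0 ∊ Y ⟺ₐ .exN (.exN (
    ♯2 ≐ pair ♯1 ♯0 ⋏ inOmegaPow X ♯1 ⋏ inOmegaPow X ♯0 ⋏ lexLe X ♯1 ♯0)))

/-- The sentence "`ω(ω)` exists and has property `P`", where `P` is a formula about the order given
by a set variable. The set variables `1` and `0` are `ω` and `ω(ω)`. -/
def omegaOmegaSatisfies (P : ℕ → Fm) : Fm :=
  .exS (.exS (isOmega 1 ⋏ isOmegaPow 1 0 ⋏ P 0))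

end SOA

namespace SOA

/-! ### Substitution -/

/-! Both halves are semantic. `completeness`, a Henkin construction, reduces the positive claim to
an argument inside an arbitrary model of `RCA₀`; `soundness` reduces the negative claim to one
countermodel.

Weak well order. Suppose that in some model f embeds an initial segment I of ω(ω) into a proper
initial segment J. Say that f drops at e if some p*⟨e⟩ in I satisfies f(p) ≥ p but f(p*⟨e⟩) < p*⟨e⟩.
Any w in I but not in J has f(w) < w, whereas f(⟨⟩) ≥ ⟨⟩, so f drops at some entry of w
(`exists_dropsAt`). A drop at e + 1 gives a drop at e (`dropsAt_of_add_one`): if z = f(p*⟨e+1⟩) <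
p*⟨e+1⟩, append to p more copies of e than z has entries. The result w satisfies z < w < p*⟨e+1⟩,
hence f(w) < z < w, so f drops between p and w, where all entries are e. A drop at 0 is impossible
(`not_dropsAt_zero`), because p*⟨0⟩ is the immediate successor of p. Being a drop is a Σ⁰₁ property
of e, so Σ⁰₁-induction leads from some drop to a drop at 0.

Unprovability. Starting from ⟨k⟩ with a counter x = k that grows at each step, replace a last entry
e + 1 by x + 1 entries e and delete a last entry 0. This descent lasts until the counter reaches at
least ack k k (`exists_descent_eq`). In an ultrapower of ℕ let k be the class of the identity, and
choose a cut that contains k, lies below the final value of the counter and is closed under each ack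
m with m standard. Within the cut the descent never ends, so the cut is a countermodel as soon as it
satisfies `RCA₀` and has sets for the lengths and entries.

To get `RCA₀`, the cut is approximated by shrinking intervals (a n, b n). A pigeonhole argument
(`exists_split`) makes each of countably many least-witness functions avoid the next interval on all
arguments up to a n. Hence on bounded arguments a Σ⁰₁-formula has witnesses in the cut iff it has
witnesses below a fixed element of the cut (`Cut.exists_bound`), and the theorem of Łoś for bounded
formulas yields Σ⁰₁-induction. The sets are generated from the two sets describing the descent by
the operation "a witness for θ occurs before any counterexample to χ", which makes sense in the
whole ultrapower and realizes Δ⁰₁-comprehension in the cut. -/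

/-- Put `x` in front of the sequence `v`. -/
def scons {α : Type*} (x : α) (v : ℕ → α) : ℕ → α
  | 0 => x
  | i + 1 => v i

@[simp] theorem scons_zero {α : Type*} (x : α) (v : ℕ → α) : scons x v 0 = x := rfl
@[simp] theorem scons_succ {α : Type*} (x : α) (v : ℕ → α) (i : ℕ) :
    scons x v (i + 1) = v i := rfl
@[simp] theorem scons_one {α : Type*} (x : α) (v : ℕ → α) : scons x v 1 = v 0 := rfl

theorem Fm.instN_eq (φ : Fm) (t : Tm) : φ.instN t = φ.subst (scons t .var) id := by
  unfold Fm.instN; congr 1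

theorem Fm.instS_eq (φ : Fm) (X : ℕ) : φ.instS X = φ.subst .var (scons X id) := by
  unfold Fm.instS; congr 1

theorem Tm.subst_subst (t : Tm) (σ τ : ℕ → Tm) :
    (t.subst σ).subst τ = t.subst fun i => (σ i).subst τ := by
  induction t <;> simp_all [Tm.subst]

theorem Tm.subst_var (t : Tm) : t.subst .var = t := by
  induction t <;> simp_all [Tm.subst]

theorem upN_comp (σ τ : ℕ → Tm) :
    (fun i => (upN σ i).subst (upN τ)) = upN fun i => (σ i).subst τ := by
  funext i
  cases i with
  | zero => rfl
  | succ i => simp [upN, Tm.lift, Tm.subst_subst, Tm.subst]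

theorem upN_var : upN .var = .var := by
  funext i; cases i <;> rfl

theorem upS_comp (ρ π : ℕ → ℕ) : upS π ∘ upS ρ = upS (π ∘ ρ) := by
  funext i; cases i <;> rfl

theorem upS_id : upS id = id := by
  funext i; cases i <;> rfl

theorem Fm.subst_subst (φ : Fm) : ∀ (σ τ : ℕ → Tm) (ρ π : ℕ → ℕ),
    (φ.subst σ ρ).subst τ π = φ.subst (fun i => (σ i).subst τ) (π ∘ ρ) := by
  induction φ with
  | falsum => intros; rfl
  | eq s t => intros; simp [Fm.subst, Tm.subst_subst]
  | lt s t => intros; simp [Fm.subst, Tm.subst_subst]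
  | mem t X => intros; simp [Fm.subst, Tm.subst_subst]
  | imp φ ψ h₁ h₂ => intros; simp [Fm.subst, h₁, h₂]
  | allN φ h => intros; simp [Fm.subst, h, upN_comp]
  | allS φ h => intros; simp [Fm.subst, h, upS_comp]

theorem Fm.subst_id (φ : Fm) : φ.subst .var id = φ := by
  induction φ <;> simp_all [Fm.subst, Tm.subst_var, upN_var, upS_id]

/-! ### Variable bounds and locality of substitution -/

/-- A strict upper bound for the indices of variables in a term. -/
def Tm.bound : Tm → ℕ
  | .var i => i + 1
  | .zero => 0
  | .one => 0
  | .add s t => max s.bound t.bound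
  | .mul s t => max s.bound t.bound

/-- A strict upper bound for the indices of number variables in a formula. -/
def Fm.boundN : Fm → ℕ
  | .falsum => 0
  | .eq s t => max s.bound t.bound
  | .lt s t => max s.bound t.bound
  | .mem t _ => t.bound
  | .imp φ ψ => max φ.boundN ψ.boundN
  | .allN φ => φ.boundN
  | .allS φ => φ.boundN

/-- A strict upper bound for the indices of set variables in a formula. -/
def Fm.boundS : Fm → ℕ
  | .falsum => 0
  | .eq _ _ => 0
  | .lt _ _ => 0
  | .mem _ X => X + 1
  | .imp φ ψ => max φ.boundS ψ.boundS
  | .allN φ => φ.boundS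
  | .allS φ => φ.boundS

theorem Tm.subst_congr (t : Tm) {σ τ : ℕ → Tm} (h : ∀ i < t.bound, σ i = τ i) :
    t.subst σ = t.subst τ := by
  induction t with
  | var i => exact h i (Nat.lt_succ_self i)
  | zero => rfl
  | one => rfl
  | add s t hs ht =>
    simp only [Tm.bound, lt_max_iff] at h
    simp [Tm.subst, hs fun i hi => h i (.inl hi), ht fun i hi => h i (.inr hi)]
  | mul s t hs ht =>
    simp only [Tm.bound, lt_max_iff] at h
    simp [Tm.subst, hs fun i hi => h i (.inl hi), ht fun i hi => h i (.inr hi)]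

/-- The bounds are not lowered under quantifiers. They are crude, but the induction needs no
subtraction: if `i + 1` is below the bound, so is `i`. -/
theorem Fm.subst_congr (φ : Fm) : ∀ {σ τ : ℕ → Tm} {ρ π : ℕ → ℕ},
    (∀ i < φ.boundN, σ i = τ i) → (∀ i < φ.boundS, ρ i = π i) →
    φ.subst σ ρ = φ.subst τ π := by
  induction φ with
  | falsum => intros; rfl
  | eq s t =>
    intro σ τ ρ π h _
    simp only [Fm.boundN, lt_max_iff] at h
    simp [Fm.subst, s.subst_congr fun i hi => h i (.inl hi),
      t.subst_congr fun i hi => h i (.inr hi)]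
  | lt s t =>
    intro σ τ ρ π h _
    simp only [Fm.boundN, lt_max_iff] at h
    simp [Fm.subst, s.subst_congr fun i hi => h i (.inl hi),
      t.subst_congr fun i hi => h i (.inr hi)]
  | mem t X =>
    intro σ τ ρ π h h'
    simp [Fm.subst, t.subst_congr h, h' X (Nat.lt_succ_self X)]
  | imp φ ψ h₁ h₂ =>
    intro σ τ ρ π h h'
    simp only [Fm.boundN, Fm.boundS, lt_max_iff] at h h'
    simp [Fm.subst, h₁ (fun i hi => h i (.inl hi)) (fun i hi => h' i (.inl hi)),
      h₂ (fun i hi => h i (.inr hi)) (fun i hi => h' i (.inr hi))]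
  | allN φ ih =>
    intro σ τ ρ π h h'
    simp only [Fm.subst]
    rw [ih (fun i hi => ?_) h']
    cases i with
    | zero => rfl
    | succ i => simp [upN, h i ((Nat.lt_succ_self i).trans hi)]
  | allS φ ih =>
    intro σ τ ρ π h h'
    simp only [Fm.subst]
    rw [ih h (fun i hi => ?_)]
    cases i with
    | zero => rfl
    | succ i => simp [upS, h' i ((Nat.lt_succ_self i).trans hi)]

/-! ### Semantics -/

section Semantics

variable {N S : Type} [Zero N] [One N] [Add N] [Mul N]

/-- The value of a term. -/
def Tm.val (v : ℕ → N) : Tm → N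
  | .var i => v i
  | .zero => 0
  | .one => 1
  | .add s t => s.val v + t.val v
  | .mul s t => s.val v * t.val v

@[simp] theorem Tm.val_var (v : ℕ → N) (i : ℕ) : (♯i).val v = v i := rfl
@[simp] theorem Tm.val_zero (v : ℕ → N) : (0 : Tm).val v = 0 := rfl
@[simp] theorem Tm.val_one (v : ℕ → N) : (1 : Tm).val v = 1 := rfl
@[simp] theorem Tm.val_add (v : ℕ → N) (s t : Tm) : (s + t).val v = s.val v + t.val v := rfl
@[simp] theorem Tm.val_mul (v : ℕ → N) (s t : Tm) : (s * t).val v = s.val v * t.val v := rfl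

theorem Tm.val_subst (t : Tm) (σ : ℕ → Tm) (v : ℕ → N) :
    (t.subst σ).val v = t.val fun i => (σ i).val v := by
  induction t <;> simp_all [Tm.subst, Tm.val]

@[simp] theorem Tm.val_lift (t : Tm) (k : ℕ) (v : ℕ → N) :
    (t.lift k).val v = t.val fun i => v (i + k) := t.val_subst _ _

theorem Tm.val_congr (t : Tm) {v w : ℕ → N} (h : ∀ i < t.bound, v i = w i) :
    t.val v = t.val w := by
  induction t with
  | var i => exact h i (Nat.lt_succ_self i)
  | zero => rfl
  | one => rfl
  | add s t hs ht =>
    simp only [Tm.bound, lt_max_iff] at h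
    simp [Tm.val, hs fun i hi => h i (.inl hi), ht fun i hi => h i (.inr hi)]
  | mul s t hs ht =>
    simp only [Tm.bound, lt_max_iff] at h
    simp [Tm.val, hs fun i hi => h i (.inl hi), ht fun i hi => h i (.inr hi)]

variable [LT N] [Membership N S]

/-- Satisfaction in the structure with numbers `N` and sets `S`. -/
def Fm.Sat : Fm → (ℕ → N) → (ℕ → S) → Prop
  | .falsum, _, _ => False
  | .eq s t, v, _ => s.val v = t.val v
  | .lt s t, v, _ => s.val v < t.val v
  | .mem t X, v, s => t.val v ∈ s X
  | .imp φ ψ, v, s => φ.Sat v s → ψ.Sat v s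
  | .allN φ, v, s => ∀ x, φ.Sat (scons x v) s
  | .allS φ, v, s => ∀ X, φ.Sat v (scons X s)

theorem Fm.sat_subst (φ : Fm) : ∀ (σ : ℕ → Tm) (ρ : ℕ → ℕ) (v : ℕ → N) (s : ℕ → S),
    (φ.subst σ ρ).Sat v s ↔ φ.Sat (fun i => (σ i).val v) (fun i => s (ρ i)) := by
  induction φ with
  | falsum => intros; rfl
  | eq s t => intros; simp [Fm.subst, Fm.Sat, Tm.val_subst]
  | lt s t => intros; simp [Fm.subst, Fm.Sat, Tm.val_subst]
  | mem t X => intros; simp [Fm.subst, Fm.Sat, Tm.val_subst]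
  | imp φ ψ h₁ h₂ => intros; simp [Fm.subst, Fm.Sat, h₁, h₂]
  | allN φ ih =>
    intro σ ρ v s
    simp only [Fm.subst, Fm.Sat, ih]
    refine forall_congr' fun x => ?_
    have : (fun i => (upN σ i).val (scons x v)) = scons x fun i => (σ i).val v := by
      funext i; cases i <;> simp [upN]
    rw [this]
  | allS φ ih =>
    intro σ ρ v s
    simp only [Fm.subst, Fm.Sat, ih]
    refine forall_congr' fun x => ?_
    have : (fun i => scons x s (upS ρ i)) = scons x fun i => s (ρ i) := by
      funext i; cases i <;> simp [upS]
    rw [this]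

theorem Fm.sat_liftN (φ : Fm) (x : N) (v : ℕ → N) (s : ℕ → S) :
    φ.liftN.Sat (scons x v) s ↔ φ.Sat v s := φ.sat_subst _ _ _ _

theorem Fm.sat_liftS (φ : Fm) (X : S) (v : ℕ → N) (s : ℕ → S) :
    φ.liftS.Sat v (scons X s) ↔ φ.Sat v s := φ.sat_subst _ _ _ _

theorem Fm.sat_instN (φ : Fm) (t : Tm) (v : ℕ → N) (s : ℕ → S) :
    (φ.instN t).Sat v s ↔ φ.Sat (scons (t.val v) v) s := by
  rw [Fm.instN_eq, Fm.sat_subst]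
  have : (fun i => (scons t Tm.var i).val v) = scons (t.val v) v := by
    funext i; cases i <;> rfl
  simp [this]

theorem Fm.sat_instS (φ : Fm) (X : ℕ) (v : ℕ → N) (s : ℕ → S) :
    (φ.instS X).Sat v s ↔ φ.Sat v (scons (s X) s) := by
  rw [Fm.instS_eq, Fm.sat_subst]
  have : (fun i => s (scons X id i)) = scons (s X) s := by
    funext i; cases i <;> rfl
  simp [this]

theorem Fm.sat_instSucc (φ : Fm) (x : N) (v : ℕ → N) (s : ℕ → S) :
    φ.instSucc.Sat (scons x v) s ↔ φ.Sat (scons (x + 1) v) s := by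
  unfold Fm.instSucc
  rw [Fm.sat_subst]
  refine iff_of_eq (congrArg₂ _ ?_ rfl)
  funext i; cases i <;> rfl

@[simp] theorem sat_falsum (v : ℕ → N) (s : ℕ → S) : Fm.falsum.Sat v s ↔ False := Iff.rfl
@[simp] theorem sat_eq (a b : Tm) (v : ℕ → N) (s : ℕ → S) :
    (a ≐ b).Sat v s ↔ a.val v = b.val v := Iff.rfl
@[simp] theorem sat_lt (a b : Tm) (v : ℕ → N) (s : ℕ → S) :
    (a ≺ b).Sat v s ↔ a.val v < b.val v := Iff.rfl
@[simp] theorem sat_mem (a : Tm) (X : ℕ) (v : ℕ → N) (s : ℕ → S) :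
    (a ∊ X).Sat v s ↔ a.val v ∈ s X := Iff.rfl
@[simp] theorem sat_imp (φ ψ : Fm) (v : ℕ → N) (s : ℕ → S) :
    (φ ⟹ₐ ψ).Sat v s ↔ (φ.Sat v s → ψ.Sat v s) := Iff.rfl
@[simp] theorem sat_allN (φ : Fm) (v : ℕ → N) (s : ℕ → S) :
    φ.allN.Sat v s ↔ ∀ x, φ.Sat (scons x v) s := Iff.rfl
@[simp] theorem sat_allS (φ : Fm) (v : ℕ → N) (s : ℕ → S) :
    φ.allS.Sat v s ↔ ∀ X, φ.Sat v (scons X s) := Iff.rfl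
@[simp] theorem sat_neg (φ : Fm) (v : ℕ → N) (s : ℕ → S) : φ.neg.Sat v s ↔ ¬ φ.Sat v s := Iff.rfl
@[simp] theorem sat_and (φ ψ : Fm) (v : ℕ → N) (s : ℕ → S) :
    (φ ⋏ ψ).Sat v s ↔ φ.Sat v s ∧ ψ.Sat v s := by simp [Fm.and]
@[simp] theorem sat_or (φ ψ : Fm) (v : ℕ → N) (s : ℕ → S) :
    (φ ⋎ ψ).Sat v s ↔ φ.Sat v s ∨ ψ.Sat v s := by simp [Fm.or]; tauto
@[simp] theorem sat_iff (φ ψ : Fm) (v : ℕ → N) (s : ℕ → S) :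
    (φ ⟺ₐ ψ).Sat v s ↔ (φ.Sat v s ↔ ψ.Sat v s) := by simp [Fm.iff]; tauto
@[simp] theorem sat_exN (φ : Fm) (v : ℕ → N) (s : ℕ → S) :
    φ.exN.Sat v s ↔ ∃ x, φ.Sat (scons x v) s := by simp [Fm.exN]
@[simp] theorem sat_exS (φ : Fm) (v : ℕ → N) (s : ℕ → S) :
    φ.exS.Sat v s ↔ ∃ X, φ.Sat v (scons X s) := by simp [Fm.exS]
@[simp] theorem sat_ballN (t : Tm) (φ : Fm) (v : ℕ → N) (s : ℕ → S) :
    (Fm.ballN t φ).Sat v s ↔ ∀ x, x < t.val v → φ.Sat (scons x v) s := by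
  simp [Fm.ballN]

theorem Fm.sat_congr (φ : Fm) : ∀ {v w : ℕ → N} {s r : ℕ → S},
    (∀ i < φ.boundN, v i = w i) → (∀ i < φ.boundS, s i = r i) → (φ.Sat v s ↔ φ.Sat w r) := by
  induction φ with
  | falsum => intros; rfl
  | eq s t =>
    intro v w _ _ h _
    simp only [Fm.boundN, lt_max_iff] at h
    simp [s.val_congr fun i hi => h i (.inl hi), t.val_congr fun i hi => h i (.inr hi)]
  | lt s t =>
    intro v w _ _ h _
    simp only [Fm.boundN, lt_max_iff] at h
    simp [s.val_congr fun i hi => h i (.inl hi), t.val_congr fun i hi => h i (.inr hi)]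
  | mem t X =>
    intro v w s r h h'
    simp [t.val_congr h, h' X (Nat.lt_succ_self X)]
  | imp φ ψ h₁ h₂ =>
    intro v w s r h h'
    simp only [Fm.boundN, Fm.boundS, lt_max_iff] at h h'
    simp [h₁ (fun i hi => h i (.inl hi)) (fun i hi => h' i (.inl hi)),
      h₂ (fun i hi => h i (.inr hi)) (fun i hi => h' i (.inr hi))]
  | allN φ ih =>
    intro v w s r h h'
    refine forall_congr' fun x => ih (fun i hi => ?_) h'
    cases i with
    | zero => rfl
    | succ i => exact h i ((Nat.lt_succ_self i).trans hi)
  | allS φ ih =>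
    intro v w s r h h'
    refine forall_congr' fun x => ih h (fun i hi => ?_)
    cases i with
    | zero => rfl
    | succ i => exact h' i ((Nat.lt_succ_self i).trans hi)

theorem soundness {T : Set Fm} (hT : ∀ φ ∈ T, ∀ (v : ℕ → N) (s : ℕ → S), φ.Sat v s)
    {Γ : List Fm} {φ : Fm} (h : Prf T Γ φ) :
    ∀ (v : ℕ → N) (s : ℕ → S), (∀ ψ ∈ Γ, ψ.Sat v s) → φ.Sat v s := by
  induction h with
  | ax h => exact fun v s _ => hT _ h v s
  | hyp h => exact fun v s hΓ => hΓ _ h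
  | impI _ ih => exact fun v s hΓ hφ => ih v s (by simpa using ⟨hφ, hΓ⟩)
  | impE _ _ ih₁ ih₂ => exact fun v s hΓ => ih₁ v s hΓ (ih₂ v s hΓ)
  | byContra _ ih =>
    intro v s hΓ
    by_contra hφ
    exact ih v s (by simpa using ⟨hφ, hΓ⟩)
  | allNI _ ih =>
    intro v s hΓ x
    refine ih _ s ?_
    simpa [Fm.sat_liftN] using hΓ
  | allNE t _ ih => exact fun v s hΓ => (Fm.sat_instN _ _ _ _).2 (ih v s hΓ _)
  | allSI _ ih =>
    intro v s hΓ X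
    refine ih v _ ?_
    simpa [Fm.sat_liftS] using hΓ
  | allSE X _ ih => exact fun v s hΓ => (Fm.sat_instS _ _ _ _).2 (ih v s hΓ _)
  | eqRefl t => exact fun _ _ _ => rfl
  | eqSubst φ _ _ ih₁ ih₂ =>
    intro v s hΓ
    have h₁ := ih₁ v s hΓ
    have h₂ := ih₂ v s hΓ
    rw [Fm.sat_instN] at h₂ ⊢
    rw [sat_eq] at h₁
    rwa [← h₁]

end Semantics

/-! ### Completeness of the deduction system -/

def Tm.code : Tm → ℕ
  | .var i => Nat.pair 0 i
  | .zero => Nat.pair 1 0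
  | .one => Nat.pair 2 0
  | .add s t => Nat.pair 3 (Nat.pair s.code t.code)
  | .mul s t => Nat.pair 4 (Nat.pair s.code t.code)

theorem Tm.code_injective : Function.Injective Tm.code := by
  intro s
  induction s with
  | add s t h₁ h₂ =>
    intro u h
    cases u <;> simp [Tm.code, Nat.pair_eq_pair] at h ⊢
    exact ⟨h₁ h.1, h₂ h.2⟩
  | mul s t h₁ h₂ =>
    intro u h
    cases u <;> simp [Tm.code, Nat.pair_eq_pair] at h ⊢
    exact ⟨h₁ h.1, h₂ h.2⟩
  | _ =>
    intro u h
    cases u <;> simp_all [Tm.code, Nat.pair_eq_pair]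

def Fm.code : Fm → ℕ
  | .falsum => Nat.pair 0 0
  | .eq s t => Nat.pair 1 (Nat.pair s.code t.code)
  | .lt s t => Nat.pair 2 (Nat.pair s.code t.code)
  | .mem t X => Nat.pair 3 (Nat.pair t.code X)
  | .imp φ ψ => Nat.pair 4 (Nat.pair φ.code ψ.code)
  | .allN φ => Nat.pair 5 φ.code
  | .allS φ => Nat.pair 6 φ.code

theorem Fm.code_injective : Function.Injective Fm.code := by
  intro φ
  induction φ with
  | imp φ ψ h₁ h₂ =>
    intro χ h
    cases χ <;> simp [Fm.code, Nat.pair_eq_pair] at h ⊢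
    exact ⟨h₁ h.1, h₂ h.2⟩
  | allN φ ih =>
    intro χ h
    cases χ <;> simp [Fm.code, Nat.pair_eq_pair] at h ⊢
    exact ih h
  | allS φ ih =>
    intro χ h
    cases χ <;> simp [Fm.code, Nat.pair_eq_pair] at h ⊢
    exact ih h
  | _ =>
    intro χ h
    cases χ <;> simp_all [Fm.code, Nat.pair_eq_pair, Tm.code_injective.eq_iff]

instance : Countable Fm := Fm.code_injective.countable

instance : Nonempty Fm := ⟨.falsum⟩

variable {T : Set Fm}

/-! ### Admissible rules: weakening, substitution, generalization over fresh variables -/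

theorem Prf.weaken {Γ : List Fm} {φ : Fm} (h : Prf T Γ φ) :
    ∀ {Δ : List Fm}, Γ ⊆ Δ → Prf T Δ φ := by
  induction h with
  | ax h => exact fun _ => .ax h
  | hyp h => exact fun hs => .hyp (hs h)
  | impI _ ih => exact fun hs => .impI (ih (List.cons_subset_cons _ hs))
  | impE _ _ ih₁ ih₂ => exact fun hs => .impE (ih₁ hs) (ih₂ hs)
  | byContra _ ih => exact fun hs => .byContra (ih (List.cons_subset_cons _ hs))
  | allNI _ ih => exact fun hs => .allNI (ih (List.map_subset _ hs))
  | allNE t _ ih => exact fun hs => .allNE t (ih hs)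
  | allSI _ ih => exact fun hs => .allSI (ih (List.map_subset _ hs))
  | allSE X _ ih => exact fun hs => .allSE X (ih hs)
  | eqRefl t => exact fun _ => .eqRefl t
  | eqSubst φ _ _ ih₁ ih₂ => exact fun hs => .eqSubst φ (ih₁ hs) (ih₂ hs)

theorem Prf.exfalso {Γ : List Fm} {φ : Fm} (h : Prf T Γ .falsum) : Prf T Γ φ :=
  .byContra (h.weaken (List.subset_cons_self _ _))

/-- Since `φ` is derivable from every `Γ`, one can generalize and instantiate again and again; each
round fixes one more variable and moves the remaining ones down by one, whence `i - n`. -/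
theorem prf_subst_number {φ : Fm} (h : ∀ Γ, Prf T Γ φ) (n : ℕ) :
    ∀ (σ : ℕ → Tm) (Γ : List Fm),
      Prf T Γ (φ.subst (fun i => if i < n then σ i else ♯(i - n)) id) := by
  induction n with
  | zero => intro σ Γ; simpa [Fm.subst_id] using h Γ
  | succ n ih =>
    intro σ Γ
    have := Prf.allNE (σ n) (Prf.allNI (ih (fun i => (σ i).lift 1) (Γ.map Fm.liftN)))
    rw [Fm.instN_eq, Fm.subst_subst] at this
    refine Eq.mp (congrArg (fun σ => Prf T Γ (φ.subst σ id)) ?_) this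
    funext i
    rcases lt_trichotomy i n with hi | rfl | hi
    · simp [hi, hi.trans (Nat.lt_succ_self n), Tm.lift, Tm.subst_subst, Tm.subst, Tm.subst_var]
    · simp [Tm.subst]
    · obtain ⟨j, rfl⟩ := Nat.exists_eq_add_of_lt hi
      simp [Tm.subst, show ¬ n + j + 1 < n by omega, show n + j + 1 - n = j + 1 by omega]

theorem prf_subst_set {φ : Fm} (h : ∀ Γ, Prf T Γ φ) (n : ℕ) :
    ∀ (ρ : ℕ → ℕ) (Γ : List Fm),
      Prf T Γ (φ.subst .var (fun i => if i < n then ρ i else i - n)) := by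
  induction n with
  | zero =>
    intro ρ Γ
    have := h Γ
    rw [← Fm.subst_id φ] at this
    exact this
  | succ n ih =>
    intro ρ Γ
    have := Prf.allSE (ρ n) (Prf.allSI (ih (fun i => ρ i + 1) (Γ.map Fm.liftS)))
    rw [Fm.instS_eq, Fm.subst_subst] at this
    refine Eq.mp (congrArg (fun ρ => Prf T Γ (φ.subst .var ρ)) ?_) this
    funext i
    rcases lt_trichotomy i n with hi | rfl | hi
    · simp [hi, hi.trans (Nat.lt_succ_self n)]
    · simp
    · obtain ⟨j, rfl⟩ := Nat.exists_eq_add_of_lt hi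
      simp [show ¬ n + j + 1 < n by omega, show n + j + 1 - n = j + 1 by omega]

/-- With `n` above all variables of `φ`, the shifted tails in the two preceding lemmas do not
matter. -/
theorem Prf.ax_subst {φ : Fm} (h : φ ∈ T) (σ : ℕ → Tm) (ρ : ℕ → ℕ) (Γ : List Fm) :
    Prf T Γ (φ.subst σ ρ) := by
  have h₁ := prf_subst_set (fun Γ => Prf.ax (Γ := Γ) h) φ.boundS ρ
  have h₂ := prf_subst_number h₁ φ.boundN σ Γ
  rw [Fm.subst_subst] at h₂
  rwa [φ.subst_congr (τ := σ) (π := ρ)] at h₂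
  · intro i hi
    simp [Tm.subst, hi]
  · intro i hi
    simp [hi]

theorem Fm.subst_liftN (φ : Fm) (σ : ℕ → Tm) (ρ : ℕ → ℕ) :
    φ.liftN.subst (upN σ) ρ = (φ.subst σ ρ).liftN := by
  simp only [Fm.liftN, Fm.subst_subst]; rfl

theorem Fm.subst_liftS (φ : Fm) (σ : ℕ → Tm) (ρ : ℕ → ℕ) :
    φ.liftS.subst σ (upS ρ) = (φ.subst σ ρ).liftS := by
  simp only [Fm.liftS, Fm.subst_subst, Tm.subst_var]; rfl

theorem Fm.subst_upN_instN (φ : Fm) (σ : ℕ → Tm) (ρ : ℕ → ℕ) (t : Tm) :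
    (φ.subst (upN σ) ρ).instN t = φ.subst (scons t σ) ρ := by
  rw [Fm.instN_eq, Fm.subst_subst]
  congr 1
  funext i
  cases i <;> simp [upN, Tm.lift, Tm.subst_subst, Tm.subst, Tm.subst_var]

theorem Fm.subst_upS_instS (φ : Fm) (σ : ℕ → Tm) (ρ : ℕ → ℕ) (X : ℕ) :
    (φ.subst σ (upS ρ)).instS X = φ.subst σ (scons X ρ) := by
  rw [Fm.instS_eq, Fm.subst_subst]
  simp only [Tm.subst_var]
  congr 1
  funext i
  cases i <;> rfl

theorem Fm.subst_instN (φ : Fm) (σ : ℕ → Tm) (ρ : ℕ → ℕ) (t : Tm) :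
    (φ.instN t).subst σ ρ = (φ.subst (upN σ) ρ).instN (t.subst σ) := by
  rw [Fm.subst_upN_instN, Fm.instN_eq, Fm.subst_subst]
  congr 1
  funext i
  cases i <;> rfl

theorem Fm.subst_instS (φ : Fm) (σ : ℕ → Tm) (ρ : ℕ → ℕ) (X : ℕ) :
    (φ.instS X).subst σ ρ = (φ.subst σ (upS ρ)).instS (ρ X) := by
  rw [Fm.subst_upS_instS, Fm.instS_eq, Fm.subst_subst]
  congr 1
  funext i
  cases i <;> rfl

theorem Prf.subst {Γ : List Fm} {φ : Fm} (h : Prf T Γ φ) :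
    ∀ (σ : ℕ → Tm) (ρ : ℕ → ℕ), Prf T (Γ.map (Fm.subst σ ρ)) (φ.subst σ ρ) := by
  induction h with
  | ax h => exact fun σ ρ => Prf.ax_subst h σ ρ _
  | hyp h => exact fun σ ρ => .hyp (List.mem_map_of_mem h)
  | impI _ ih => exact fun σ ρ => .impI (ih σ ρ)
  | impE _ _ ih₁ ih₂ => exact fun σ ρ => .impE (ih₁ σ ρ) (ih₂ σ ρ)
  | byContra _ ih => exact fun σ ρ => .byContra (ih σ ρ)
  | allNI _ ih =>
    intro σ ρ
    refine .allNI ?_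
    have := ih (upN σ) ρ
    simpa [Function.comp_def, Fm.subst_liftN] using this
  | allNE t _ ih =>
    intro σ ρ
    rw [Fm.subst_instN]
    exact .allNE _ (ih σ ρ)
  | allSI _ ih =>
    intro σ ρ
    refine .allSI ?_
    have := ih σ (upS ρ)
    simpa [Function.comp_def, Fm.subst_liftS] using this
  | allSE X _ ih =>
    intro σ ρ
    rw [Fm.subst_instS]
    exact .allSE _ (ih σ ρ)
  | eqRefl t => exact fun σ ρ => .eqRefl _
  | eqSubst φ _ _ ih₁ ih₂ =>
    intro σ ρ
    rw [Fm.subst_instN]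
    refine .eqSubst _ (ih₁ σ ρ) ?_
    rw [← Fm.subst_instN]
    exact ih₂ σ ρ

theorem exists_bound (f : Fm → ℕ) (Γ : List Fm) : ∃ k, ∀ ψ ∈ Γ, f ψ ≤ k := by
  induction Γ with
  | nil => exact ⟨0, by simp⟩
  | cons ψ Γ ih =>
    obtain ⟨k, hk⟩ := ih
    refine ⟨max k (f ψ), fun χ hχ => ?_⟩
    rcases List.mem_cons.1 hχ with rfl | h
    · exact le_max_right _ _
    · exact (hk χ h).trans (le_max_left _ _)

/-- A variable that is too large to occur acts as a fresh constant: sending it to `♯0` and shifting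
all others up turns the hypothesis into the premise of `allNI`. -/
theorem Prf.generalizeN {Γ : List Fm} {φ : Fm} {k : ℕ} (hΓ : ∀ ψ ∈ Γ, ψ.boundN ≤ k)
    (hφ : φ.boundN ≤ k) (h : Prf T Γ (φ.instN ♯k)) : Prf T Γ φ.allN := by
  refine .allNI ?_
  have := h.subst (fun i => if i = k then ♯0 else ♯(i + 1)) id
  rw [Fm.instN_eq, Fm.subst_subst, φ.subst_congr (τ := .var) (π := id), Fm.subst_id] at this
  · convert this using 1
    refine List.map_congr_left fun ψ hψ => ψ.subst_congr (fun i hi => ?_) (fun _ _ => rfl)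
    have := (hi.trans_le (hΓ ψ hψ)).ne
    simp [this]
  · intro i hi
    cases i with
    | zero => simp [Tm.subst]
    | succ i =>
      have : i ≠ k := by omega
      simp [Tm.subst, this]
  · intro i _
    rfl

theorem Prf.generalizeS {Γ : List Fm} {φ : Fm} {k : ℕ} (hΓ : ∀ ψ ∈ Γ, ψ.boundS ≤ k)
    (hφ : φ.boundS ≤ k) (h : Prf T Γ (φ.instS k)) : Prf T Γ φ.allS := by
  refine .allSI ?_
  have := h.subst .var (fun i => if i = k then 0 else i + 1)
  rw [Fm.instS_eq, Fm.subst_subst, φ.subst_congr (τ := .var) (π := id), Fm.subst_id] at this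
  · convert this using 1
    refine List.map_congr_left fun ψ hψ => ψ.subst_congr (fun _ _ => rfl) (fun i hi => ?_)
    have := (hi.trans_le (hΓ ψ hψ)).ne
    simp [this]
  · intro i _
    rfl
  · intro i hi
    cases i with
    | zero => simp
    | succ i =>
      have : i ≠ k := by omega
      simp [this]

/-- The hypotheses `Γ` decide `φ`, with a counterexample if `φ` is a refuted universal formula. -/
def Decides (T : Set Fm) (Γ : List Fm) (φ : Fm) : Prop :=
  Prf T Γ φ ∨ (Prf T Γ φ.neg ∧ (∀ θ, φ = .allN θ → ∃ t, Prf T Γ (θ.instN t).neg) ∧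
    ∀ θ, φ = .allS θ → ∃ X, Prf T Γ (θ.instS X).neg)

/-- A finite list of hypotheses leaves unused variables, and these serve as counterexamples to
refuted universal formulas. The language needs no new constants. -/
theorem exists_decides {Γ : List Fm} (hΓ : ¬ Prf T Γ .falsum) (φ : Fm) :
    ∃ Δ, Γ ⊆ Δ ∧ ¬ Prf T Δ .falsum ∧ Decides T Δ φ := by
  by_cases h : Prf T Γ φ
  · exact ⟨Γ, List.Subset.refl _, hΓ, .inl h⟩
  have hn : ¬ Prf T (φ.neg :: Γ) .falsum := fun h' => h (.byContra h')
  cases φ with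
  | allN θ =>
    obtain ⟨k, hk⟩ := exists_bound Fm.boundN (θ :: θ.allN.neg :: Γ)
    refine ⟨(θ.instN ♯k).neg :: θ.allN.neg :: Γ, ?_, fun h' => hn ?_,
      .inr ⟨.hyp (by simp), ?_, ?_⟩⟩
    · exact List.Subset.trans (List.subset_cons_self _ _) (List.subset_cons_self _ _)
    · have := Prf.generalizeN (fun ψ hψ => hk ψ (List.mem_cons_of_mem _ hψ))
        (hk θ (by simp)) (.byContra h')
      exact .impE (.hyp (List.mem_cons_self ..)) this
    · rintro _ ⟨⟩
      exact ⟨_, .hyp (List.mem_cons_self ..)⟩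
    · rintro _ ⟨⟩
  | allS θ =>
    obtain ⟨k, hk⟩ := exists_bound Fm.boundS (θ :: θ.allS.neg :: Γ)
    refine ⟨(θ.instS k).neg :: θ.allS.neg :: Γ, ?_, fun h' => hn ?_,
      .inr ⟨.hyp (by simp), ?_, ?_⟩⟩
    · exact List.Subset.trans (List.subset_cons_self _ _) (List.subset_cons_self _ _)
    · have := Prf.generalizeS (fun ψ hψ => hk ψ (List.mem_cons_of_mem _ hψ))
        (hk θ (by simp)) (.byContra h')
      exact .impE (.hyp (List.mem_cons_self ..)) this
    · rintro _ ⟨⟩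
    · rintro _ ⟨⟩
      exact ⟨_, .hyp (List.mem_cons_self ..)⟩
  | _ =>
    refine ⟨_, List.subset_cons_self _ _, hn, .inr ⟨.hyp (List.mem_cons_self ..), ?_, ?_⟩⟩ <;>
    rintro _ ⟨⟩

/-! ### Henkin sets and the term model -/

/-- Deductively closed, complete sets of formulas with witnesses. -/
structure IsHenkin (T : Set Fm) (D : Fm → Prop) : Prop where
  falsum : ¬ D .falsum
  imp (φ ψ : Fm) : D (.imp φ ψ) ↔ (D φ → D ψ)
  allN (φ : Fm) : D φ.allN ↔ ∀ t, D (φ.instN t)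
  allS (φ : Fm) : D φ.allS ↔ ∀ X, D (φ.instS X)
  eqRefl (t : Tm) : D (t ≐ t)
  eqSubst (φ : Fm) {s t : Tm} : D (s ≐ t) → D (φ.instN s) → D (φ.instN t)
  ax_subst {φ : Fm} (h : φ ∈ T) (σ : ℕ → Tm) (ρ : ℕ → ℕ) : D (φ.subst σ ρ)

theorem exists_henkin {Γ : List Fm} (hΓ : ¬ Prf T Γ .falsum) :
    ∃ D : Fm → Prop, IsHenkin T D ∧ ∀ φ ∈ Γ, D φ := by
  obtain ⟨f, hf⟩ := exists_surjective_nat Fm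
  choose step hs₁ hs₂ hs₃ using
    fun (Γ : {Γ : List Fm // ¬ Prf T Γ .falsum}) (φ : Fm) => exists_decides Γ.2 φ
  -- Stage `n + 1` decides the `n`-th formula and stays consistent. The Henkin set consists of what
  -- is derivable at some stage.
  let G : ℕ → {Γ : List Fm // ¬ Prf T Γ .falsum} := fun n =>
    Nat.rec ⟨Γ, hΓ⟩ (fun n Δ => ⟨step Δ (f n), hs₂ Δ (f n)⟩) n
  have hmono : Monotone fun n => {φ | φ ∈ (G n).1} :=
    monotone_nat_of_le_succ fun n φ hφ => hs₁ (G n) (f n) hφ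
  have hdec (φ : Fm) : ∃ n, Decides T (G n).1 φ := by
    obtain ⟨n, rfl⟩ := hf φ
    exact ⟨n + 1, hs₃ (G n) (f n)⟩
  let D : Fm → Prop := fun φ => ∃ n, Prf T (G n).1 φ
  have up {m n : ℕ} (h : m ≤ n) {φ : Fm} (hφ : Prf T (G m).1 φ) : Prf T (G n).1 φ :=
    hφ.weaken fun _ hψ => hmono h hψ
  have mp {φ ψ : Fm} : D (.imp φ ψ) → D φ → D ψ := by
    rintro ⟨m, hm⟩ ⟨n, hn⟩
    exact ⟨max m n, .impE (up (le_max_left _ _) hm) (up (le_max_right _ _) hn)⟩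
  have con : ¬ D .falsum := fun ⟨n, hn⟩ => (G n).2 hn
  refine ⟨D, ⟨con, fun φ ψ => ⟨mp, fun h => ?_⟩, fun φ => ⟨?_, fun h => ?_⟩,
    fun φ => ⟨?_, fun h => ?_⟩, fun t => ⟨0, .eqRefl t⟩, ?_, ?_⟩, fun φ hφ => ⟨0, .hyp hφ⟩⟩
  · obtain ⟨n, hn | ⟨hn, -⟩⟩ := hdec φ
    · obtain ⟨m, hm⟩ := h ⟨n, hn⟩
      exact ⟨m, .impI (hm.weaken (List.subset_cons_self _ _))⟩
    · refine ⟨n, .impI (.exfalso (.impE (hn.weaken (List.subset_cons_self _ _)) (.hyp ?_)))⟩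
      exact List.mem_cons_self ..
  · rintro ⟨n, hn⟩ t
    exact ⟨n, .allNE t hn⟩
  · obtain ⟨n, hn | ⟨-, hn, -⟩⟩ := hdec φ.allN
    · exact ⟨n, hn⟩
    · obtain ⟨t, ht⟩ := hn φ rfl
      exact (con (mp ⟨n, ht⟩ (h t))).elim
  · rintro ⟨n, hn⟩ X
    exact ⟨n, .allSE X hn⟩
  · obtain ⟨n, hn | ⟨-, -, hn⟩⟩ := hdec φ.allS
    · exact ⟨n, hn⟩
    · obtain ⟨X, hX⟩ := hn φ rfl
      exact (con (mp ⟨n, hX⟩ (h X))).elim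
  · rintro φ s t ⟨m, hm⟩ ⟨n, hn⟩
    exact ⟨max m n, .eqSubst φ (up (le_max_left _ _) hm) (up (le_max_right _ _) hn)⟩
  · exact fun h σ ρ => ⟨0, .ax_subst h σ ρ _⟩

namespace IsHenkin

variable {D : Fm → Prop} (hD : IsHenkin T D)
include hD

/-- Replace `s` by `t` in a context given by a number variable. -/
theorem replace {s t : Tm} (h : D (s ≐ t)) (φ : Fm) (h' : D (φ.subst (scons s .var) id)) :
    D (φ.subst (scons t .var) id) := by
  rw [← Fm.instN_eq] at *
  exact hD.eqSubst φ h h'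

theorem eq_symm {s t : Tm} (h : D (s ≐ t)) : D (t ≐ s) := by
  have := hD.replace h (♯0 ≐ s.lift 1) (by
    simpa [Fm.subst, Tm.subst, Tm.lift, Tm.subst_subst, Tm.subst_var] using hD.eqRefl s)
  simpa [Fm.subst, Tm.subst, Tm.lift, Tm.subst_subst, Tm.subst_var] using this

theorem eq_trans {s t u : Tm} (h : D (s ≐ t)) (h' : D (t ≐ u)) : D (s ≐ u) := by
  have := hD.replace h' (s.lift 1 ≐ ♯0) (by
    simpa [Fm.subst, Tm.subst, Tm.lift, Tm.subst_subst, Tm.subst_var] using h)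
  simpa [Fm.subst, Tm.subst, Tm.lift, Tm.subst_subst, Tm.subst_var] using this

theorem eq_add {s t s' t' : Tm} (h : D (s ≐ t)) (h' : D (s' ≐ t')) :
    D (.add s s' ≐ .add t t') := by
  have h₁ := hD.replace h (.add (s.lift 1) (s'.lift 1) ≐ .add ♯0 (s'.lift 1)) (by
    simpa [Fm.subst, Tm.subst, Tm.lift, Tm.subst_subst, Tm.subst_var] using hD.eqRefl _)
  have h₂ := hD.replace h' (.add (t.lift 1) (s'.lift 1) ≐ .add (t.lift 1) ♯0) (by
    simpa [Fm.subst, Tm.subst, Tm.lift, Tm.subst_subst, Tm.subst_var] using hD.eqRefl _)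
  simp only [Fm.subst, Tm.subst, Tm.lift, Tm.subst_subst, scons_zero, scons_succ,
    Tm.subst_var] at h₁ h₂
  exact hD.eq_trans h₁ h₂

theorem eq_mul {s t s' t' : Tm} (h : D (s ≐ t)) (h' : D (s' ≐ t')) :
    D (.mul s s' ≐ .mul t t') := by
  have h₁ := hD.replace h (.mul (s.lift 1) (s'.lift 1) ≐ .mul ♯0 (s'.lift 1)) (by
    simpa [Fm.subst, Tm.subst, Tm.lift, Tm.subst_subst, Tm.subst_var] using hD.eqRefl _)
  have h₂ := hD.replace h' (.mul (t.lift 1) (s'.lift 1) ≐ .mul (t.lift 1) ♯0) (by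
    simpa [Fm.subst, Tm.subst, Tm.lift, Tm.subst_subst, Tm.subst_var] using hD.eqRefl _)
  simp only [Fm.subst, Tm.subst, Tm.lift, Tm.subst_subst, scons_zero, scons_succ,
    Tm.subst_var] at h₁ h₂
  exact hD.eq_trans h₁ h₂

theorem lt_congr {s t s' t' : Tm} (h : D (s ≐ t)) (h' : D (s' ≐ t')) (hs : D (s ≺ s')) :
    D (t ≺ t') := by
  have h₁ := hD.replace h (♯0 ≺ s'.lift 1) (by
    simpa [Fm.subst, Tm.subst, Tm.lift, Tm.subst_subst, Tm.subst_var] using hs)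
  simp only [Fm.subst, Tm.subst, Tm.lift, Tm.subst_subst, scons_zero, scons_succ,
    Tm.subst_var] at h₁
  have h₂ := hD.replace h' (t.lift 1 ≺ ♯0) (by
    simpa [Fm.subst, Tm.subst, Tm.lift, Tm.subst_subst, Tm.subst_var] using h₁)
  simpa [Fm.subst, Tm.subst, Tm.lift, Tm.subst_subst, Tm.subst_var] using h₂

theorem mem_congr {s t : Tm} (X : ℕ) (h : D (s ≐ t)) (hs : D (s ∊ X)) : D (t ∊ X) := by
  simpa [Fm.subst, Tm.subst] using hD.replace h (♯0 ∊ X) (by simpa [Fm.subst, Tm.subst] using hs)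

/-- Equality of terms according to `D`. -/
def setoid : Setoid Tm where
  r s t := D (s ≐ t)
  iseqv := ⟨hD.eqRefl, hD.eq_symm, hD.eq_trans⟩

/-- Every Henkin set has a model. -/
theorem exists_model (φ : Fm) (hφ : ¬ D φ)
    (h : ∀ (N S : Type) [Zero N] [One N] [Add N] [Mul N] [LT N] [Membership N S],
      (∀ ψ ∈ T, ∀ (v : ℕ → N) (s : ℕ → S), ψ.Sat v s) →
      ∀ (v : ℕ → N) (s : ℕ → S), φ.Sat v s) : False := by
  -- Numbers are terms modulo equality in `D`; sets are the set variables themselves.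
  let N := Quotient hD.setoid
  let _ : Zero N := ⟨Quotient.mk _ .zero⟩
  let _ : One N := ⟨Quotient.mk _ .one⟩
  let _ : Add N := ⟨Quotient.map₂ .add fun _ _ h _ _ h' => hD.eq_add h h'⟩
  let _ : Mul N := ⟨Quotient.map₂ .mul fun _ _ h _ _ h' => hD.eq_mul h h'⟩
  let _ : LT N := ⟨Quotient.lift₂ (fun s t => D (s ≺ t)) fun _ _ _ _ h h' =>
    propext ⟨hD.lt_congr h h', hD.lt_congr (hD.eq_symm h) (hD.eq_symm h')⟩⟩
  let _ : Membership N ℕ := ⟨fun X => Quotient.lift (fun t => D (t ∊ X)) fun _ _ h =>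
    propext ⟨hD.mem_congr X h, hD.mem_congr X (hD.eq_symm h)⟩⟩
  have val (t : Tm) (σ : ℕ → Tm) :
      t.val (fun i => (Quotient.mk _ (σ i) : N)) = Quotient.mk _ (t.subst σ) := by
    induction t with
    | var i => rfl
    | zero => rfl
    | one => rfl
    | add s t hs ht => simp only [Tm.val, hs, ht]; rfl
    | mul s t hs ht => simp only [Tm.val, hs, ht]; rfl
  have truth (ψ : Fm) : ∀ (σ : ℕ → Tm) (ρ : ℕ → ℕ),
      ψ.Sat (fun i => (Quotient.mk _ (σ i) : N)) ρ ↔ D (ψ.subst σ ρ) := by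
    induction ψ with
    | falsum => exact fun _ _ => ⟨False.elim, hD.falsum⟩
    | eq s t =>
      intro σ ρ
      rw [sat_eq, val, val]
      exact Quotient.eq (r := hD.setoid)
    | lt s t =>
      intro σ ρ
      rw [sat_lt, val, val]
      rfl
    | mem t X =>
      intro σ ρ
      rw [sat_mem, val]
      rfl
    | imp φ ψ h₁ h₂ =>
      intro σ ρ
      rw [sat_imp, h₁, h₂]
      exact (hD.imp _ _).symm
    | allN φ ih =>
      intro σ ρ
      simp only [sat_allN, Fm.subst, hD.allN, Fm.subst_upN_instN, ← ih]
      have key (t : Tm) : scons (Quotient.mk hD.setoid t) (fun i => (Quotient.mk _ (σ i) : N)) =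
          fun i => Quotient.mk _ (scons t σ i) := by
        funext i; cases i <;> rfl
      exact ⟨fun h t => key t ▸ h _, fun h => Quotient.ind fun t => (key t).symm ▸ h t⟩
    | allS φ ih =>
      intro σ ρ
      simp only [sat_allS, Fm.subst, hD.allS, Fm.subst_upS_instS, ← ih]
  have := h N ℕ (fun ψ hψ v s => ?_) (fun i => Quotient.mk _ ♯i) id
  · rw [truth, Fm.subst_id] at this
    exact hφ this
  -- Representatives turn an arbitrary assignment into a substitution, so the axioms hold because
  -- `D` contains all their substitution instances.
  · have hv : v = fun i => Quotient.mk _ (v i).out := by funext i; simp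
    rw [hv, truth]
    exact hD.ax_subst hψ _ _

end IsHenkin

theorem completeness {φ : Fm}
    (h : ∀ (N S : Type) [Zero N] [One N] [Add N] [Mul N] [LT N] [Membership N S],
      (∀ ψ ∈ T, ∀ (v : ℕ → N) (s : ℕ → S), ψ.Sat v s) →
      ∀ (v : ℕ → N) (s : ℕ → S), φ.Sat v s) : Proves T φ := by
  refine .byContra (by_contra fun hcon => ?_)
  obtain ⟨D, hD, hΓ⟩ := exists_henkin hcon
  refine hD.exists_model φ (fun hφ => ?_) h
  exact hD.falsum ((hD.imp φ .falsum).1 (hΓ φ.neg (List.mem_cons_self ..)) hφ)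

set_option linter.unusedSectionVars false

/-! ### Definable predicates, with parameters -/

theorem IsBounded.subst {φ : Fm} (h : IsBounded φ) :
    ∀ (σ : ℕ → Tm) (ρ : ℕ → ℕ), IsBounded (φ.subst σ ρ) := by
  induction h with
  | falsum => exact fun _ _ => .falsum
  | eq s t => exact fun _ _ => .eq _ _
  | lt s t => exact fun _ _ => .lt _ _
  | mem t X => exact fun _ _ => .mem _ _
  | imp _ _ h₁ h₂ => exact fun σ ρ => .imp (h₁ σ ρ) (h₂ σ ρ)
  | ballN t _ ih =>
    intro σ ρ
    have := IsBounded.ballN (t.subst σ) (ih (upN σ) ρ)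
    simpa [Fm.ballN, Fm.subst, upN, Tm.subst, Tm.lift, Tm.subst_subst] using this

section Definability

variable {N S : Type} [Zero N] [One N] [Add N] [Mul N]

/-- The assignment obtained from `v` when each variable stands for a parameter or an entry of
`v`. -/
def interp (w : ℕ → N ⊕ ℕ) (v : ℕ → N) (i : ℕ) : N := Sum.elim id v (w i)

/-- The sequence with even entries from `a` and odd entries from `b`. -/
def interleave {α : Type*} (a b : ℕ → α) (i : ℕ) : α :=
  if i % 2 = 0 then a (i / 2) else b (i / 2)

@[simp] theorem interleave_even {α : Type*} (a b : ℕ → α) (i : ℕ) :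
    interleave a b (2 * i) = a i := by simp [interleave]

@[simp] theorem interleave_odd {α : Type*} (a b : ℕ → α) (i : ℕ) :
    interleave a b (2 * i + 1) = b i := by
  simp [interleave, show (2 * i + 1) % 2 = 1 by omega, show (2 * i + 1) / 2 = i by omega]

@[simp] theorem interp_interleave_even (a b : ℕ → N ⊕ ℕ) (v : ℕ → N) (i : ℕ) :
    interp (interleave a b) v (2 * i) = interp a v i := by simp [interp]

@[simp] theorem interp_interleave_odd (a b : ℕ → N ⊕ ℕ) (v : ℕ → N) (i : ℕ) :
    interp (interleave a b) v (2 * i + 1) = interp b v i := by simp [interp]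

/-- Functions of an assignment that are given by a term with parameters. -/
class IsTerm (f : (ℕ → N) → N) : Prop where
  out : ∃ (t : Tm) (w : ℕ → N ⊕ ℕ), ∀ v, f v = t.val (interp w v)

instance IsTerm.const (c : N) : IsTerm fun _ => c := ⟨♯0, fun _ => .inl c, fun _ => rfl⟩

instance IsTerm.var (i : ℕ) : IsTerm fun v : ℕ → N => v i := ⟨♯0, fun _ => .inr i, fun _ => rfl⟩

/-- Two terms with unrelated parameters get a common assignment by moving one to the even and the
other to the odd variables. -/
theorem IsTerm.binary {f g : (ℕ → N) → N} [hf : IsTerm f] [hg : IsTerm g] :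
    ∃ (s t : Tm) (w : ℕ → N ⊕ ℕ), ∀ v, f v = s.val (interp w v) ∧ g v = t.val (interp w v) := by
  obtain ⟨s, w, hs⟩ := hf
  obtain ⟨t, w', ht⟩ := hg
  exact ⟨s.subst fun i => ♯(2 * i), t.subst fun i => ♯(2 * i + 1), interleave w w', fun v => by
    simp [hs, ht, Tm.val_subst]⟩

instance IsTerm.add (f g : (ℕ → N) → N) [IsTerm f] [IsTerm g] : IsTerm fun v => f v + g v := by
  obtain ⟨s, t, w, h⟩ := IsTerm.binary (f := f) (g := g)
  exact ⟨s + t, w, fun v => by simp [h]⟩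

instance IsTerm.mul (f g : (ℕ → N) → N) [IsTerm f] [IsTerm g] : IsTerm fun v => f v * g v := by
  obtain ⟨s, t, w, h⟩ := IsTerm.binary (f := f) (g := g)
  exact ⟨s * t, w, fun v => by simp [h]⟩

variable [LT N] [Membership N S]

variable (S) in
/-- Predicates that are given by a bounded formula with parameters. -/
class D0 (P : (ℕ → N) → Prop) : Prop where
  out : ∃ θ, IsBounded θ ∧ ∃ (w : ℕ → N ⊕ ℕ) (s : ℕ → S), ∀ v, P v ↔ θ.Sat (interp w v) s

variable (S) in
/-- Predicates that are given by a `Σ⁰₁`-formula with parameters. -/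
class S1 (P : (ℕ → N) → Prop) : Prop where
  out : ∃ Q : (ℕ → N) → Prop, D0 S Q ∧ ∀ v, P v ↔ ∃ y, Q (scons y v)

theorem D0.congr {P Q : (ℕ → N) → Prop} (h : D0 S P) (hPQ : ∀ v, Q v ↔ P v) : D0 S Q := by
  obtain ⟨θ, hθ, w, s, hw⟩ := h
  exact ⟨θ, hθ, w, s, fun v => (hPQ v).trans (hw v)⟩

theorem S1.congr {P Q : (ℕ → N) → Prop} (h : S1 S P) (hPQ : ∀ v, Q v ↔ P v) : S1 S Q := by
  obtain ⟨R, hR, hw⟩ := h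
  exact ⟨R, hR, fun v => (hPQ v).trans (hw v)⟩

instance D0.mem (f : (ℕ → N) → N) [hf : IsTerm f] (X : S) : D0 S fun v => f v ∈ X := by
  obtain ⟨t, w, h⟩ := hf
  exact ⟨t ∊ 0, .mem _ _, w, fun _ => X, fun v => by simp [h]⟩

instance D0.imp (P Q : (ℕ → N) → Prop) [hP : D0 S P] [hQ : D0 S Q] :
    D0 S fun v => P v → Q v := by
  obtain ⟨θ, hθ, w, s, h⟩ := hP
  obtain ⟨χ, hχ, w', s', h'⟩ := hQ
  refine ⟨θ.subst (fun i => ♯(2 * i)) (fun i => 2 * i) ⟹ₐ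
    χ.subst (fun i => ♯(2 * i + 1)) (fun i => 2 * i + 1), .imp (hθ.subst _ _) (hχ.subst _ _),
    interleave w w', interleave s s', fun v => ?_⟩
  simp only [h, h', sat_imp, Fm.sat_subst, Tm.val_var, interp_interleave_even,
    interp_interleave_odd, interleave_even, interleave_odd]

variable [Nonempty S]

instance D0.eq (f g : (ℕ → N) → N) [IsTerm f] [IsTerm g] : D0 S fun v => f v = g v := by
  obtain ⟨s, t, w, h⟩ := IsTerm.binary (f := f) (g := g)
  exact ⟨s ≐ t, .eq _ _, w, fun _ => Classical.arbitrary S, fun v => by simp [h]⟩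

instance D0.lt (f g : (ℕ → N) → N) [IsTerm f] [IsTerm g] : D0 S fun v => f v < g v := by
  obtain ⟨s, t, w, h⟩ := IsTerm.binary (f := f) (g := g)
  exact ⟨s ≺ t, .lt _ _, w, fun _ => Classical.arbitrary S, fun v => by simp [h]⟩

instance D0.false : D0 S fun _ : ℕ → N => False :=
  ⟨.falsum, .falsum, fun _ => .inr 0, fun _ => Classical.arbitrary S, fun _ => Iff.rfl⟩

instance D0.not (P : (ℕ → N) → Prop) [D0 S P] : D0 S fun v => ¬ P v := D0.imp P fun _ => False

instance D0.const (p : Prop) : D0 S fun _ : ℕ → N => p := by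
  by_cases h : p
  · exact (inferInstance : D0 S fun _ : ℕ → N => ¬ False).congr (by simp [h])
  · exact D0.congr D0.false (by simp [h])

instance D0.or (P Q : (ℕ → N) → Prop) [D0 S P] [D0 S Q] : D0 S fun v => P v ∨ Q v :=
  (inferInstance : D0 S fun v : ℕ → N => ¬ P v → Q v).congr fun _ => or_iff_not_imp_left

instance D0.and (P Q : (ℕ → N) → Prop) [D0 S P] [D0 S Q] : D0 S fun v => P v ∧ Q v :=
  (inferInstance : D0 S fun v : ℕ → N => ¬ (P v → ¬ Q v)).congr fun _ => by tauto

instance D0.iff (P Q : (ℕ → N) → Prop) [D0 S P] [D0 S Q] : D0 S fun v => P v ↔ Q v :=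
  (inferInstance : D0 S fun v : ℕ → N => (P v → Q v) ∧ (Q v → P v)).congr fun _ =>
    iff_iff_implies_and_implies

instance D0.ball (f : (ℕ → N) → N) (Q : N → (ℕ → N) → Prop) [hf : IsTerm f]
    [hQ : D0 S fun v => Q (v 0) fun i => v (i + 1)] : D0 S fun v => ∀ x, x < f v → Q x v := by
  obtain ⟨t, w, h⟩ := hf
  obtain ⟨θ, hθ, w', s, h'⟩ := hQ
  -- In the body, `σ` sends the bound variable to `♯0` and every other variable to an odd position,
  -- raised by one for the binder. The value of `u` at the bound variable is never read.
  let u : ℕ → N ⊕ ℕ := fun i => match w' i with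
    | .inl c => .inl c
    | .inr 0 => .inl 0
    | .inr (j + 1) => .inr j
  let σ : ℕ → Tm := fun i => match w' i with
    | .inl _ => ♯(2 * i + 1 + 1)
    | .inr 0 => ♯0
    | .inr (_ + 1) => ♯(2 * i + 1 + 1)
  refine ⟨Fm.ballN (t.subst fun i => ♯(2 * i)) (θ.subst σ id), .ballN _ (hθ.subst _ _),
    interleave w u, s, fun v => ?_⟩
  simp only [sat_ballN, Fm.sat_subst, Tm.val_subst, Tm.val_var, interp_interleave_even]
  refine forall_congr' fun x => ?_
  rw [h]
  refine imp_congr Iff.rfl ((h' (scons x v)).trans (iff_of_eq (congrArg₂ _ ?_ rfl)))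
  funext i
  rcases hi : w' i with c | _ | j <;> simp [σ, u, interp, hi]

instance D0.bex (f : (ℕ → N) → N) (Q : N → (ℕ → N) → Prop) [IsTerm f]
    [D0 S fun v => Q (v 0) fun i => v (i + 1)] : D0 S fun v => ∃ x, x < f v ∧ Q x v :=
  (inferInstance : D0 S fun v : ℕ → N => ¬ ∀ x, x < f v → ¬ Q x v).congr fun _ => by simp

theorem D0.comp_interp {P : (ℕ → N) → Prop} (h : D0 S P) (r : ℕ → N ⊕ ℕ) :
    D0 S fun v => P (interp r v) := by
  obtain ⟨θ, hθ, w, s, h⟩ := h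
  refine ⟨θ, hθ, fun i => Sum.elim .inl r (w i), s, fun v =>
    (h _).trans (iff_of_eq (congrArg₂ _ ?_ rfl))⟩
  funext i
  rcases hi : w i with c | j <;> simp [interp, hi]

theorem D0.rename {P : (ℕ → N) → Prop} (h : D0 S P) (r : ℕ → ℕ) :
    D0 S fun v => P fun i => v (r i) :=
  h.comp_interp fun i => .inr (r i)

instance S1.of_D0 (P : (ℕ → N) → Prop) [h : D0 S P] : S1 S P :=
  ⟨fun v => P fun i => v (i + 1), h.rename _, fun v => ⟨fun h => ⟨v 0, h⟩, fun ⟨_, h⟩ => h⟩⟩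

instance S1.or (P Q : (ℕ → N) → Prop) [hP : S1 S P] [hQ : S1 S Q] : S1 S fun v => P v ∨ Q v := by
  obtain ⟨P', hP', h⟩ := hP
  obtain ⟨Q', hQ', h'⟩ := hQ
  refine ⟨fun v => P' v ∨ Q' v, inferInstance, fun v => ?_⟩
  rw [h, h', exists_or]

theorem S1.exists_D0 (Q : N → (ℕ → N) → Prop) [h : D0 S fun v => Q (v 0) fun i => v (i + 1)] :
    S1 S fun v => ∃ x, Q x v :=
  ⟨_, h, fun _ => Iff.rfl⟩

/-! ### Induction and comprehension for definable predicates -/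

variable (N S) in
/-- All axioms of `RCA₀` hold in the structure. -/
def IsModel : Prop := ∀ φ, RCA₀ φ → ∀ (v : ℕ → N) (s : ℕ → S), φ.Sat v s

/-- Brings a definable relation into the shape required by the axiom schemes: the arguments are
variables `0` and `1`, and all parameters sit behind them. -/
theorem D0.exists_formula {P : N → N → Prop} (h : D0 S fun v => P (v 0) (v 1)) :
    ∃ θ, IsBounded θ ∧ ∃ (e : ℕ → N) (s : ℕ → S),
      ∀ x y, θ.Sat (scons x (scons y e)) s ↔ P x y := by
  obtain ⟨θ, hθ, w, s, h⟩ := h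
  let σ : ℕ → Tm := fun i => match w i with
    | .inr 0 => ♯0
    | .inr 1 => ♯1
    | _ => ♯(i + 2)
  let e : ℕ → N := fun i => match w i with
    | .inl c => c
    | _ => 0
  refine ⟨θ.subst σ id, hθ.subst _ _, e, s, fun x y => ?_⟩
  rw [Fm.sat_subst]
  refine Iff.trans (iff_of_eq (congrArg₂ _ ?_ rfl)) (h (scons x (scons y fun _ => 0))).symm
  funext i
  rcases hi : w i with c | _ | _ | j <;> simp [σ, e, interp, hi]

theorem IsModel.induction (H : IsModel N S) {P : N → Prop} (hP : S1 S fun v => P (v 0))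
    (zero : P 0) (succ : ∀ x, P x → P (x + 1)) (x : N) : P x := by
  obtain ⟨Q, hQ, h⟩ := hP
  -- `P` depends only on its argument, so the entries after the witness and the argument may be
  -- frozen at `0`.
  have hQ' : D0 S fun v => Q (scons (v 0) (scons (v 1) fun _ => (0 : N))) := by
    obtain ⟨θ, hθ, w, s, h⟩ := hQ
    refine ⟨θ, hθ, fun i => match w i with
      | .inr (_ + 2) => .inl 0
      | z => z, s, fun v => (h _).trans (iff_of_eq (congrArg₂ _ ?_ rfl))⟩
    funext i
    rcases hi : w i with c | _ | _ | j <;> simp [interp, hi]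
  obtain ⟨θ, hθ, e, s, hs⟩ := D0.exists_formula (P := fun x y => Q (scons x (scons y fun _ => 0)))
    hQ'
  have key (y : N) : θ.exN.Sat (scons y e) s ↔ P y := by
    rw [sat_exN]
    simp only [hs]
    exact (h (scons y fun _ => 0)).symm
  have := H _ (.induction ⟨θ, hθ, rfl⟩) e s
  simp only [SOA.induction, sat_imp, sat_and, sat_allN, Fm.sat_instN, Fm.sat_instSucc, key,
    Tm.val_zero] at this
  exact this ⟨zero, succ⟩ x

/-- A bounded formula is both Σ⁰₁ and Π⁰₁ via a dummy quantifier; the renaming keeps variable `0`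
free for it. -/
theorem IsModel.comprehension (H : IsModel N S) {P : N → Prop} (hP : D0 S fun v => P (v 0)) :
    ∃ X : S, ∀ x, x ∈ X ↔ P x := by
  obtain ⟨θ, hθ, e, s, hs⟩ := D0.exists_formula (P := fun _ y => P y) (hP.rename fun i => i + 1)
  have := H _ (.comprehension ⟨θ, hθ, rfl⟩ ⟨θ, hθ, rfl⟩) e s
  simpa [SOA.comprehension, Fm.sat_liftS, hs] using this

end Definability

/-! ### Models of `RCA₀` as ordered semirings -/

namespace IsModel

variable {N S : Type} [Zero N] [One N] [Add N] [Mul N] [LT N] [Membership N S] [Nonempty S]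
  (H : IsModel N S)
include H

theorem add_zero (x : N) : x + 0 = x :=
  H _ .add_zero (fun _ => x) fun _ => Classical.arbitrary S

theorem mul_zero (x : N) : x * 0 = 0 :=
  H _ .mul_zero (fun _ => x) fun _ => Classical.arbitrary S

theorem succ_ne_zero (x : N) : x + 1 ≠ 0 :=
  H _ .succ_ne_zero (fun _ => x) fun _ => Classical.arbitrary S

theorem succ_inj {x y : N} : x + 1 = y + 1 → x = y :=
  H _ .succ_inj (scons x fun _ => y) fun _ => Classical.arbitrary S

theorem add_succ (x y : N) : x + (y + 1) = x + y + 1 :=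
  H _ .add_succ (scons x fun _ => y) fun _ => Classical.arbitrary S

theorem mul_succ (x y : N) : x * (y + 1) = x * y + x :=
  H _ .mul_succ (scons x fun _ => y) fun _ => Classical.arbitrary S

theorem not_lt_zero (x : N) : ¬ x < 0 :=
  H _ .not_lt_zero (fun _ => x) fun _ => Classical.arbitrary S

theorem lt_succ (x y : N) : x < y + 1 ↔ x < y ∨ x = y := by
  have := H _ .lt_succ (scons x fun _ => y) fun _ => Classical.arbitrary S
  simpa using this

theorem zero_add (x : N) : 0 + x = x := by
  induction x using H.induction with
  | hP => infer_instance
  | zero => exact H.add_zero 0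
  | succ x ih => rw [H.add_succ, ih]

theorem succ_add (x y : N) : x + 1 + y = x + y + 1 := by
  induction y using H.induction with
  | hP => infer_instance
  | zero => rw [H.add_zero, H.add_zero]
  | succ y ih => rw [H.add_succ, ih, H.add_succ]

theorem add_comm (x y : N) : x + y = y + x := by
  induction y using H.induction with
  | hP => infer_instance
  | zero => rw [H.add_zero, H.zero_add]
  | succ y ih => rw [H.add_succ, ih, H.succ_add]

theorem add_assoc (x y z : N) : x + y + z = x + (y + z) := by
  induction z using H.induction with
  | hP => infer_instance
  | zero => rw [H.add_zero, H.add_zero]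
  | succ z ih => rw [H.add_succ, ih, H.add_succ, H.add_succ]

theorem zero_mul (x : N) : 0 * x = 0 := by
  induction x using H.induction with
  | hP => infer_instance
  | zero => exact H.mul_zero 0
  | succ x ih => rw [H.mul_succ, ih, H.add_zero]

theorem succ_mul (x y : N) : (x + 1) * y = x * y + y := by
  induction y using H.induction with
  | hP => infer_instance
  | zero => rw [H.mul_zero, H.mul_zero, H.add_zero]
  | succ y ih =>
    rw [H.mul_succ, ih, H.mul_succ, H.add_assoc, H.add_assoc, ← H.add_assoc y, H.add_comm y x,
      H.add_assoc x]

theorem mul_comm (x y : N) : x * y = y * x := by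
  induction y using H.induction with
  | hP => infer_instance
  | zero => rw [H.mul_zero, H.zero_mul]
  | succ y ih => rw [H.mul_succ, ih, H.succ_mul]

theorem mul_add (x y z : N) : x * (y + z) = x * y + x * z := by
  induction z using H.induction with
  | hP => infer_instance
  | zero => rw [H.add_zero, H.mul_zero, H.add_zero]
  | succ z ih => rw [H.add_succ, H.mul_succ, ih, H.mul_succ, H.add_assoc]

theorem mul_assoc (x y z : N) : x * y * z = x * (y * z) := by
  induction z using H.induction with
  | hP => infer_instance
  | zero => rw [H.mul_zero, H.mul_zero, H.mul_zero]
  | succ z ih => rw [H.mul_succ, ih, H.mul_succ, H.mul_add]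

theorem mul_one (x : N) : x * 1 = x := by
  rw [← H.zero_add 1, H.mul_succ, H.mul_zero, H.zero_add]

theorem add_right_cancel {x y : N} (z : N) : x + z = y + z → x = y := by
  induction z using H.induction with
  | hP => infer_instance
  | zero => rw [H.add_zero, H.add_zero]; exact id
  | succ z ih => rw [H.add_succ, H.add_succ]; exact fun h => ih (H.succ_inj h)

theorem add_left_cancel {x y : N} (z : N) (h : z + x = z + y) : x = y :=
  H.add_right_cancel z (by rwa [H.add_comm x, H.add_comm y])

theorem eq_zero_or_succ (x : N) : x = 0 ∨ ∃ y, x = y + 1 := by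
  induction x using H.induction with
  | hP =>
    have := S1.exists_D0 (S := S) fun (y : N) v => v 0 = y + 1
    infer_instance
  | zero => exact .inl rfl
  | succ x => exact .inr ⟨x, rfl⟩

theorem lt_add_succ (x z : N) : x < x + z + 1 := by
  induction z using H.induction with
  | hP => infer_instance
  | zero => rw [H.add_zero, H.lt_succ]; exact .inr rfl
  | succ z ih => rw [← H.add_succ x z] at ih; exact (H.lt_succ _ _).2 (.inl ih)

theorem lt_iff (x y : N) : x < y ↔ ∃ z, y = x + z + 1 := by
  refine ⟨fun h => ?_, fun ⟨z, hz⟩ => hz ▸ H.lt_add_succ x z⟩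
  -- As a disjunction of a bounded and an existential statement, this is visibly Σ⁰₁.
  have : ¬ x < y ∨ ∃ z, y = x + z + 1 := by
    clear h
    induction y using H.induction with
    | hP =>
      have := S1.exists_D0 (S := S) fun (z : N) v => v 0 = x + z + 1
      infer_instance
    | zero => exact .inl (H.not_lt_zero x)
    | succ y ih =>
      by_cases h : x < y + 1
      · rcases (H.lt_succ _ _).1 h with h | rfl
        · obtain ⟨z, rfl⟩ := ih.resolve_left (not_not.2 h)
          exact .inr ⟨z + 1, by rw [H.add_succ]⟩
        · exact .inr ⟨0, by rw [H.add_zero]⟩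
      · exact .inl h
  exact this.resolve_left (not_not.2 h)

theorem le_total (x y : N) : (∃ z, y = x + z) ∨ ∃ z, x = y + z := by
  induction y using H.induction with
  | hP =>
    have := S1.exists_D0 (S := S) fun (z : N) v => v 0 = x + z
    have := S1.exists_D0 (S := S) fun (z : N) v => x = v 0 + z
    infer_instance
  | zero => exact .inr ⟨x, (H.zero_add x).symm⟩
  | succ y ih =>
    rcases ih with ⟨z, rfl⟩ | ⟨z, rfl⟩
    · exact .inl ⟨z + 1, by rw [H.add_succ]⟩
    · rcases H.eq_zero_or_succ z with rfl | ⟨z, rfl⟩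
      · exact .inl ⟨1, by rw [H.add_zero]⟩
      · exact .inr ⟨z, by rw [H.add_succ, H.succ_add]⟩

/-- The numbers of a model as a semiring. -/
abbrev commSemiring : CommSemiring N where
  add_assoc := H.add_assoc
  zero_add := H.zero_add
  add_zero := H.add_zero
  add_comm := H.add_comm
  left_distrib := H.mul_add
  right_distrib x y z := by rw [H.mul_comm, H.mul_add, H.mul_comm z, H.mul_comm z]
  zero_mul := H.zero_mul
  mul_zero := H.mul_zero
  mul_assoc := H.mul_assoc
  one_mul x := by rw [H.mul_comm, H.mul_one]
  mul_one := H.mul_one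
  mul_comm := H.mul_comm
  nsmul := nsmulRec

theorem eq_of_add_add {x z w : N} (h : x = x + z + w) : z = 0 := by
  have := H.add_left_cancel x (x := 0) (y := z + w) (by rw [H.add_zero, ← H.add_assoc]; exact h)
  rcases H.eq_zero_or_succ w with rfl | ⟨w, rfl⟩
  · rw [H.add_zero] at this
    exact this.symm
  · rw [H.add_succ] at this
    exact (H.succ_ne_zero _ this.symm).elim

/-- The numbers of a model as a linear order. -/
noncomputable abbrev linearOrder : LinearOrder N where
  le x y := ∃ z, y = x + z
  lt := (· < ·)
  le_refl x := ⟨0, (H.add_zero x).symm⟩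
  le_trans := by
    rintro x _ _ ⟨z, rfl⟩ ⟨w, rfl⟩
    exact ⟨z + w, H.add_assoc _ _ _⟩
  lt_iff_le_not_ge x y := by
    rw [H.lt_iff]
    constructor
    · rintro ⟨z, rfl⟩
      refine ⟨⟨z + 1, by rw [H.add_succ]⟩, fun ⟨w, hw⟩ => H.succ_ne_zero z ?_⟩
      rw [← H.add_succ] at hw
      exact H.eq_of_add_add hw
    · rintro ⟨⟨z, rfl⟩, h⟩
      rcases H.eq_zero_or_succ z with rfl | ⟨z, rfl⟩
      · exact (h ⟨0, by rw [H.add_zero, H.add_zero]⟩).elim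
      · exact ⟨z, by rw [H.add_succ]⟩
  le_antisymm := by
    rintro x _ ⟨z, rfl⟩ ⟨w, hw⟩
    rw [H.eq_of_add_add hw, H.add_zero]
  le_total := H.le_total
  toDecidableLE := Classical.decRel _

theorem isStrictOrderedRing :
    letI := H.commSemiring
    letI := H.linearOrder
    IsStrictOrderedRing N := by
  let _ := H.commSemiring
  let _ := H.linearOrder
  have mul_lt (a b c : N) (hc : 0 < c) (h : a < b) : c * a < c * b := by
    obtain ⟨z, rfl⟩ := (H.lt_iff _ _).1 h
    obtain ⟨c, rfl⟩ := (H.lt_iff _ _).1 hc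
    exact (H.lt_iff _ _).2 ⟨(0 + c + 1) * z + c, by ring⟩
  exact {
    add_le_add_left := by
      rintro a _ ⟨z, rfl⟩ c
      exact ⟨z, by ring⟩
    le_of_add_le_add_left := by
      rintro a b c ⟨z, hz⟩
      exact ⟨z, H.add_left_cancel a (by rw [hz, H.add_assoc])⟩
    zero_le_one := ⟨1, (H.zero_add 1).symm⟩
    exists_pair_ne := ⟨0 + 1, 0, H.succ_ne_zero 0⟩
    mul_lt_mul_of_pos_left := fun a ha b c h => mul_lt _ _ _ ha h
    mul_lt_mul_of_pos_right := fun a ha b c h => by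
      simpa only [H.mul_comm _ a] using mul_lt _ _ _ ha h }

theorem canonicallyOrderedAdd :
    letI := H.commSemiring
    letI := H.linearOrder
    CanonicallyOrderedAdd N := by
  let _ := H.commSemiring
  let _ := H.linearOrder
  exact {
    exists_add_of_le := id
    le_self_add := fun a b => ⟨b, rfl⟩
    le_add_self := fun a b => ⟨b, H.add_comm _ _⟩ }

/-- The successor function of a model. -/
noncomputable abbrev succAddOrder :
    letI := H.linearOrder
    SuccAddOrder N :=
  letI := H.commSemiring
  letI := H.linearOrder
  haveI := H.isStrictOrderedRing
  haveI := H.canonicallyOrderedAdd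
  { SuccOrder.ofSuccLeIff (fun x : N => x + 1) fun {a b} => by
      rw [show a < b ↔ _ from H.lt_iff a b]
      exact exists_congr fun z => by rw [H.add_assoc, H.add_comm 1, H.add_assoc] with
    succ_eq_add_one := fun _ => rfl }

end IsModel

/-! ### Transfer to ordered semirings -/

/-- Models of `RCA₀` whose numbers are presented as an ordered semiring. -/
class RCAModel (N S : Type) [CommSemiring N] [LinearOrder N] [Membership N S] : Prop where
  isModel : IsModel N S

/-- The property `C` holds for all ordered semirings on `N` that give a model of `RCA₀`. -/
def ForallOrdered (N S : Type) [Membership N S]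
    (C : Zero N → One N → Add N → Mul N → LT N → Prop) : Prop :=
  ∀ [CommSemiring N] [LinearOrder N] [IsStrictOrderedRing N] [CanonicallyOrderedAdd N]
    [SuccAddOrder N] [RCAModel N S],
    C inferInstance inferInstance inferInstance inferInstance inferInstance

/-- A property of models of `RCA₀` can be checked for ordered semirings. -/
theorem IsModel.elim {N S : Type} {hz : Zero N} {ho : One N} {ha : Add N} {hm : Mul N} {hl : LT N}
    [hS : Membership N S] [Nonempty S] (H : @IsModel N S hz ho ha hm hl hS)
    {C : Zero N → One N → Add N → Mul N → LT N → Prop} (h : ForallOrdered N S C) :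
    C hz ho ha hm hl :=
  -- The instances built from `H` contain the given operations and the given `<` definitionally, so
  -- `C` needs no translation.
  @h H.commSemiring H.linearOrder H.isStrictOrderedRing H.canonicallyOrderedAdd
    H.succAddOrder (@RCAModel.mk N S H.commSemiring H.linearOrder hS H)

section Ordered

variable {N S : Type} [CommSemiring N] [LinearOrder N] [IsStrictOrderedRing N]
  [CanonicallyOrderedAdd N] [SuccAddOrder N] [Membership N S] [Nonempty S]

/-! ### Further closure properties of definable predicates -/

instance D0.le (f g : (ℕ → N) → N) [IsTerm f] [IsTerm g] : D0 S fun v => f v ≤ g v :=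
  (inferInstance : D0 S fun v => f v < g v + 1).congr fun _ => Order.lt_add_one_iff.symm

instance D0.ball_le (f : (ℕ → N) → N) (Q : N → (ℕ → N) → Prop) [IsTerm f]
    [D0 S fun v => Q (v 0) fun i => v (i + 1)] : D0 S fun v => ∀ x, x ≤ f v → Q x v :=
  (inferInstance : D0 S fun v => ∀ x, x < f v + 1 → Q x v).congr fun _ => by
    simp only [Order.lt_add_one_iff]

instance D0.bex_le (f : (ℕ → N) → N) (Q : N → (ℕ → N) → Prop) [IsTerm f]
    [D0 S fun v => Q (v 0) fun i => v (i + 1)] : D0 S fun v => ∃ x, x ≤ f v ∧ Q x v :=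
  (inferInstance : D0 S fun v => ∃ x, x < f v + 1 ∧ Q x v).congr fun _ => by
    simp only [Order.lt_add_one_iff]

/-- Two unbounded quantifiers merge into one: both witnesses lie below `x + y + 1`. -/
instance S1.exists (Q : N → (ℕ → N) → Prop) [h : S1 S fun v => Q (v 0) fun i => v (i + 1)] :
    S1 S fun v => ∃ x, Q x v := by
  obtain ⟨R, hR, h⟩ := h
  have hR' : D0 S fun v => R (scons (v 0) (scons (v 1) fun i => v (i + 3))) := by
    refine (hR.rename fun i => if i < 2 then i else i + 1).congr fun v => iff_of_eq (congrArg R ?_)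
    funext i
    rcases i with _ | _ | i <;> simp
  refine ⟨fun v => ∃ x, x < v 0 ∧ ∃ y, y < v 0 ∧ R (scons y (scons x fun i => v (i + 1))),
    inferInstance, fun v => ?_⟩
  have h' (x : N) : Q x v ↔ ∃ y, R (scons y (scons x v)) := h (scons x v)
  simp only [h']
  constructor
  · rintro ⟨x, y, hxy⟩
    refine ⟨x + y + 1, x, ?_, y, ?_, hxy⟩
    · exact Order.lt_add_one_iff.2 le_self_add
    · exact Order.lt_add_one_iff.2 le_add_self
  · rintro ⟨z, x, _, y, _, hxy⟩
    exact ⟨x, y, hxy⟩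

instance S1.and (P Q : (ℕ → N) → Prop) [hP : S1 S P] [hQ : S1 S Q] : S1 S fun v => P v ∧ Q v := by
  obtain ⟨P', hP', h⟩ := hP
  obtain ⟨Q', hQ', h'⟩ := hQ
  have h₁ : D0 S fun v => P' (scons (v 1) fun i => v (i + 2)) := by
    refine (hP'.rename fun i => i + 1).congr fun v => iff_of_eq (congrArg P' ?_)
    funext i
    cases i <;> rfl
  have h₂ : D0 S fun v => Q' (scons (v 0) fun i => v (i + 2)) := by
    refine (hQ'.rename fun i => if i = 0 then i else i + 1).congr fun v =>
      iff_of_eq (congrArg Q' ?_)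
    funext i
    cases i <;> simp
  refine (inferInstance : S1 S fun v => ∃ y, ∃ y', P' (scons y v) ∧ Q' (scons y' v)).congr
    fun v => ?_
  rw [h, h']
  simp

instance S1.imp (P Q : (ℕ → N) → Prop) [D0 S P] [S1 S Q] : S1 S fun v => P v → Q v :=
  (inferInstance : S1 S fun v => ¬ P v ∨ Q v).congr fun _ => imp_iff_not_or

variable [H : RCAModel N S]

variable (S) in
theorem s1_induction {P : N → Prop} (hP : S1 S fun v => P (v 0)) (zero : P 0)
    (succ : ∀ x, P x → P (x + 1)) (x : N) : P x :=
  H.isModel.induction hP zero succ x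

variable (S) in
theorem s1_induction_le {P : N → Prop} (hP : S1 S fun v => P (v 0)) (n : N) (zero : P 0)
    (succ : ∀ x < n, P x → P (x + 1)) : P n := by
  have : ∀ x, x ≤ n → P x := by
    refine s1_induction S inferInstance (fun _ => zero) fun x ih hx => ?_
    have hx := Order.add_one_le_iff.1 hx
    exact succ x hx (ih hx.le)
  exact this n le_rfl

variable (S) in
theorem d0_comprehension {P : N → Prop} (hP : D0 S fun v => P (v 0)) : ∃ X : S, ∀ x, x ∈ X ↔ P x :=
  H.isModel.comprehension hP

variable (S) in
theorem d0_least {P : N → Prop} (hP : D0 S fun v => P (v 0)) {x : N} (hx : P x) :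
    ∃ m, P m ∧ ∀ y < m, ¬ P y := by
  by_contra! h
  have hP' : ∀ i, D0 S fun v => P (v i) := fun i => hP.rename fun _ => i
  have : ∀ n y, y < n → ¬ P y := by
    refine s1_induction S inferInstance (by simp) fun n ih y hy hPy => ?_
    obtain ⟨z, hz, hPz⟩ := h y hPy
    exact ih z (hz.trans_le (Order.lt_add_one_iff.1 hy)) hPz
  exact this (x + 1) x (Order.lt_add_one_iff.2 le_rfl) hx

variable (S) in
/-- `Σ⁰₁`-collection. -/
theorem collection {R : N → N → Prop} (hR : D0 S fun v => R (v 0) (v 1)) (n : N)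
    (h : ∀ x < n, ∃ y, R x y) : ∃ b, ∀ x, x < n → ∃ y, y < b ∧ R x y := by
  have hR' : ∀ i j, D0 S fun v => R (v i) (v j) := fun i j =>
    hR.rename fun k => if k = 0 then i else j
  refine s1_induction_le S (P := fun n => ∃ b, ∀ x, x < n → ∃ y, y < b ∧ R x y) inferInstance n
    ⟨0, by simp⟩ fun x hx ⟨b, hb⟩ => ?_
  obtain ⟨y, hy⟩ := h x hx
  refine ⟨b + y + 1, fun z hz => ?_⟩
  rcases (Order.lt_add_one_iff.1 hz).lt_or_eq with hz | rfl
  · obtain ⟨y', hy', hR⟩ := hb z hz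
    exact ⟨y', hy'.trans_le (le_self_add.trans le_self_add), hR⟩
  · exact ⟨y, Order.lt_add_one_iff.2 le_add_self, hy⟩

/-- By collection the witnesses for all `x < f v` have a common bound, which becomes the single
unbounded quantifier. -/
instance S1.ball (f : (ℕ → N) → N) (Q : N → (ℕ → N) → Prop) [hf : IsTerm f]
    [h : S1 S fun v => Q (v 0) fun i => v (i + 1)] : S1 S fun v => ∀ x, x < f v → Q x v := by
  obtain ⟨R, hR, h⟩ := h
  have hR' : D0 S fun v => R (scons (v 0) (scons (v 1) fun i => v (i + 3))) := by
    refine (hR.rename fun i => if i < 2 then i else i + 1).congr fun v => iff_of_eq (congrArg R ?_)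
    funext i
    rcases i with _ | _ | i <;> simp
  have hf' : IsTerm fun v : ℕ → N => f fun i => v (i + 1) := by
    obtain ⟨t, w, h⟩ := hf
    refine ⟨t, fun i => (w i).map id (· + 1), fun v => (h _).trans (congrArg t.val ?_)⟩
    funext i
    rcases hi : w i with c | j <;> simp [interp, hi]
  refine ⟨fun v => ∀ x, x < f (fun i => v (i + 1)) → ∃ y, y < v 0 ∧
    R (scons y (scons x fun i => v (i + 1))), inferInstance, fun v => ?_⟩
  have h' (x : N) : Q x v ↔ ∃ y, R (scons y (scons x v)) := h (scons x v)
  simp only [h']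
  constructor
  · refine collection S (R := fun x y => R (scons y (scons x v))) ?_ (f v)
    refine (hR.comp_interp fun i => match i with
      | 0 => .inr 1
      | 1 => .inr 0
      | i + 2 => .inl (v i)).congr fun u => iff_of_eq (congrArg R ?_)
    funext i
    rcases i with _ | _ | i <;> rfl
  · intro ⟨b, hb⟩ x hx
    obtain ⟨y, -, hy⟩ := hb x hx
    exact ⟨y, hy⟩

/-! ### Division -/

variable (S) in
include H in
theorem exists_div (n d : N) (hd : 0 < d) : ∃ q r, n = q * d + r ∧ r < d := by
  refine s1_induction S (P := fun n => ∃ q r, n = q * d + r ∧ r < d) inferInstance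
    ⟨0, 0, by simp, hd⟩ ?_ n
  rintro _ ⟨q, r, rfl, hr⟩
  rcases (Order.add_one_le_iff.2 hr).lt_or_eq with h | h
  · exact ⟨q, r + 1, by ring, h⟩
  · exact ⟨q + 1, 0, by rw [← h]; ring, hd⟩

theorem div_unique {d q r q' r' : N} (h : q * d + r = q' * d + r') (hr : r < d) (hr' : r' < d) :
    r = r' := by
  rcases lt_trichotomy q q' with hq | rfl | hq
  · obtain ⟨z, rfl⟩ := exists_add_of_le (Order.add_one_le_iff.2 hq)
    have : r = d + z * d + r' := add_left_cancel (a := q * d) (by rw [h]; ring)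
    exact absurd hr (by rw [this, add_assoc]; exact not_lt.2 le_self_add)
  · exact add_left_cancel h
  · obtain ⟨z, rfl⟩ := exists_add_of_le (Order.add_one_le_iff.2 hq)
    have : r' = d + z * d + r := add_left_cancel (a := q' * d) (by rw [← h]; ring)
    exact absurd hr' (by rw [this, add_assoc]; exact not_lt.2 le_self_add)

/-! ### Pairs -/

/-- The pairing function. -/
def pr (x y : N) : N := (x + y) * (x + y) + x

instance IsTerm.pr (f g : (ℕ → N) → N) [IsTerm f] [IsTerm g] : IsTerm fun v => pr (f v) (g v) :=
  (inferInstance : IsTerm fun v => (f v + g v) * (f v + g v) + f v)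

theorem val_pair (s t : Tm) (v : ℕ → N) : (pair s t).val v = pr (s.val v) (t.val v) := rfl

theorem le_mul_self' (x : N) : x ≤ x * x := by
  rcases eq_or_ne x 0 with rfl | hx
  · simp
  · exact le_mul_of_one_le_left' (Order.one_le_iff_pos.2 (pos_iff_ne_zero.2 hx))

theorem le_pr_left (x y : N) : x ≤ pr x y := le_add_self

theorem le_pr_right (x y : N) : y ≤ pr x y :=
  le_add_self.trans ((le_mul_self' (x + y)).trans le_self_add)

/-- As (x + y)² + x < (x + y + 1)², codes of pairs are ordered by the sum of the components first.
-/
theorem pr_lt {x y x' y' : N} (h : x + y < x' + y') : pr x y < pr x' y' := by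
  obtain ⟨z, hz⟩ := exists_add_of_le (Order.add_one_le_iff.2 h)
  have : (x + y) * (x + y) + x < (x + y + 1 + z) * (x + y + 1 + z) := by
    rw [show (x + y + 1 + z) * (x + y + 1 + z) =
      (x + y) * (x + y) + x + 1 + ((x + y) + y + z * (2 * (x + y) + 2 + z)) by ring]
    exact (Order.lt_add_one_iff.2 le_rfl).trans_le le_self_add
  unfold pr
  rw [hz]
  exact this.trans_le le_self_add

theorem pr_inj {x y x' y' : N} : pr x y = pr x' y' ↔ x = x' ∧ y = y' := by
  refine ⟨fun h => ?_, fun ⟨h, h'⟩ => by rw [h, h']⟩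
  rcases lt_trichotomy (x + y) (x' + y') with h' | h' | h'
  · exact absurd h (pr_lt h').ne
  · have : x = x' := by
      unfold pr at h
      rw [h'] at h
      exact add_left_cancel h
    subst this
    exact ⟨rfl, add_left_cancel h'⟩
  · exact absurd h (pr_lt h').ne'

end Ordered

section Ordered

variable {N S : Type} [CommSemiring N] [LinearOrder N] [IsStrictOrderedRing N]
  [CanonicallyOrderedAdd N] [SuccAddOrder N] [Membership N S] [Nonempty S]

/-! ### Codes of finite sequences -/

/-- `c` represents a sequence of length `l`. -/
def Len (c l : N) : Prop := ∃ m n, c = pr l (pr m n)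

/-- `x` is the `i`-th entry of the sequence represented by `c`. -/
def Ent (c i x : N) : Prop :=
  ∃ l m n q, c = pr l (pr m n) ∧ i < l ∧ x < m * (i + 1) + 1 ∧ n = q * (m * (i + 1) + 1) + x

/-- `c` and `d` represent the same sequence. -/
def Same (c d : N) : Prop := (∀ l, Len c l ↔ Len d l) ∧ ∀ i x, Ent c i x ↔ Ent d i x

/-- `c` is the least number that represents some sequence. -/
def IsSeq (c : N) : Prop := (∃ l, Len c l) ∧ ∀ d < c, ¬ Same c d

theorem Len.le {c l : N} (h : Len c l) : l ≤ c := by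
  obtain ⟨m, n, rfl⟩ := h
  exact le_pr_left _ _

theorem Len.unique {c l l' : N} (h : Len c l) (h' : Len c l') : l = l' := by
  obtain ⟨m, n, rfl⟩ := h
  obtain ⟨m', n', h⟩ := h'
  exact (pr_inj.1 h).1

theorem Ent.len {c i x : N} (h : Ent c i x) : ∃ l, Len c l ∧ i < l := by
  obtain ⟨l, m, n, q, hc, hi, -⟩ := h
  exact ⟨l, ⟨m, n, hc⟩, hi⟩

theorem Ent.lt {c l i x : N} (h : Ent c i x) (hl : Len c l) : i < l := by
  obtain ⟨l', hl', hi⟩ := h.len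
  rwa [hl.unique hl']

theorem Ent.le_left {c i x : N} (h : Ent c i x) : i ≤ c := by
  obtain ⟨l, hl, hi⟩ := h.len
  exact hi.le.trans hl.le

theorem Ent.le_right {c i x : N} (h : Ent c i x) : x ≤ c := by
  obtain ⟨l, m, n, q, rfl, hi, -, rfl⟩ := h
  exact le_add_self.trans ((le_pr_right _ _).trans (le_pr_right _ _))

theorem Ent.unique {c i x y : N} (h : Ent c i x) (h' : Ent c i y) : x = y := by
  obtain ⟨l, m, n, q, rfl, hi, hx, rfl⟩ := h
  obtain ⟨l', m', n', q', h, hi', hy, rfl⟩ := h'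
  rw [pr_inj, pr_inj] at h
  obtain ⟨-, rfl, h⟩ := h
  exact div_unique h hx hy

theorem Same.refl (c : N) : Same c c := ⟨fun _ => Iff.rfl, fun _ _ => Iff.rfl⟩

theorem Same.symm {c d : N} (h : Same c d) : Same d c :=
  ⟨fun l => (h.1 l).symm, fun i x => (h.2 i x).symm⟩

theorem Same.trans {c d e : N} (h : Same c d) (h' : Same d e) : Same c e :=
  ⟨fun l => (h.1 l).trans (h'.1 l), fun i x => (h.2 i x).trans (h'.2 i x)⟩

theorem IsSeq.eq {c d : N} (hc : IsSeq c) (hd : IsSeq d) (h : Same c d) : c = d := by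
  rcases lt_trichotomy c d with h' | h' | h'
  · exact (hd.2 c h' h.symm).elim
  · exact h'
  · exact (hc.2 d h' h).elim

instance IsTerm.rename (f : (ℕ → N) → N) (r : ℕ → ℕ) [hf : IsTerm f] :
    IsTerm fun v : ℕ → N => f fun i => v (r i) := by
  obtain ⟨t, w, h⟩ := hf
  refine ⟨t, fun i => (w i).map id r, fun v => (h _).trans (congrArg t.val ?_)⟩
  funext i
  rcases hi : w i with c | j <;> simp [interp, hi]

/-- Terms are inserted by bounded quantifiers over `x ≤ f v` with `x = f v`, so definability of a
relation need only be checked on variables. -/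
theorem D0.rel₂ {R : N → N → Prop} (h : D0 S fun v => R (v 0) (v 1)) (f g : (ℕ → N) → N)
    [IsTerm f] [IsTerm g] : D0 S fun v => R (f v) (g v) := by
  have h' : ∀ i j, D0 S fun v => R (v i) (v j) := fun i j =>
    h.rename fun k => if k = 0 then i else j
  refine (inferInstance : D0 S fun v => ∃ x, x ≤ f v ∧ ∃ y, y ≤ g v ∧
    (x = f v ∧ y = g v ∧ R x y)).congr fun v => ⟨fun h => ⟨_, le_rfl, _, le_rfl, rfl, rfl, h⟩, ?_⟩
  rintro ⟨_, -, _, -, rfl, rfl, h⟩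
  exact h

theorem D0.rel₃ {R : N → N → N → Prop} (h : D0 S fun v => R (v 0) (v 1) (v 2))
    (f g k : (ℕ → N) → N) [IsTerm f] [IsTerm g] [IsTerm k] :
    D0 S fun v => R (f v) (g v) (k v) := by
  have h' : ∀ i j l, D0 S fun v => R (v i) (v j) (v l) := fun i j l =>
    h.rename fun k => if k = 0 then i else if k = 1 then j else l
  refine (inferInstance : D0 S fun v => ∃ x, x ≤ f v ∧ ∃ y, y ≤ g v ∧ ∃ z, z ≤ k v ∧
    (x = f v ∧ y = g v ∧ z = k v ∧ R x y z)).congr fun v =>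
      ⟨fun h => ⟨_, le_rfl, _, le_rfl, _, le_rfl, rfl, rfl, rfl, h⟩, ?_⟩
  rintro ⟨_, -, _, -, _, -, rfl, rfl, rfl, h⟩
  exact h

theorem S1.rename {P : (ℕ → N) → Prop} (h : S1 S P) (r : ℕ → ℕ) :
    S1 S fun v => P fun i => v (r i) := by
  obtain ⟨Q, hQ, h⟩ := h
  refine ⟨fun v => Q (scons (v 0) fun i => v (r i + 1)), ?_, fun v => h _⟩
  refine (hQ.rename fun i => match i with
    | 0 => 0
    | i + 1 => r i + 1).congr fun v => iff_of_eq (congrArg Q ?_)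
  funext i
  cases i <;> rfl

theorem S1.rel₂ {R : N → N → Prop} (h : S1 S fun v => R (v 0) (v 1)) (f g : (ℕ → N) → N)
    [IsTerm f] [IsTerm g] : S1 S fun v => R (f v) (g v) := by
  have h' : ∀ i j, S1 S fun v => R (v i) (v j) := fun i j =>
    h.rename fun k => if k = 0 then i else j
  exact (inferInstance : S1 S fun v => ∃ x y, x = f v ∧ y = g v ∧ R x y).congr fun v => by simp

instance D0.len (f g : (ℕ → N) → N) [IsTerm f] [IsTerm g] : D0 S fun v => Len (f v) (g v) := by
  refine D0.rel₂ ((inferInstance : D0 S fun v => ∃ m, m ≤ v 0 ∧ ∃ n, n ≤ v 0 ∧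
    v 0 = pr (v 1) (pr m n)).congr fun v => ⟨?_, ?_⟩) f g
  · rintro ⟨m, n, h⟩
    have := le_pr_right (v 1) (pr m n)
    rw [← h] at this
    exact ⟨m, (le_pr_left _ _).trans this, n, (le_pr_right _ _).trans this, h⟩
  · rintro ⟨m, -, n, -, h⟩
    exact ⟨m, n, h⟩

instance D0.ent (f g k : (ℕ → N) → N) [IsTerm f] [IsTerm g] [IsTerm k] :
    D0 S fun v => Ent (f v) (g v) (k v) := by
  refine D0.rel₃ ((inferInstance : D0 S fun v => ∃ l, l ≤ v 0 ∧ ∃ m, m ≤ v 0 ∧ ∃ n, n ≤ v 0 ∧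
    ∃ q, q ≤ v 0 ∧ (v 0 = pr l (pr m n) ∧ v 1 < l ∧ v 2 < m * (v 1 + 1) + 1 ∧
    n = q * (m * (v 1 + 1) + 1) + v 2)).congr fun v => ⟨?_, ?_⟩) f g k
  · rintro ⟨l, m, n, q, h, hi, hx, hn⟩
    have hl := le_pr_left l (pr m n)
    have := le_pr_right l (pr m n)
    rw [← h] at this hl
    have hn' := (le_pr_right m n).trans this
    refine ⟨l, hl, m, (le_pr_left _ _).trans this, n, hn', q, le_trans ?_ hn', h, hi, hx, hn⟩
    rw [hn]
    exact (le_mul_of_one_le_right' le_add_self).trans le_self_add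
  · rintro ⟨l, -, m, -, n, -, q, -, h⟩
    exact ⟨l, m, n, q, h⟩

theorem same_iff {c d b : N} (hc : c ≤ b) (hd : d ≤ b) : Same c d ↔
    (∀ l, l ≤ b → (Len c l ↔ Len d l)) ∧ ∀ i, i ≤ b → ∀ x, x ≤ b → (Ent c i x ↔ Ent d i x) := by
  refine ⟨fun h => ⟨fun l _ => h.1 l, fun i _ x _ => h.2 i x⟩, fun h => ⟨fun l => ?_, fun i x => ?_⟩⟩
  · by_cases hl : l ≤ b
    · exact h.1 l hl
    · exact iff_of_false (fun h => hl (h.le.trans hc)) (fun h => hl (h.le.trans hd))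
  · by_cases hi : i ≤ b
    · by_cases hx : x ≤ b
      · exact h.2 i hi x hx
      · exact iff_of_false (fun h => hx (h.le_right.trans hc)) (fun h => hx (h.le_right.trans hd))
    · exact iff_of_false (fun h => hi (h.le_left.trans hc)) (fun h => hi (h.le_left.trans hd))

instance D0.same (f g : (ℕ → N) → N) [IsTerm f] [IsTerm g] : D0 S fun v => Same (f v) (g v) :=
  D0.rel₂ ((inferInstance : D0 S fun v => (∀ l, l ≤ v 0 + v 1 → (Len (v 0) l ↔ Len (v 1) l)) ∧
    ∀ i, i ≤ v 0 + v 1 → ∀ x, x ≤ v 0 + v 1 → (Ent (v 0) i x ↔ Ent (v 1) i x)).congr fun _ =>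
      same_iff le_self_add le_add_self) f g

instance D0.isSeq (f : (ℕ → N) → N) [IsTerm f] : D0 S fun v => IsSeq (f v) := by
  refine D0.rel₂ (R := fun c _ => IsSeq c) ((inferInstance : D0 S fun v =>
    (∃ l, l ≤ v 0 ∧ Len (v 0) l) ∧ ∀ d, d < v 0 → ¬ Same (v 0) d).congr fun v => ?_) f f
  exact and_congr_left' ⟨fun ⟨l, hl⟩ => ⟨l, hl.le, hl⟩, fun ⟨l, _, hl⟩ => ⟨l, hl⟩⟩

variable [H : RCAModel N S]

variable (S) in
include H in
theorem Len.exists_ent {c l : N} (h : Len c l) {i : N} (hi : i < l) : ∃ x, Ent c i x := by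
  obtain ⟨m, n, rfl⟩ := h
  obtain ⟨q, r, hn, hr⟩ := exists_div S n (m * (i + 1) + 1) (Order.lt_add_one_iff.2 zero_le)
  exact ⟨r, l, m, n, q, rfl, hi, hr, hn⟩

variable (S) in
include H in
theorem Len.exists_isSeq {c l : N} (h : Len c l) : ∃ d, IsSeq d ∧ Same c d := by
  obtain ⟨d, hd, hd'⟩ := d0_least S (P := fun d => Same c d) inferInstance (Same.refl c)
  exact ⟨d, ⟨⟨l, (hd.1 l).1 h⟩, fun e he h => hd' e he (hd.trans h)⟩, hd⟩

/-! ### Existence of codes -/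

variable (S) in
include H in
theorem exists_common_multiple (n : N) : ∃ m : N, 1 ≤ m ∧ ∀ t, t < n → ∃ s, m = (t + 1) * s := by
  refine s1_induction S (P := fun n => ∃ m, 1 ≤ m ∧ ∀ t, t < n → ∃ s, m = (t + 1) * s)
    inferInstance ⟨1, le_rfl, by simp⟩ ?_ n
  rintro n ⟨m, hm, h⟩
  refine ⟨m * (n + 1), one_le_mul hm le_add_self, fun t ht => ?_⟩
  rcases (Order.lt_add_one_iff.1 ht).lt_or_eq with ht | rfl
  · obtain ⟨s, hs⟩ := h t ht
    exact ⟨s * (n + 1), by rw [hs, mul_assoc]⟩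
  · exact ⟨m, mul_comm _ _⟩

/-- Coprimality is expressed without subtraction, as invertibility modulo `d`; inverses multiply. -/
theorem coprime_mul {a b d : N} (ha : ∃ u w, u * a = w * d + 1) (hb : ∃ u w, u * b = w * d + 1) :
    ∃ u w, u * (a * b) = w * d + 1 := by
  obtain ⟨u, w, h⟩ := ha
  obtain ⟨u', w', h'⟩ := hb
  refine ⟨u * u', w * w' * d + w + w', ?_⟩
  rw [show u * u' * (a * b) = (u * a) * (u' * b) by ring, h, h']
  ring

/-- Put X = m(j + t + 2) and compute modulo X + 1. Multiplying m(j + 1) + 1 by j + t + 2 gives t +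
1; a further factor s gives m, another j + t + 2 gives X ≡ -1, and a final X gives X² ≡ 1. The
number Y stands for X - 1. -/
theorem coprime_moduli {m j t s : N} (hm : 1 ≤ m) (h : m = (t + 1) * s) :
    ∃ u w, u * (m * (j + 1) + 1) = w * (m * (j + t + 1 + 1) + 1) + 1 := by
  obtain ⟨Y, hY⟩ := exists_add_of_le (one_le_mul hm (le_add_self : 1 ≤ j + t + 1 + 1))
  set X := m * (j + t + 1 + 1) with hX
  have h₁ : (j + t + 1 + 1) * (m * (j + 1) + 1) = t + 1 + (j + 1) * (X + 1) := by rw [hX]; ring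
  refine ⟨X * s * (j + t + 1 + 1) * (j + t + 1 + 1),
    Y + X * s * (j + t + 1 + 1) * (j + 1), ?_⟩
  calc _ = X * s * (j + t + 1 + 1) * ((j + t + 1 + 1) * (m * (j + 1) + 1)) := by ring
    _ = X * (((t + 1) * s) * (j + t + 1 + 1)) + X * s * (j + t + 1 + 1) * (j + 1) * (X + 1) := by
      rw [h₁]; ring
    _ = X * X + X * s * (j + t + 1 + 1) * (j + 1) * (X + 1) := by rw [← h]
    _ = (1 + Y) * X + X * s * (j + t + 1 + 1) * (j + 1) * (X + 1) := by rw [← hY]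
    _ = (Y * X + X) + X * s * (j + t + 1 + 1) * (j + 1) * (X + 1) := by ring
    _ = (Y * X + (1 + Y)) + X * s * (j + t + 1 + 1) * (j + 1) * (X + 1) := by rw [← hY]
    _ = _ := by ring

variable (S) in
set_option synthInstance.maxHeartbeats 400000 in
set_option synthInstance.maxSize 2000 in
/-- Every finite sequence of values of a `Σ⁰₁`-relation has a code. -/
theorem exists_seq {R : N → N → Prop} (hR : S1 S fun v => R (v 0) (v 1)) (l : N)
    (h : ∀ i < l, ∃ x, R i x) :
    ∃ c, IsSeq c ∧ Len c l ∧ ∀ i < l, ∃ x, Ent c i x ∧ R i x := by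
  have hR' : ∀ i j, S1 S fun v => R (v i) (v j) := fun i j => hR.rel₂ _ _
  obtain ⟨B, hB⟩ : ∃ B, ∀ x, x < l → ∃ y, y < B ∧ R x y := by
    refine s1_induction_le S (P := fun n => ∃ B, ∀ x, x < n → ∃ y, y < B ∧ R x y) inferInstance l
      ⟨0, by simp⟩ fun x hx ⟨b, hb⟩ => ?_
    obtain ⟨y, hy⟩ := h x hx
    refine ⟨b + y + 1, fun z hz => ?_⟩
    rcases (Order.lt_add_one_iff.1 hz).lt_or_eq with hz | rfl
    · obtain ⟨y', hy', hR⟩ := hb z hz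
      exact ⟨y', hy'.trans_le (le_self_add.trans le_self_add), hR⟩
    · exact ⟨y, Order.lt_add_one_iff.2 le_add_self, hy⟩
  obtain ⟨m₀, hm₀, hdvd₀⟩ := exists_common_multiple S l
  -- Divisibility makes the moduli `m * (i + 1) + 1` coprime; `B ≤ m` makes every entry smaller than
  -- its modulus.
  obtain ⟨m, hm, hmB, hdvd⟩ : ∃ m : N, 1 ≤ m ∧ B ≤ m ∧ ∀ t, t < l → ∃ s, m = (t + 1) * s := by
    refine ⟨m₀ * (B + 1), one_le_mul hm₀ le_add_self, ?_, fun t ht => ?_⟩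
    · exact le_self_add.trans (le_mul_of_one_le_left' hm₀)
    · obtain ⟨s, hs⟩ := hdvd₀ t ht
      exact ⟨s * (B + 1), by rw [hs, mul_assoc]⟩
  -- Chinese remainder theorem by induction on `j`: `a` is a common multiple of the moduli used so
  -- far and is invertible modulo the later ones.
  obtain ⟨n, -, hn, -⟩ : ∃ n a,
      (∀ i, i < l → ∃ x q, R i x ∧ x < m * (i + 1) + 1 ∧ n = q * (m * (i + 1) + 1) + x) ∧
      (∀ i, i < l → ∃ s, a = s * (m * (i + 1) + 1)) ∧
      ∀ k, k < l → l ≤ k → ∃ u w, u * a = w * (m * (k + 1) + 1) + 1 := by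
    refine s1_induction_le S (P := fun j => ∃ n a,
      (∀ i, i < j → ∃ x q, R i x ∧ x < m * (i + 1) + 1 ∧ n = q * (m * (i + 1) + 1) + x) ∧
      (∀ i, i < j → ∃ s, a = s * (m * (i + 1) + 1)) ∧
      ∀ k, k < l → j ≤ k → ∃ u w, u * a = w * (m * (k + 1) + 1) + 1) inferInstance l
      ⟨0, 1, by simp, by simp, fun k _ _ => ⟨1, 0, by simp⟩⟩ ?_
    rintro j hj ⟨n, a, hn, ha, hcop⟩
    obtain ⟨x, hxB, hx⟩ := hB j hj
    obtain ⟨u, w, huw⟩ := hcop j hj le_rfl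
    -- Modulo M = m(j + 1) + 1 this is x - n, written without subtraction. Since u * a is 1 modulo
    -- M, adding u * a * z to n gives remainder x and leaves the earlier remainders alone.
    set z := x + n * (m * (j + 1)) with hz
    refine ⟨n + u * a * z, a * (m * (j + 1) + 1), fun i hi => ?_, fun i hi => ?_,
      fun k hk hjk => ?_⟩
    · rcases (Order.lt_add_one_iff.1 hi).lt_or_eq with hi | rfl
      · obtain ⟨y, q, hy, hlt, hq⟩ := hn i hi
        obtain ⟨s, hs⟩ := ha i hi
        refine ⟨y, q + u * s * z, hy, hlt, ?_⟩
        rw [hq, hs]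
        ring
      · refine ⟨x, n + w * z, hx, ?_, ?_⟩
        · refine Order.lt_add_one_iff.2 (hxB.le.trans (hmB.trans ?_))
          exact le_mul_of_one_le_right' le_add_self
        · rw [huw, hz]
          ring
    · rcases (Order.lt_add_one_iff.1 hi).lt_or_eq with hi | rfl
      · obtain ⟨s, hs⟩ := ha i hi
        exact ⟨s * (m * (j + 1) + 1), by rw [hs]; ring⟩
      · exact ⟨a, rfl⟩
    · have hjk' := Order.add_one_le_iff.1 hjk
      refine coprime_mul (hcop k hk hjk'.le) ?_
      obtain ⟨t, rfl⟩ := exists_add_of_le hjk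
      obtain ⟨s, hs⟩ := hdvd t (lt_of_le_of_lt le_add_self hk)
      have := coprime_moduli (j := j) hm hs
      rwa [show j + t + 1 + 1 = j + 1 + t + 1 by ring] at this
  obtain ⟨c, hc, hsame⟩ := Len.exists_isSeq S (c := pr l (pr m n)) ⟨m, n, rfl⟩
  refine ⟨c, hc, (hsame.1 l).1 ⟨m, n, rfl⟩, fun i hi => ?_⟩
  obtain ⟨x, q, hx, hlt, hq⟩ := hn i hi
  exact ⟨x, (hsame.2 i x).1 ⟨l, m, n, q, rfl, hi, hlt, hq⟩, hx⟩

end Ordered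

@[simp] theorem scons_two {α : Type*} (x : α) (v : ℕ → α) : scons x v 2 = v 1 := rfl
@[simp] theorem scons_three {α : Type*} (x : α) (v : ℕ → α) : scons x v 3 = v 2 := rfl
@[simp] theorem scons_four {α : Type*} (x : α) (v : ℕ → α) : scons x v 4 = v 3 := rfl

section Ordered

variable {N S : Type} [CommSemiring N] [LinearOrder N] [IsStrictOrderedRing N]
  [CanonicallyOrderedAdd N] [SuccAddOrder N] [Membership N S] [Nonempty S]

/-! ### The meaning of the formulas on sequences and orders -/

/-- Codes of non-increasing sequences. -/
def InPow (c : N) : Prop := IsSeq c ∧ ∀ i x y, Ent c i x → Ent c (i + 1) y → y ≤ x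

/-- The lexicographic order on codes of sequences. -/
def Lex (c d : N) : Prop :=
  ((∃ l l', Len c l ∧ Len d l' ∧ l ≤ l') ∧ ∀ i x, Ent c i x → Ent d i x) ∨
    ∃ j x y, Ent c j x ∧ Ent d j y ∧ x < y ∧ ∀ i z, i < j → (Ent c i z ↔ Ent d i z)

section Sat

variable (v : ℕ → N) (s : ℕ → S)

@[simp] theorem sat_le (a b : Tm) : (Fm.le a b).Sat v s ↔ a.val v ≤ b.val v := by
  simp [Fm.le, le_iff_lt_or_eq]

@[simp] theorem sat_hasLength (c l : Tm) : (hasLength c l).Sat v s ↔ Len (c.val v) (l.val v) := by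
  simp [hasLength, Len, val_pair]

@[simp] theorem sat_hasEntry (c i x : Tm) :
    (hasEntry c i x).Sat v s ↔ Ent (c.val v) (i.val v) (x.val v) := by
  simp [hasEntry, Ent, val_pair]

@[simp] theorem sat_sameSeq (c d : Tm) : (sameSeq c d).Sat v s ↔ Same (c.val v) (d.val v) := by
  simp [sameSeq, Same]

@[simp] theorem sat_isSeq (c : Tm) : (isSeq c).Sat v s ↔ IsSeq (c.val v) := by
  simp [isSeq, IsSeq]

@[simp] theorem sat_inField (X : ℕ) (t : Tm) :
    (inField X t).Sat v s ↔ pr (t.val v) (t.val v) ∈ s X := Iff.rfl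

@[simp] theorem sat_leIn (X : ℕ) (a b : Tm) :
    (leIn X a b).Sat v s ↔ pr (a.val v) (b.val v) ∈ s X := Iff.rfl

@[simp] theorem sat_ltIn (X : ℕ) (a b : Tm) :
    (ltIn X a b).Sat v s ↔ pr (a.val v) (b.val v) ∈ s X ∧ a.val v ≠ b.val v := by
  simp [ltIn]

/-- The set `X` is the usual order on the numbers. -/
def IsOmega (X : S) : Prop := ∀ x y : N, pr x y ∈ X ↔ x ≤ y

theorem isOmega_of_sat {X : ℕ} (h : (isOmega X).Sat v s) : IsOmega (N := N) (s X) := by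
  intro x y
  simp only [isOmega, sat_allN, sat_iff, sat_mem, sat_exN, sat_and, sat_eq, val_pair, sat_le,
    Tm.val_var, scons_zero, scons_one, scons_two] at h
  rw [h]
  constructor
  · rintro ⟨x', y', h, h'⟩
    obtain ⟨rfl, rfl⟩ := pr_inj.1 h
    exact h'
  · exact fun h => ⟨x, y, rfl, h⟩

theorem sat_inOmegaPow {X : ℕ} (hX : IsOmega (N := N) (s X)) (c : Tm) :
    (inOmegaPow X c).Sat v s ↔ InPow (c.val v) := by
  have hX' := hX
  unfold IsOmega at hX'
  simp [inOmegaPow, InPow, hX']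

theorem sat_lexLe {X : ℕ} (hX : IsOmega (N := N) (s X)) (c d : Tm) :
    (lexLe X c d).Sat v s ↔ Lex (c.val v) (d.val v) := by
  have hX' := hX
  unfold IsOmega at hX'
  simp [lexLe, Lex, hX', lt_iff_le_and_ne]

/-- The set `Y` is the lexicographic order on non-increasing sequences of numbers. -/
def IsOmegaPow (Y : S) : Prop :=
  ∀ z : N, z ∈ Y ↔ ∃ c d, z = pr c d ∧ InPow c ∧ InPow d ∧ Lex c d

theorem sat_isOmegaPow {X Y : ℕ} (hX : IsOmega (N := N) (s X)) :
    (isOmegaPow X Y).Sat v s ↔ IsOmegaPow (N := N) (s Y) := by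
  simp [isOmegaPow, IsOmegaPow, sat_inOmegaPow _ _ hX, sat_lexLe _ _ hX, val_pair]

theorem sat_isOmega (X : ℕ) : (isOmega X).Sat v s ↔
    ∀ z, z ∈ s X ↔ ∃ x y : N, z = pr x y ∧ x ≤ y := by
  simp [isOmega, val_pair]

theorem sat_isLinearOrder (Y : ℕ) : (isLinearOrder Y).Sat v s ↔
    (∀ z, z ∈ s Y → ∃ x y : N, z = pr x y) ∧
    (∀ x y : N, pr x y ∈ s Y → pr x x ∈ s Y ∧ pr y y ∈ s Y) ∧
    (∀ x y z : N, pr x y ∈ s Y → pr y z ∈ s Y → pr x z ∈ s Y) ∧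
    (∀ x y : N, pr x y ∈ s Y → pr y x ∈ s Y → x = y) ∧
    ∀ x y : N, pr x x ∈ s Y → pr y y ∈ s Y → pr x y ∈ s Y ∨ pr y x ∈ s Y := by
  simp [isLinearOrder, val_pair]

/-- The sets `I`, `J`, `F` witness that `Y` is not a weak well order. -/
structure IsCollapse (Y I J F : S) : Prop where
  field : ∀ x : N, x ∈ I → pr x x ∈ Y
  lower : ∀ x y : N, x ∈ I → pr y x ∈ Y → y ≠ x → y ∈ I
  lower' : ∀ x y : N, x ∈ J → pr y x ∈ Y → y ≠ x → y ∈ J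
  subset : ∀ x : N, x ∈ J → x ∈ I
  proper : ∃ x : N, x ∈ I ∧ x ∉ J
  maps : ∀ x y : N, pr x y ∈ F → x ∈ I ∧ y ∈ J
  total : ∀ x : N, x ∈ I → ∃ y, pr x y ∈ F
  unique : ∀ x y z : N, pr x y ∈ F → pr x z ∈ F → y = z
  mono : ∀ x y x' y' : N, pr x y ∈ F → pr x' y' ∈ F → pr x x' ∈ Y → x ≠ x' →
    pr y y' ∈ Y ∧ y ≠ y'

theorem sat_isWeakWellOrder (Y : ℕ) (h : (isLinearOrder Y).Sat v s)
    (h' : ∀ I J F, ¬ IsCollapse (N := N) (s Y) I J F) : (isWeakWellOrder Y).Sat v s := by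
  unfold isWeakWellOrder
  rw [sat_and, sat_neg, sat_exS]
  refine ⟨h, ?_⟩
  rintro ⟨I, h⟩
  simp only [sat_exS] at h
  obtain ⟨J, F, h⟩ := h
  apply h' I J F
  simp [isInitialSegment, isProperSubset, isEmbedding, isFunction, val_pair] at h
  obtain ⟨⟨h₁, h₂⟩, ⟨h₃, h₄⟩, ⟨h₅, h₆⟩, ⟨h₇, h₈, h₉⟩, h₁₀⟩ := h
  refine ⟨h₁, fun x y => h₂ y x, fun x y => h₄ y x, h₅, h₆, fun x y h => ?_, h₈, h₉, fun x y x' y' h h' => h₁₀ x y x' y' h h'⟩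
  obtain ⟨x', y', h, h'⟩ := h₇ _ h
  obtain ⟨rfl, rfl⟩ := pr_inj.1 h
  exact h'

theorem isWellOrder_of_sat (Y : ℕ) (h : (isWellOrder Y).Sat v s) (F : S)
    (h₁ : ∀ z, z ∈ F → ∃ x y : N, z = pr x y ∧ pr y y ∈ s Y) (h₂ : ∀ x : N, ∃ y, pr x y ∈ F)
    (h₃ : ∀ x y z : N, pr x y ∈ F → pr x z ∈ F → y = z) :
    ∃ x y z : N, pr x y ∈ F ∧ pr (x + 1) z ∈ F ∧ ¬ (pr z y ∈ s Y ∧ z ≠ y) := by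
  unfold isWellOrder at h
  rw [sat_and, sat_neg, sat_exS] at h
  by_contra! h'
  refine h.2 ⟨F, ?_⟩
  simp [isFunction, val_pair]
  exact ⟨⟨h₁, h₂, h₃⟩, fun x y z h h'' => h' x y z h h''⟩

end Sat

end Ordered

section Ordered

variable {N S : Type} [CommSemiring N] [LinearOrder N] [IsStrictOrderedRing N]
  [CanonicallyOrderedAdd N] [SuccAddOrder N] [Membership N S] [Nonempty S]

/-! ### Shifted entries and the strict lexicographic order -/

theorem pos_of_lt' {x y : N} (h : x < y) : 0 < y := lt_of_le_of_lt zero_le h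

theorem lt_add_one' (x : N) : x < x + 1 := Order.lt_add_one_iff.2 le_rfl

open Classical in
/-- The successor of the `i`-th entry of the sequence with code `c`, or `0` if there is none. -/
noncomputable def entry (c i : N) : N := if h : ∃ x, Ent c i x then h.choose + 1 else 0

theorem Ent.ent_eq {c i x : N} (h : Ent c i x) : entry c i = x + 1 := by
  have h' : ∃ x, Ent c i x := ⟨x, h⟩
  rw [entry, dif_pos h', h'.choose_spec.unique h]

theorem ent_eq_zero {c i : N} (h : ∀ x, ¬ Ent c i x) : entry c i = 0 :=
  dif_neg fun ⟨x, hx⟩ => h x hx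

theorem ent_pos {c i : N} (h : 0 < entry c i) : ∃ x, Ent c i x := by
  by_contra! h'
  rw [ent_eq_zero h'] at h
  exact lt_irrefl _ h

theorem ent_eq_add_one {c i x : N} (h : entry c i = x + 1) : Ent c i x := by
  obtain ⟨y, hy⟩ := ent_pos (h ▸ pos_of_lt' (lt_add_one' x))
  rw [hy.ent_eq] at h
  rwa [← add_right_cancel h]

theorem ent_eq_iff {c d i j : N} : entry c i = entry d j ↔ ∀ x, Ent c i x ↔ Ent d j x := by
  constructor
  · intro h x
    exact ⟨fun hx => ent_eq_add_one (h ▸ hx.ent_eq), fun hx => ent_eq_add_one (h ▸ hx.ent_eq)⟩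
  · intro h
    by_cases hc : ∃ x, Ent c i x
    · obtain ⟨x, hx⟩ := hc
      rw [hx.ent_eq, ((h x).1 hx).ent_eq]
    · push Not at hc
      rw [ent_eq_zero hc, ent_eq_zero fun x hx => hc x ((h x).2 hx)]

theorem Len.ent_eq_zero {c l : N} (h : Len c l) {i : N} (hi : l ≤ i) : entry c i = 0 :=
  SOA.ent_eq_zero fun _ hx => not_lt.2 hi (hx.lt h)

instance D0.ent_eq (f g k l : (ℕ → N) → N) [IsTerm f] [IsTerm g] [IsTerm k] [IsTerm l] :
    D0 S fun v => entry (f v) (g v) = entry (k v) (l v) := by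
  refine (inferInstance : D0 S fun v => ∀ x, x ≤ f v + k v →
    (Ent (f v) (g v) x ↔ Ent (k v) (l v) x)).congr fun v => ?_
  rw [ent_eq_iff]
  refine ⟨fun h x _ => h x, fun h x => ?_⟩
  exact ⟨fun hx => (h x (hx.le_right.trans le_self_add)).1 hx,
    fun hx => (h x (hx.le_right.trans le_add_self)).2 hx⟩

/-- The strict lexicographic order. -/
def SLex (c d : N) : Prop := ∃ j, entry c j < entry d j ∧ ∀ i < j, entry c i = entry d i

theorem SLex.trans {c d e : N} (h : SLex c d) (h' : SLex d e) : SLex c e := by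
  obtain ⟨j, hj, hj'⟩ := h
  obtain ⟨k, hk, hk'⟩ := h'
  rcases lt_trichotomy j k with h | rfl | h
  · exact ⟨j, hk' j h ▸ hj, fun i hi => (hj' i hi).trans (hk' i (hi.trans h))⟩
  · exact ⟨j, hj.trans hk, fun i hi => (hj' i hi).trans (hk' i hi)⟩
  · exact ⟨k, (hj' k h).symm ▸ hk, fun i hi => (hj' i (hi.trans h)).trans (hk' i hi)⟩

theorem SLex.irrefl (c : N) : ¬ SLex c c := fun ⟨_, h, _⟩ => lt_irrefl _ h

variable [H : RCAModel N S]

variable (S) in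
include H in
theorem Len.ent_pos {c l : N} (h : Len c l) {i : N} (hi : i < l) : 0 < entry c i := by
  obtain ⟨x, hx⟩ := h.exists_ent S hi
  rw [hx.ent_eq]
  exact pos_of_lt' (lt_add_one' x)

variable (S) in
include H in
theorem Len.lt_of_ent_ne_zero {c l : N} (h : Len c l) {i : N} (hi : entry c i ≠ 0) : i < l := by
  by_contra! h'
  exact hi (h.ent_eq_zero h')

variable (S) in
include H in
theorem Len.eq_of_ent {c d l l' : N} (h : Len c l) (h' : Len d l') (he : ∀ i, entry c i = entry d i) :
    l = l' := by
  rcases lt_trichotomy l l' with hl | hl | hl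
  · have := h'.ent_pos S hl
    rw [← he, h.ent_eq_zero le_rfl] at this
    exact (lt_irrefl _ this).elim
  · exact hl
  · have := h.ent_pos S hl
    rw [he, h'.ent_eq_zero le_rfl] at this
    exact (lt_irrefl _ this).elim

variable (S) in
include H in
theorem IsSeq.eq_of_ent {c d : N} (hc : IsSeq c) (hd : IsSeq d) (h : ∀ i, entry c i = entry d i) :
    c = d := by
  refine hc.eq hd ⟨fun l => ?_, fun i => ent_eq_iff.1 (h i)⟩
  obtain ⟨l', hl'⟩ := hc.1
  obtain ⟨l'', hl''⟩ := hd.1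
  obtain rfl := hl'.eq_of_ent S hl'' h
  exact ⟨fun h => h.unique hl' ▸ hl'', fun h => h.unique hl'' ▸ hl'⟩

variable (S) in
include H in
theorem SLex.total {c d : N} (hc : IsSeq c) (hd : IsSeq d) : c = d ∨ SLex c d ∨ SLex d c := by
  by_cases h : ∀ i, entry c i = entry d i
  · exact .inl (hc.eq_of_ent S hd h)
  · push Not at h
    obtain ⟨i, hi⟩ := h
    obtain ⟨j, hj, hj'⟩ := d0_least S (P := fun i => ¬ entry c i = entry d i) inferInstance hi
    simp only [not_not] at hj'
    rcases lt_or_gt_of_ne hj with h | h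
    · exact .inr (.inl ⟨j, h, hj'⟩)
    · exact .inr (.inr ⟨j, h, fun i hi => (hj' i hi).symm⟩)

-- With `0` for a missing entry, a proper prefix is smaller at the position of its length. Both
-- clauses of `Lex` thus become a comparison at the first difference.
variable (S) in
include H in
theorem lex_iff {c d : N} (hc : IsSeq c) (hd : IsSeq d) : Lex c d ↔ c = d ∨ SLex c d := by
  constructor
  · rintro (⟨⟨l, l', hl, hl', hle⟩, h⟩ | ⟨j, x, y, hx, hy, hxy, h⟩)
    · have h' : ∀ i < l, entry c i = entry d i := fun i hi => by
        obtain ⟨x, hx⟩ := hl.exists_ent S hi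
        rw [hx.ent_eq, (h i x hx).ent_eq]
      rcases hle.lt_or_eq with hlt | rfl
      · exact .inr ⟨l, by rw [hl.ent_eq_zero le_rfl]; exact hl'.ent_pos S hlt, h'⟩
      · refine .inl (hc.eq_of_ent S hd fun i => ?_)
        rcases lt_or_ge i l with hi | hi
        · exact h' i hi
        · rw [hl.ent_eq_zero hi, hl'.ent_eq_zero hi]
    · refine .inr ⟨j, ?_, fun i hi => ent_eq_iff.2 fun z => h i z hi⟩
      rw [hx.ent_eq, hy.ent_eq]
      exact add_lt_add_left hxy 1
  · rintro (rfl | ⟨j, hj, h⟩)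
    · obtain ⟨l, hl⟩ := hc.1
      exact .inl ⟨⟨l, l, hl, hl, le_rfl⟩, fun _ _ h => h⟩
    · obtain ⟨y, hy⟩ := SOA.ent_pos (pos_of_lt' hj)
      rcases eq_or_ne (entry c j) 0 with h0 | h0
      · obtain ⟨l, hl⟩ := hc.1
        obtain ⟨l', hl'⟩ := hd.1
        have hlj : l ≤ j := by
          by_contra! hlt
          exact (hl.ent_pos S hlt).ne' h0
        refine .inl ⟨⟨l, l', hl, hl', hlj.trans (hy.lt hl').le⟩, fun i x hx => ?_⟩
        exact (ent_eq_iff.1 (h i ((hx.lt hl).trans_le hlj)) x).1 hx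
      · obtain ⟨x, hx⟩ := SOA.ent_pos (pos_iff_ne_zero.2 h0)
        rw [hx.ent_eq, hy.ent_eq] at hj
        exact .inr ⟨j, x, y, hx, hy, lt_of_add_lt_add_right hj,
          fun i z hi => ent_eq_iff.1 (h i hi) z⟩

variable (S) in
include H in
theorem inPow_iff {c : N} : InPow c ↔ IsSeq c ∧ ∀ i, entry c (i + 1) ≤ entry c i := by
  refine and_congr_right fun hc => ⟨fun h i => ?_, fun h i x y hx hy => ?_⟩
  · by_cases hy : ∃ y, Ent c (i + 1) y
    · obtain ⟨y, hy⟩ := hy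
      obtain ⟨l, hl, hil⟩ := hy.len
      obtain ⟨x, hx⟩ := hl.exists_ent S ((lt_add_one' i).trans hil)
      rw [hx.ent_eq, hy.ent_eq]
      exact add_le_add_left (h i x y hx hy) 1
    · rw [ent_eq_zero fun y hy' => hy ⟨y, hy'⟩]
      exact zero_le
  · have := h i
    rw [hx.ent_eq, hy.ent_eq] at this
    exact le_of_add_le_add_right this

instance D0.inPow (f : (ℕ → N) → N) [IsTerm f] : D0 S fun v => InPow (f v) := by
  refine D0.rel₂ (R := fun c _ => InPow c) ((inferInstance : D0 S fun v => IsSeq (v 0) ∧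
    ∀ i, i ≤ v 0 → ∀ x, x ≤ v 0 → ∀ y, y ≤ v 0 → Ent (v 0) i x → Ent (v 0) (i + 1) y →
      y ≤ x).congr fun v => ?_) f f
  refine and_congr_right fun _ => ⟨fun h i _ x _ y _ => h i x y, fun h i x y hx hy => ?_⟩
  exact h i hx.le_left x hx.le_right y hy.le_right hx hy

instance D0.lex (f g : (ℕ → N) → N) [IsTerm f] [IsTerm g] : D0 S fun v => Lex (f v) (g v) := by
  refine D0.rel₂ ((inferInstance : D0 S fun v =>
    ((∃ l, l ≤ v 0 ∧ ∃ l', l' ≤ v 1 ∧ (Len (v 0) l ∧ Len (v 1) l' ∧ l ≤ l')) ∧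
      ∀ i, i ≤ v 0 → ∀ x, x ≤ v 0 → Ent (v 0) i x → Ent (v 1) i x) ∨
    ∃ j, j ≤ v 0 ∧ ∃ x, x ≤ v 0 ∧ ∃ y, y ≤ v 1 ∧ (Ent (v 0) j x ∧ Ent (v 1) j y ∧ x < y ∧
      ∀ i, i < j → entry (v 0) i = entry (v 1) i)).congr fun v => ?_) f g
  refine or_congr (and_congr ⟨?_, ?_⟩ ⟨fun h i _ x _ => h i x, fun h i x hx =>
    h i hx.le_left x hx.le_right hx⟩) ⟨?_, ?_⟩
  · rintro ⟨l, l', h, h', hl⟩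
    exact ⟨l, h.le, l', h'.le, h, h', hl⟩
  · rintro ⟨l, -, l', -, h⟩
    exact ⟨l, l', h⟩
  · rintro ⟨j, x, y, hx, hy, hxy, h⟩
    exact ⟨j, hx.le_left, x, hx.le_right, y, hy.le_right, hx, hy, hxy,
      fun i hi => ent_eq_iff.2 fun z => h i z hi⟩
  · rintro ⟨j, -, x, -, y, -, hx, hy, hxy, h⟩
    exact ⟨j, x, y, hx, hy, hxy, fun i z hi => ent_eq_iff.1 (h i hi) z⟩

variable (N S) in
theorem exists_omega : ∃ X : S, ∀ z, z ∈ X ↔ ∃ x y : N, z = pr x y ∧ x ≤ y := by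
  refine d0_comprehension S (P := fun z => ∃ x y : N, z = pr x y ∧ x ≤ y)
    ((inferInstance : D0 S fun v => ∃ x, x ≤ v 0 ∧ ∃ y, y ≤ v 0 ∧ (v 0 = pr x y ∧ x ≤ y)).congr
      fun v => ⟨?_, ?_⟩)
  · rintro ⟨x, y, h, hxy⟩
    exact ⟨x, h ▸ le_pr_left _ _, y, h ▸ le_pr_right _ _, h, hxy⟩
  · rintro ⟨x, -, y, -, h⟩
    exact ⟨x, y, h⟩

variable (N S) in
theorem exists_omegaPow : ∃ Y : S, IsOmegaPow (N := N) Y := by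
  refine d0_comprehension S (P := fun z => ∃ x y : N, z = pr x y ∧ InPow x ∧ InPow y ∧ Lex x y)
    ((inferInstance : D0 S fun v => ∃ x, x ≤ v 0 ∧ ∃ y, y ≤ v 0 ∧ (v 0 = pr x y ∧ InPow x ∧
      InPow y ∧ Lex x y)).congr fun v => ⟨?_, ?_⟩)
  · rintro ⟨x, y, h, hxy⟩
    exact ⟨x, h ▸ le_pr_left _ _, y, h ▸ le_pr_right _ _, h, hxy⟩
  · rintro ⟨x, -, y, -, h⟩
    exact ⟨x, y, h⟩

/-! ### The order `ω(ω)` is linear -/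

section OmegaPow

variable {Y : S} (hY : IsOmegaPow (N := N) Y)
include H hY

theorem IsOmegaPow.mem_iff {x y : N} :
    pr x y ∈ Y ↔ InPow x ∧ InPow y ∧ (x = y ∨ SLex x y) := by
  rw [hY]
  constructor
  · rintro ⟨x', y', h, hx, hy, h'⟩
    obtain ⟨rfl, rfl⟩ := pr_inj.1 h
    exact ⟨hx, hy, (lex_iff S hx.1 hy.1).1 h'⟩
  · rintro ⟨hx, hy, h⟩
    exact ⟨x, y, rfl, hx, hy, (lex_iff S hx.1 hy.1).2 h⟩

theorem IsOmegaPow.field_iff {x : N} : pr x x ∈ Y ↔ InPow x := by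
  rw [hY.mem_iff]
  exact ⟨fun h => h.1, fun h => ⟨h, h, .inl rfl⟩⟩

theorem IsOmegaPow.strict_iff {x y : N} :
    pr x y ∈ Y ∧ x ≠ y ↔ InPow x ∧ InPow y ∧ SLex x y := by
  rw [hY.mem_iff]
  constructor
  · rintro ⟨⟨hx, hy, h⟩, hne⟩
    exact ⟨hx, hy, h.resolve_left hne⟩
  · rintro ⟨hx, hy, h⟩
    refine ⟨⟨hx, hy, .inr h⟩, ?_⟩
    rintro rfl
    exact SLex.irrefl _ h

theorem IsOmegaPow.not_mem_iff {x y : N} (hx : InPow x) (hy : InPow y) :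
    pr x y ∉ Y ↔ SLex y x := by
  rw [hY.mem_iff]
  constructor
  · intro h
    rcases SLex.total S hx.1 hy.1 with h' | h' | h'
    · exact (h ⟨hx, hy, .inl h'⟩).elim
    · exact (h ⟨hx, hy, .inr h'⟩).elim
    · exact h'
  · rintro h ⟨-, -, rfl | h'⟩
    · exact SLex.irrefl _ h
    · exact SLex.irrefl _ (h.trans h')

theorem IsOmegaPow.sat_isLinearOrder (v : ℕ → N) (s : ℕ → S) (X : ℕ) (hX : s X = Y) :
    (isLinearOrder X).Sat v s := by
  rw [SOA.sat_isLinearOrder, hX]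
  refine ⟨fun z hz => ?_, fun x y h => ?_, fun x y z h h' => ?_, fun x y h h' => ?_,
    fun x y hx hy => ?_⟩
  · obtain ⟨x, y, h, -⟩ := (hY z).1 hz
    exact ⟨x, y, h⟩
  · rw [hY.mem_iff] at h
    exact ⟨hY.field_iff.2 h.1, hY.field_iff.2 h.2.1⟩
  · rw [hY.mem_iff] at *
    refine ⟨h.1, h'.2.1, ?_⟩
    rcases h.2.2 with rfl | h₁
    · exact h'.2.2
    · rcases h'.2.2 with rfl | h₂
      · exact .inr h₁
      · exact .inr (h₁.trans h₂)
  · rw [hY.mem_iff] at *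
    rcases h.2.2 with h₁ | h₁
    · exact h₁
    · rcases h'.2.2 with h₂ | h₂
      · exact h₂.symm
      · exact (SLex.irrefl _ (h₁.trans h₂)).elim
  · rw [hY.field_iff] at hx hy
    by_contra! h
    rw [hY.not_mem_iff hx hy, hY.not_mem_iff hy hx] at h
    exact SLex.irrefl _ (h.1.trans h.2)

end OmegaPow

end Ordered

section Ordered

variable {N S : Type} [CommSemiring N] [LinearOrder N] [IsStrictOrderedRing N]
  [CanonicallyOrderedAdd N] [SuccAddOrder N] [Membership N S] [Nonempty S]

/-! ### Prefixes and extensions of sequences -/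

/-- `s` is the code of the first `j` entries of `w`. -/
def IsPre (w j s : N) : Prop := IsSeq s ∧ Len s j ∧ ∀ i, i < j → entry s i = entry w i

instance D0.isPre (f g k : (ℕ → N) → N) [IsTerm f] [IsTerm g] [IsTerm k] :
    D0 S fun v => IsPre (f v) (g v) (k v) :=
  D0.rel₃ (R := IsPre) (inferInstance : D0 S fun v => IsSeq (v 2) ∧ Len (v 2) (v 1) ∧
    ∀ i, i < v 1 → entry (v 2) i = entry (v 0) i) f g k

theorem IsPre.inPow [H : RCAModel N S] {w j s : N} (h : IsPre w j s) (hw : InPow w) : InPow s := by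
  rw [inPow_iff S] at *
  refine ⟨h.1, fun i => ?_⟩
  rcases lt_or_ge (i + 1) j with hi | hi
  · rw [h.2.2 _ hi, h.2.2 _ ((lt_add_one' i).trans hi)]
    exact hw.2 i
  · rw [h.2.1.ent_eq_zero hi]
    exact zero_le

variable [H : RCAModel N S]

variable (S) in
include H in
theorem exists_pre {w n j : N} (hw : Len w n) (hj : j ≤ n) : ∃ s, IsPre w j s := by
  obtain ⟨s, hs, hl, h⟩ := exists_seq S (R := fun i x => Ent w i x) inferInstance j
    fun i hi => hw.exists_ent S (hi.trans_le hj)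
  refine ⟨s, hs, hl, fun i hi => ?_⟩
  obtain ⟨x, hx, hx'⟩ := h i hi
  rw [hx.ent_eq, hx'.ent_eq]

variable (S) in
include H in
theorem IsPre.unique {w j s s' : N} (h : IsPre w j s) (h' : IsPre w j s') : s = s' := by
  refine h.1.eq_of_ent S h'.1 fun i => ?_
  rcases lt_or_ge i j with hi | hi
  · rw [h.2.2 i hi, h'.2.2 i hi]
  · rw [h.2.1.ent_eq_zero hi, h'.2.1.ent_eq_zero hi]

theorem IsPre.self {w n : N} (h : IsSeq w) (hn : Len w n) : IsPre w n w :=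
  ⟨h, hn, fun _ _ => rfl⟩

theorem IsPre.pre {w j k s p : N} (h : IsPre w j s) (hp : IsPre w k p) (hk : k ≤ j) :
    IsPre s k p :=
  ⟨hp.1, hp.2.1, fun i hi => by rw [hp.2.2 i hi, h.2.2 i (hi.trans_le hk)]⟩

variable (S) in
include H in
theorem IsPre.eq_or_sLex {w n j s : N} (h : IsPre w j s) (hw : IsSeq w) (hn : Len w n)
    (hj : j ≤ n) : s = w ∨ SLex s w := by
  rcases hj.lt_or_eq with hj | rfl
  · refine .inr ⟨j, ?_, h.2.2⟩
    rw [h.2.1.ent_eq_zero le_rfl]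
    exact hn.ent_pos S hj
  · exact .inl (h.unique S (IsPre.self hw hn))

variable (S) in
include H in
/-- The sequence `p` can be extended by `m` copies of `e`. -/
theorem exists_extension {p l : N} (hp : Len p l) (e m : N) :
    ∃ w, IsSeq w ∧ Len w (l + m) ∧ (∀ i < l, entry w i = entry p i) ∧
      ∀ i, l ≤ i → i < l + m → entry w i = e + 1 := by
  obtain ⟨w, hw, hl, h⟩ := exists_seq S (R := fun i x => i < l ∧ Ent p i x ∨ l ≤ i ∧ x = e)
    inferInstance (l + m) fun i hi => by
      rcases lt_or_ge i l with hi | hi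
      · obtain ⟨x, hx⟩ := hp.exists_ent S hi
        exact ⟨x, .inl ⟨hi, hx⟩⟩
      · exact ⟨e, .inr ⟨hi, rfl⟩⟩
  refine ⟨w, hw, hl, fun i hi => ?_, fun i hi hi' => ?_⟩
  · obtain ⟨x, hx, ⟨-, h⟩ | ⟨h, -⟩⟩ := h i (hi.trans_le le_self_add)
    · rw [hx.ent_eq, h.ent_eq]
    · exact (not_lt.2 h hi).elim
  · obtain ⟨x, hx, ⟨h, -⟩ | ⟨-, rfl⟩⟩ := h i hi'
    · exact (not_lt.2 hi h).elim
    · rw [hx.ent_eq]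

variable (S) in
include H in
/-- If `y < p * ⟨e + 1⟩` then `y < p * ⟨e, …, e⟩` for every longer sequence of that form. -/
theorem sLex_extension {y s w l m e n : N} (hy : InPow y) (hn : Len y n) (hnm : n < l + m)
    (hm : 0 < m) (hw : IsSeq w) (hwl : Len w (l + m)) (hs : Len s (l + 1))
    (hse : entry s l = e + 1 + 1) (hws : ∀ i < l, entry w i = entry s i)
    (hwe : ∀ i, l ≤ i → i < l + m → entry w i = e + 1) (h : SLex y s) : SLex y w := by
  have hy' := ((inPow_iff S).1 hy).2
  rcases SLex.total S hy.1 hw with rfl | h' | ⟨j, hj, hj'⟩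
  · exact ((hn.unique hwl).not_lt hnm).elim
  · exact h'
  exfalso
  obtain ⟨k, hk, hk'⟩ := h
  rcases lt_trichotomy k l with hkl | rfl | hkl
  · rcases lt_trichotomy j k with hjk | rfl | hjk
    · exact hj.ne (by rw [hws j (hjk.trans hkl), hk' j hjk])
    · exact lt_irrefl _ (hk.trans_eq (hws j hkl).symm |>.trans hj)
    · exact hk.ne (by rw [← hj' k hjk, hws k hkl])
  · rcases lt_trichotomy j k with hjk | rfl | hjk
    · exact hj.ne (by rw [hws j hjk, hk' j hjk])
    · rw [hwe j le_rfl (lt_add_of_pos_right j hm)] at hj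
      rw [hse] at hk
      exact not_lt.2 (Order.lt_add_one_iff.1 hk) hj
    -- The length of `y` keeps `j` inside the block of copies of `e`. There `y` agrees with `w` just
    -- before `j`, and a non-increasing sequence cannot exceed `e` afterwards.
    · have hjn := hn.lt_of_ent_ne_zero S (pos_of_lt' hj).ne'
      have hj1 : 1 ≤ j := Order.one_le_iff_pos.2 (pos_of_lt' hjk)
      obtain ⟨i, hi⟩ := exists_add_of_le hj1
      rw [add_comm] at hi
      subst hi
      have hki := Order.lt_add_one_iff.1 hjk
      have hil := hjn.trans hnm
      rw [hwe (i + 1) hjk.le hil] at hj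
      have h₁ := hj' i (lt_add_one' i)
      rw [hwe i hki ((lt_add_one' i).trans hil)] at h₁
      exact not_lt.2 ((hy' i).trans h₁.ge) hj
  · rw [hs.ent_eq_zero (Order.add_one_le_iff.2 hkl)] at hk
    exact not_lt.2 zero_le hk

variable (S) in
include H in
/-- There is nothing strictly between `p` and `p * ⟨0⟩`. -/
theorem not_sLex_between {p s t l : N} (ht : InPow t) (hs : Len s (l + 1)) (hsl : entry s l = 1)
    (hp : IsPre s l p) (h : SLex p t) (h' : SLex t s) : False := by
  obtain ⟨j, hj, hj'⟩ := h
  obtain ⟨k, hk, hk'⟩ := h'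
  have hkl : k < l + 1 := hs.lt_of_ent_ne_zero S (pos_of_lt' hk).ne'
  rcases (Order.lt_add_one_iff.1 hkl).lt_or_eq with hkl | rfl
  · rcases lt_trichotomy j k with hjk | rfl | hjk
    · exact hj.ne (by rw [hk' j hjk, hp.2.2 j (hjk.trans hkl)])
    · rw [hp.2.2 j hkl] at hj
      exact lt_irrefl _ (hj.trans hk)
    · exact hk.ne (by rw [← hj' k hjk, hp.2.2 k hkl])
  · rw [hsl, Order.lt_one_iff] at hk
    have hkj : k ≤ j := by
      by_contra! hjk
      exact hj.ne (by rw [hk' j hjk, hp.2.2 j hjk])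
    obtain ⟨n, hn⟩ := ht.1.1
    have hnk : n ≤ k := by
      by_contra! hlt
      exact (hn.ent_pos S hlt).ne' hk
    rw [hn.ent_eq_zero (hnk.trans hkj)] at hj
    exact not_lt.2 zero_le hj

/-! ### The order `ω(ω)` is a weak well order -/

namespace IsCollapse

variable {Y I J F : S} (hY : IsOmegaPow (N := N) Y) (h : IsCollapse (N := N) Y I J F)
include H hY h

theorem inPow {x : N} (hx : x ∈ I) : InPow x := hY.field_iff.1 (h.field x hx)

theorem mem_of_pre {w n j s : N} (hw : w ∈ I) (hn : Len w n) (hj : j ≤ n) (hs : IsPre w j s) :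
    s ∈ I := by
  have hwp := h.inPow hY hw
  rcases hs.eq_or_sLex S hwp.1 hn hj with rfl | hlt
  · exact hw
  · obtain ⟨h₁, h₂⟩ := hY.strict_iff.2 ⟨hs.inPow (S := S) hwp, hwp, hlt⟩
    exact h.lower w s hw h₁ h₂

theorem image_inPow {x y : N} (hxy : pr x y ∈ F) : InPow y :=
  h.inPow hY (h.subset y (h.maps x y hxy).2)

/-- If `f` maps `w` downwards but not its prefix of length `j₀`, there are two successive prefixes
with this property. -/
theorem walk {w n j₀ y' : N} (hw : w ∈ I) (hn : Len w n) (hj₀ : j₀ ≤ n)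
    (h₀ : ∃ p y, IsPre w j₀ p ∧ pr p y ∈ F ∧ pr p y ∈ Y) (hy' : pr w y' ∈ F)
    (hlt : pr w y' ∉ Y) :
    ∃ j, j₀ ≤ j ∧ j < n ∧ ∃ p y s z, IsPre w j p ∧ IsPre w (j + 1) s ∧ pr p y ∈ F ∧ pr p y ∈ Y ∧
      pr s z ∈ F ∧ pr s z ∉ Y := by
  -- Otherwise not being mapped downwards passes from each prefix to the next one. This property is
  -- Σ⁰₁ in the length, so induction carries it to `w` itself.
  by_contra! hcon
  obtain ⟨k, rfl⟩ := exists_add_of_le hj₀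
  obtain ⟨p, y, hp, hF, hpY⟩ : ∃ p y, IsPre w (j₀ + k) p ∧ pr p y ∈ F ∧ pr p y ∈ Y := by
    refine s1_induction_le S (P := fun k => ∃ p y, IsPre w (j₀ + k) p ∧ pr p y ∈ F ∧ pr p y ∈ Y)
      inferInstance k (by simpa using h₀) ?_
    rintro i hi ⟨p, y, hp, hF, hpY⟩
    have hi' : j₀ + i < j₀ + k := by simpa using hi
    obtain ⟨s, hs⟩ := exists_pre S hn (Order.add_one_le_iff.2 hi')
    obtain ⟨z, hz⟩ := h.total s (h.mem_of_pre hY hw hn (Order.add_one_le_iff.2 hi') hs)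
    refine ⟨s, z, by rwa [← add_assoc], hz, ?_⟩
    by_contra hzY
    exact hzY (hcon _ le_self_add hi' p y s z hp hs hF hpY hz)
  obtain rfl := hp.unique S (IsPre.self (h.inPow hY hw).1 hn)
  exact hlt (h.unique _ _ _ hF hy' ▸ hpY)

omit hY h in
/-- The map `F` sends some `p * ⟨e⟩` downwards, but not `p`. -/
def _root_.SOA.DropsAt (Y I F : S) (e : N) : Prop := ∃ s l p y z, s ∈ I ∧ Len s (l + 1) ∧ Ent s l e ∧
  IsPre s l p ∧ pr p y ∈ F ∧ pr p y ∈ Y ∧ pr s z ∈ F ∧ pr s z ∉ Y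

theorem dropsAt_of_walk {w n j₀ y' : N} (hw : w ∈ I) (hn : Len w n) (hj₀ : j₀ ≤ n)
    (h₀ : ∃ p y, IsPre w j₀ p ∧ pr p y ∈ F ∧ pr p y ∈ Y) (hy' : pr w y' ∈ F)
    (hlt : pr w y' ∉ Y) : ∃ j e, j₀ ≤ j ∧ j < n ∧ Ent w j e ∧ DropsAt Y I F e := by
  obtain ⟨j, hj, hjn, p, y, s, z, hp, hs, h'⟩ := h.walk hY hw hn hj₀ h₀ hy' hlt
  obtain ⟨e, he⟩ := hn.exists_ent S hjn
  have hjn' := Order.add_one_le_iff.2 hjn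
  exact ⟨j, e, hj, hjn, he, s, j, p, y, z, h.mem_of_pre hY hw hn hjn' hs, hs.2.1,
    (ent_eq_iff.1 (hs.2.2 j (lt_add_one' j)) e).2 he, hs.pre hp (lt_add_one' j).le, h'⟩

/-- A point of `I` outside `J` must be mapped downwards since its image lies in the initial segment
`J`, while the empty sequence, being least, cannot be. -/
theorem exists_dropsAt : ∃ e, DropsAt Y I F e := by
  obtain ⟨w, hwI, hwJ⟩ := h.proper
  have hw := h.inPow hY hwI
  obtain ⟨n, hn⟩ := hw.1.1
  obtain ⟨y', hy'⟩ := h.total w hwI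
  have hy'J := (h.maps w y' hy').2
  have hlt : pr w y' ∉ Y := by
    intro hle
    rcases eq_or_ne w y' with rfl | hne
    · exact hwJ hy'J
    · exact hwJ (h.lower' y' w hy'J hle hne)
  obtain ⟨p, hp⟩ := exists_pre S hn (zero_le : 0 ≤ n)
  obtain ⟨y, hy⟩ := h.total p (h.mem_of_pre hY hwI hn zero_le hp)
  have hyP := h.image_inPow hY hy
  have hpY : pr p y ∈ Y := by
    by_contra hpY
    rw [hY.not_mem_iff (hp.inPow (S := S) hw) hyP] at hpY
    obtain ⟨j, hj, -⟩ := hpY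
    rw [hp.2.1.ent_eq_zero zero_le] at hj
    exact not_lt.2 zero_le hj
  obtain ⟨j, e, -, -, -, he⟩ := h.dropsAt_of_walk hY hwI hn zero_le ⟨p, y, hp, hy, hpY⟩ hy' hlt
  exact ⟨e, he⟩

/-- A drop would give p ≤ f(p) < f(p*⟨0⟩) < p*⟨0⟩, but p*⟨0⟩ is the immediate successor of p. -/
theorem not_dropsAt_zero : ¬ DropsAt Y I F (0 : N) := by
  rintro ⟨s, l, p, y, z, hsI, hs, hsl, hp, hpF, hpY, hsF, hsY⟩
  have hsP := h.inPow hY hsI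
  have hpP := hp.inPow (S := S) hsP
  have hzP := h.image_inPow hY hsF
  rw [hY.not_mem_iff hsP hzP] at hsY
  have hps : SLex p s := by
    rcases hp.eq_or_sLex S hsP.1 hs (lt_add_one' l).le with rfl | h
    · exact ((lt_add_one' l).ne (hp.2.1.unique hs)).elim
    · exact h
  obtain ⟨h₁, h₂⟩ := hY.strict_iff.2 ⟨hpP, hsP, hps⟩
  have hyz := (hY.strict_iff.1 (h.mono p y s z hpF hsF h₁ h₂)).2.2
  refine not_sLex_between S hzP hs (by rw [hsl.ent_eq, zero_add]) hp ?_ hsY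
  rcases (hY.mem_iff.1 hpY).2.2 with rfl | h
  · exact hyz
  · exact h.trans hyz

/-- Some w = p*⟨e, …, e⟩ lies strictly between z = f(p*⟨e+1⟩) and p*⟨e+1⟩. Monotonicity gives f(w) <
z < w, so there is a drop on the way from p to w, and every entry there is e. -/
theorem dropsAt_of_add_one {e : N} (he : DropsAt Y I F (e + 1)) : DropsAt Y I F e := by
  obtain ⟨s, l, p, y, z, hsI, hs, hsl, hp, hpF, hpY, hsF, hsY⟩ := he
  have hsP := h.inPow hY hsI
  have hzP := h.image_inPow hY hsF
  rw [hY.not_mem_iff hsP hzP] at hsY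
  obtain ⟨n, hn⟩ := hzP.1.1
  -- With `n + 1` copies `w` is longer than `z`, as `sLex_extension` requires.
  obtain ⟨w, hw, hwl, hwp, hwe⟩ := exists_extension S hp.2.1 e (n + 1)
  have hws : ∀ i < l, entry w i = entry s i := fun i hi => by rw [hwp i hi, hp.2.2 i hi]
  have hl : l < l + (n + 1) := lt_add_of_pos_right l (pos_of_lt' (lt_add_one' n))
  have hse := hsl.ent_eq
  have hwP : InPow w := by
    rw [inPow_iff S]
    refine ⟨hw, fun i => ?_⟩
    have hsi := ((inPow_iff S).1 hsP).2 i
    rcases lt_or_ge (i + 1) (l + (n + 1)) with hi | hi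
    · rcases lt_trichotomy (i + 1) l with hil | rfl | hil
      · rw [hws _ hil, hws _ ((lt_add_one' i).trans hil)]
        exact hsi
      · rw [hwe _ le_rfl hi, hws i (lt_add_one' i)]
        rw [hse] at hsi
        exact (lt_add_one' _).le.trans hsi
      · rw [hwe _ hil.le hi, hwe i (Order.lt_add_one_iff.1 hil) ((lt_add_one' i).trans hi)]
    · rw [hwl.ent_eq_zero hi]
      exact zero_le
  have hws' : SLex w s := by
    refine ⟨l, ?_, hws⟩
    rw [hwe l le_rfl hl, hse]
    exact lt_add_one' _
  obtain ⟨h₁, h₂⟩ := hY.strict_iff.2 ⟨hwP, hsP, hws'⟩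
  have hwI := h.lower s w hsI h₁ h₂
  obtain ⟨u, hu⟩ := h.total w hwI
  have huP := h.image_inPow hY hu
  have huz := (hY.strict_iff.1 (h.mono w u s z hu hsF h₁ h₂)).2.2
  have hzw : SLex z w := sLex_extension S hzP hn
    ((lt_add_one' n).trans_le le_add_self) (pos_of_lt' (lt_add_one' n)) hw hwl hs hse hws hwe hsY
  have huw : pr w u ∉ Y := (hY.not_mem_iff hwP huP).2 (huz.trans hzw)
  obtain ⟨j, e', hj, hjn, he', hd⟩ := h.dropsAt_of_walk hY hwI hwl hl.le
    ⟨p, y, ⟨hp.1, hp.2.1, fun i hi => (hwp i hi).symm⟩, hpF, hpY⟩ hu huw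
  have := hwe j hj hjn
  rw [he'.ent_eq] at this
  rwa [← add_right_cancel this]

set_option synthInstance.maxHeartbeats 400000 in
set_option synthInstance.maxSize 2000 in
theorem false : False := by
  obtain ⟨e, he⟩ := h.exists_dropsAt hY
  obtain ⟨j, hj, hd⟩ : ∃ j, j + e = e ∧ DropsAt Y I F j := by
    -- Downward induction from `e` to `0`: `i` counts the steps already taken. `DropsAt` is
    -- existential over bounded conditions, hence Σ⁰₁.
    refine s1_induction_le S (P := fun i => ∃ j, j + i = e ∧ DropsAt Y I F j) ?_ e
      ⟨e, by simp, he⟩ ?_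
    · unfold DropsAt
      infer_instance
    · rintro i hi ⟨j, hj, hd⟩
      rcases eq_or_ne j 0 with rfl | h0
      · rw [zero_add] at hj
        exact (hi.ne hj).elim
      · obtain ⟨j, rfl⟩ := exists_add_of_le (Order.one_le_iff_pos.2 (pos_iff_ne_zero.2 h0))
        rw [add_comm 1 j] at hj hd
        exact ⟨j, by rw [← hj]; ring, h.dropsAt_of_add_one hY hd⟩
  have : j = 0 := by simpa using hj
  exact h.not_dropsAt_zero hY (this ▸ hd)

end IsCollapse

variable (N S) in
theorem sat_weakWellOrder (v : ℕ → N) (s : ℕ → S) :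
    (omegaOmegaSatisfies isWeakWellOrder).Sat v s := by
  obtain ⟨X, hX⟩ := exists_omega N S
  obtain ⟨Y, hY⟩ := exists_omegaPow N S
  unfold omegaOmegaSatisfies
  rw [sat_exS]
  refine ⟨X, ?_⟩
  rw [sat_exS]
  refine ⟨Y, ?_⟩
  have hX' : (isOmega 1).Sat v (scons Y (scons X s)) := (sat_isOmega _ _ _).2 hX
  rw [sat_and, sat_and]
  refine ⟨hX', (sat_isOmegaPow _ _ (isOmega_of_sat _ _ hX')).2 hY, ?_⟩
  exact sat_isWeakWellOrder _ _ _ (hY.sat_isLinearOrder _ _ _ rfl) fun I J F h => h.false hY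

end Ordered

theorem proves_weakWellOrder : Proves RCA₀ (omegaOmegaSatisfies isWeakWellOrder) := by
  refine completeness fun N S _ _ _ _ _ _ hT v s => ?_
  have : Nonempty S := ⟨s 0⟩
  exact IsModel.elim (N := N) (S := S) hT
    (C := fun _ _ _ _ _ => (omegaOmegaSatisfies isWeakWellOrder).Sat v s)
    (sat_weakWellOrder N S v s)

section Ordered

variable {N S : Type} [CommSemiring N] [LinearOrder N] [IsStrictOrderedRing N]
  [CanonicallyOrderedAdd N] [SuccAddOrder N] [Membership N S] [Nonempty S] [H : RCAModel N S]

/-! ### Descending sequences in `ω(ω)` -/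

/-- `c` is the code of the `i`-th sequence described by `Λ` and `E`. -/
def Describes (Λ E : S) (i c : N) : Prop := IsSeq c ∧ ∃ l, l ≤ c ∧ (Len c l ∧ pr i l ∈ Λ ∧
  ∀ j, j < l → ∀ x, x ≤ c → Ent c j x → pr (pr i j) x ∈ E)

instance D0.describes (Λ E : S) (i j : ℕ) : D0 S fun v : ℕ → N => Describes Λ E (v i) (v j) := by
  unfold Describes
  infer_instance

include H in
/-- If the model has sets that describe a descending sequence of non-increasing sequences with
lengths `len i` and entries `e i j`, then `ω(ω)` is not a well order in this model. -/
theorem not_sat_wellOrder {len : N → N} {e : N → N → N} {Λ E : S}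
    (hΛ : ∀ i l, pr i l ∈ Λ ↔ l = len i) (hE : ∀ i j x, pr (pr i j) x ∈ E ↔ x = e i j)
    (hmono : ∀ i j, j + 1 < len i → e i (j + 1) ≤ e i j)
    (hdesc : ∀ i, (len (i + 1) < len i ∧ ∀ j < len (i + 1), e i j = e (i + 1) j) ∨
      ∃ j, j < len i ∧ j < len (i + 1) ∧ e (i + 1) j < e i j ∧ ∀ k < j, e i k = e (i + 1) k)
    (v : ℕ → N) (s : ℕ → S) : ¬ (omegaOmegaSatisfies isWellOrder).Sat v s := by
  intro h
  unfold omegaOmegaSatisfies at h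
  rw [sat_exS] at h
  obtain ⟨X, h⟩ := h
  rw [sat_exS] at h
  obtain ⟨Y, h⟩ := h
  rw [sat_and, sat_and] at h
  obtain ⟨hX, hY, hwo⟩ := h
  rw [sat_isOmegaPow _ _ (isOmega_of_sat _ _ hX)] at hY
  change IsOmegaPow (N := N) Y at hY
  have hC {i c : N} (hc : Describes Λ E i c) : InPow c ∧ Len c (len i) ∧
      ∀ j < len i, entry c j = e i j + 1 := by
    obtain ⟨hc, l, -, hl, hil, hj⟩ := hc
    obtain rfl := (hΛ i l).1 hil
    have hce : ∀ j < len i, entry c j = e i j + 1 := fun j hji => by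
      obtain ⟨x, hx⟩ := hl.exists_ent S hji
      rw [hx.ent_eq, (hE i j x).1 (hj j hji x hx.le_right hx)]
    refine ⟨(inPow_iff S).2 ⟨hc, fun j => ?_⟩, hl, hce⟩
    rcases lt_or_ge (j + 1) (len i) with hji | hji
    · rw [hce _ hji, hce _ ((lt_add_one' j).trans hji)]
      exact add_le_add_left (hmono i j hji) 1
    · rw [hl.ent_eq_zero hji]
      exact zero_le
  -- The graph of the descending sequence of codes. `Describes` is bounded because a code bounds its
  -- length and entries; it determines the code because codes are least representatives.
  obtain ⟨F, hF⟩ := d0_comprehension S (P := fun z : N => ∃ i, i ≤ z ∧ ∃ c, c ≤ z ∧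
    (z = pr i c ∧ Describes Λ E i c)) inferInstance
  have hF' (i c : N) : pr i c ∈ F ↔ Describes Λ E i c := by
    rw [hF]
    constructor
    · rintro ⟨i', -, c', -, h, hC⟩
      obtain ⟨rfl, rfl⟩ := pr_inj.1 h
      exact hC
    · exact fun h => ⟨i, le_pr_left _ _, c, le_pr_right _ _, rfl, h⟩
  have h₁ : ∀ z, z ∈ F → ∃ i c : N, z = pr i c ∧ pr c c ∈ Y := fun z hz => by
    obtain ⟨i, -, c, -, h, hc⟩ := (hF z).1 hz
    exact ⟨i, c, h, hY.field_iff.2 (hC hc).1⟩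
  have h₂ : ∀ i : N, ∃ c, pr i c ∈ F := fun i => by
    obtain ⟨c, hc, hl, h⟩ := exists_seq S (R := fun j x => pr (pr i j) x ∈ E) inferInstance (len i)
      fun j _ => ⟨e i j, (hE _ _ _).2 rfl⟩
    refine ⟨c, (hF' i c).2 ⟨hc, len i, hl.le, hl, (hΛ _ _).2 rfl, fun j hj x _ hx => ?_⟩⟩
    obtain ⟨y, hy, hy'⟩ := h j hj
    rwa [hx.unique hy]
  have h₃ : ∀ i c d : N, pr i c ∈ F → pr i d ∈ F → c = d := fun i c d hc hd => by
    rw [hF'] at hc hd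
    obtain ⟨hcP, hcl, hce⟩ := hC hc
    obtain ⟨hdP, hdl, hde⟩ := hC hd
    refine hcP.1.eq_of_ent S hdP.1 fun j => ?_
    rcases lt_or_ge j (len i) with hj | hj
    · rw [hce j hj, hde j hj]
    · rw [hcl.ent_eq_zero hj, hdl.ent_eq_zero hj]
  obtain ⟨i, c, d, hc, hd, hcd⟩ := isWellOrder_of_sat _ _ _ hwo F h₁ h₂ h₃
  rw [hF'] at hc hd
  obtain ⟨hcP, hcl, hce⟩ := hC hc
  obtain ⟨hdP, hdl, hde⟩ := hC hd
  refine hcd (hY.strict_iff.2 ⟨hdP, hcP, ?_⟩)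
  rcases hdesc i with ⟨hlt, h⟩ | ⟨j, hj, hj', hlt, h⟩
  · refine ⟨len (i + 1), ?_, fun j hj => ?_⟩
    · rw [hdl.ent_eq_zero le_rfl]
      exact hcl.ent_pos S hlt
    · rw [hde j hj, hce j (hj.trans hlt), h j hj]
  · refine ⟨j, ?_, fun k hk => ?_⟩
    · rw [hde j hj', hce j hj]
      exact add_lt_add_left hlt 1
    · rw [hde k (hk.trans hj'), hce k (hk.trans hj), h k hk]

end Ordered

/-! ### Long descending sequences -/

/-- Replace the last entry `e + 1` of a sequence by `x + 1` entries `e`, or drop a last entry `0`.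
Sequences are given in reverse order. -/
def descend (x : ℕ) : List ℕ → List ℕ
  | [] => []
  | 0 :: τ => τ
  | (e + 1) :: τ => List.replicate (x + 1) e ++ τ

/-- Iterate `descend`, with increasing values of `x`. -/
def descent (x : ℕ) (σ : List ℕ) : ℕ → List ℕ
  | 0 => σ
  | i + 1 => descend (x + i) (descent x σ i)

theorem descent_add (x : ℕ) (σ : List ℕ) (i j : ℕ) :
    descent x σ (i + j) = descent (x + i) (descent x σ i) j := by
  induction j with
  | zero => rfl
  | succ j ih => rw [← add_assoc, descent, ih, descent, add_assoc]

/-- Removing an entry `e + 1` at counter `x` means removing `x + 1` entries `e` in turn, and each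
removal applies at least `ack e` to the counter. This is the recursion `ack (e + 1) x = (ack e)^[x +
1] 1`. -/
theorem exists_descent_eq (e : ℕ) : ∀ (τ : List ℕ) (x : ℕ), ∃ n, descent x (e :: τ) n = τ ∧
    ack e x ≤ x + n ∧ ∀ i < n, τ.length < (descent x (e :: τ) i).length := by
  induction e with
  | zero =>
    intro τ x
    refine ⟨1, rfl, by simp, fun i hi => ?_⟩
    obtain rfl : i = 0 := by omega
    simp [descent]
  | succ e ih =>
    have key (m : ℕ) : ∀ (τ : List ℕ) (x : ℕ), ∃ n, descent x (List.replicate m e ++ τ) n = τ ∧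
        (ack e)^[m] x ≤ x + n ∧
        ∀ i < n, τ.length < (descent x (List.replicate m e ++ τ) i).length := by
      induction m with
      | zero => exact fun τ x => ⟨0, rfl, le_rfl, by simp⟩
      | succ m ihm =>
        intro τ x
        obtain ⟨n, hn, hle, hlt⟩ := ih (List.replicate m e ++ τ) x
        obtain ⟨n', hn', hle', hlt'⟩ := ihm τ (x + n)
        rw [List.replicate_succ, List.cons_append]
        refine ⟨n + n', by rw [descent_add, hn, hn'], ?_, fun i hi => ?_⟩
        · rw [Function.iterate_succ_apply, ← add_assoc]
          refine le_trans ?_ hle'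
          exact ((ack_mono_right e).iterate m) hle
        · rcases lt_or_ge i n with h | h
          · refine lt_of_le_of_lt ?_ (hlt i h)
            simp
          · obtain ⟨j, rfl⟩ := Nat.exists_eq_add_of_le h
            rw [descent_add, hn]
            exact hlt' j (by omega)
    intro τ x
    obtain ⟨n, hn, hle, hlt⟩ := key (x + 1) τ (x + 1)
    have h1 (i : ℕ) : descent x ((e + 1) :: τ) (1 + i) =
        descent (x + 1) (List.replicate (x + 1) e ++ τ) i := descent_add _ _ 1 i
    refine ⟨1 + n, by rw [h1, hn], ?_, fun i hi => ?_⟩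
    · rw [← add_assoc]
      refine le_trans ?_ hle
      have (m : ℕ) : ack (e + 1) m = (ack e)^[m + 1] 1 := by
        induction m with
        | zero => simp
        | succ m ih => rw [ack_succ_succ, ih, ← Function.iterate_succ_apply' (ack e)]
      rw [this]
      exact ((ack_mono_right e).iterate _) (by omega)
    · rcases i with _ | i
      · simp [descent]
      · rw [add_comm i 1, h1]
        exact hlt i (by omega)

theorem descent_sorted (x : ℕ) {σ : List ℕ} (h : σ.Pairwise (· ≤ ·)) (i : ℕ) :
    (descent x σ i).Pairwise (· ≤ ·) := by
  induction i with
  | zero => exact h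
  | succ i ih =>
    rw [descent]
    generalize descent x σ i = τ at ih
    rcases τ with _ | ⟨_ | e, τ⟩
    · exact ih
    · exact (List.pairwise_cons.1 ih).2
    · obtain ⟨h₁, h₂⟩ := List.pairwise_cons.1 ih
      refine List.pairwise_append.2 ⟨List.pairwise_replicate.2 (.inr le_rfl), h₂, fun a ha b hb => ?_⟩
      rw [List.eq_of_mem_replicate ha]
      exact (Nat.le_succ e).trans (h₁ b hb)

theorem descent_length_le (x : ℕ) (σ : List ℕ) (i : ℕ) :
    (descent x σ i).length ≤ σ.length + i * (x + i) := by
  induction i with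
  | zero => simp [descent]
  | succ i ih =>
    have : (descent x σ (i + 1)).length ≤ (descent x σ i).length + (x + i) := by
      rw [descent]
      rcases descent x σ i with _ | ⟨_ | e, τ⟩ <;> simp [descend]
      · omega
      · omega
    refine this.trans ?_
    nlinarith

theorem descent_le {x b : ℕ} {σ : List ℕ} (h : ∀ y ∈ σ, y ≤ b) (i : ℕ) :
    ∀ y ∈ descent x σ i, y ≤ b := by
  induction i with
  | zero => exact h
  | succ i ih =>
    intro y hy
    rw [descent] at hy
    generalize descent x σ i = τ at ih hy
    rcases τ with _ | ⟨_ | e, τ⟩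
    · exact ih y hy
    · exact ih y (List.mem_cons_of_mem _ hy)
    · rcases List.mem_append.1 hy with hy | hy
      · rw [List.eq_of_mem_replicate hy]
        exact (Nat.le_succ e).trans (ih _ (List.mem_cons_self ..))
      · exact ih y (List.mem_cons_of_mem _ hy)

/-- The `j`-th entry of a sequence given in reverse order. -/
def revEntry (σ : List ℕ) (j : ℕ) : ℕ := σ.reverse.getD j 0

theorem revEntry_append (σ τ : List ℕ) {j : ℕ} (hj : j < τ.length) :
    revEntry (σ ++ τ) j = revEntry τ j := by
  unfold revEntry
  rw [List.reverse_append, List.getD_append _ _ _ _ (by simpa using hj)]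

theorem revEntry_cons (e : ℕ) (τ : List ℕ) : revEntry (e :: τ) τ.length = e := by
  simp [revEntry, List.getD_eq_getElem?_getD]

theorem revEntry_le {b : ℕ} {σ : List ℕ} (h : ∀ y ∈ σ, y ≤ b) (j : ℕ) : revEntry σ j ≤ b := by
  unfold revEntry
  rcases lt_or_ge j σ.reverse.length with hj | hj
  · rw [List.getD_eq_getElem _ _ hj]
    exact h _ (List.mem_reverse.1 (List.getElem_mem hj))
  · rw [List.getD_eq_default _ _ hj]
    exact zero_le

theorem revEntry_anti {σ : List ℕ} (h : σ.Pairwise (· ≤ ·)) {j : ℕ} (hj : j + 1 < σ.length) :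
    revEntry σ (j + 1) ≤ revEntry σ j := by
  have h' := List.pairwise_reverse.2 h
  unfold revEntry
  have h₁ : j + 1 < σ.reverse.length := by simpa using hj
  rw [List.getD_eq_getElem _ _ h₁, List.getD_eq_getElem _ _ (by omega)]
  exact List.pairwise_iff_getElem.1 h' j (j + 1) _ _ (Nat.lt_succ_self j)

theorem descend_lt (x : ℕ) {σ : List ℕ} (h : σ ≠ []) :
    ((descend x σ).length < σ.length ∧
      ∀ j < (descend x σ).length, revEntry σ j = revEntry (descend x σ) j) ∨
    ∃ j, j < σ.length ∧ j < (descend x σ).length ∧ revEntry (descend x σ) j < revEntry σ j ∧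
      ∀ i < j, revEntry σ i = revEntry (descend x σ) i := by
  rcases σ with _ | ⟨_ | e, τ⟩
  · exact (h rfl).elim
  · exact .inl ⟨by simp [descend], fun j hj => revEntry_append [0] τ hj⟩
  -- Of the `x + 1` new entries, the one next to `τ` takes the place of `e + 1`; that is the first
  -- difference.
  · have h₁ : descend x ((e + 1) :: τ) = List.replicate x e ++ (e :: τ) := by
      rw [descend, List.replicate_succ', List.append_assoc, List.singleton_append]
    refine .inr ⟨τ.length, by simp, by simp [h₁]; omega, ?_, fun i hi => ?_⟩
    · rw [h₁, revEntry_append _ _ (by simp), revEntry_cons, revEntry_cons]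
      exact Nat.lt_succ_self e
    · rw [h₁, revEntry_append _ _ (by simp; omega)]
      exact (revEntry_append [e + 1] τ hi).trans (revEntry_append [e] τ hi).symm

/-! ### A cut in the natural numbers -/

/-- The points `ack (r + 1) (a + j)` bound `a + 2` consecutive intervals, while `G` has only `a + 1`
values on arguments up to `a`; so some open interval is missed. Its ends satisfy `b' = ack r a'`, at
the cost of three levels of `ack`. -/
theorem exists_split {r : ℕ} (hr : 1 ≤ r) {a b : ℕ} (hab : ack (r + 3) a ≤ b) (G : ℕ → ℕ) :
    ∃ a' b', ack (r + 1) a ≤ a' ∧ ack r a' ≤ b' ∧ b' ≤ b ∧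
      ∀ p ≤ a, ¬ (a' < G p ∧ G p < b') := by
  have hstep (j : ℕ) : ack r (ack (r + 1) (a + j)) = ack (r + 1) (a + j + 1) :=
    (ack_succ_succ _ _).symm
  have : ∃ j < a + 2, ∀ p ≤ a,
      ¬ (ack (r + 1) (a + j) < G p ∧ G p < ack (r + 1) (a + j + 1)) := by
    by_contra! h
    choose! p hp hp₁ hp₂ using h
    obtain ⟨i, hi, j, hj, hij, he⟩ := Finset.exists_ne_map_eq_of_card_lt_of_maps_to
      (s := Finset.range (a + 2)) (t := Finset.range (a + 1)) (by simp)
      (f := p) (fun i hi => by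
        have := hp i (by simpa using hi)
        simp only [Finset.coe_range, Set.mem_Iio]
        omega)
    have key : ∀ i j, i < a + 2 → j < a + 2 → p i = p j → ¬ i < j := by
      intro i j hi hj he hij
      have h₁ := hp₂ i hi
      have h₂ := hp₁ j hj
      rw [he] at h₁
      have h₃ : ack (r + 1) (a + i + 1) ≤ ack (r + 1) (a + j) := ack_mono_right _ (by omega)
      omega
    simp only [Finset.mem_range] at hi hj
    rcases lt_or_gt_of_ne hij with h | h
    · exact key i j hi hj he h
    · exact key j i hj hi he.symm h
  obtain ⟨j, hj, h⟩ := this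
  refine ⟨ack (r + 1) (a + j), ack (r + 1) (a + j + 1), ack_mono_right _ (by omega),
    (hstep j).le, ?_, h⟩
  -- As `j < a + 2`, the argument is at most `ack 2 a = 2 * a + 3`; the composition costs two
  -- levels.
  calc ack (r + 1) (a + j + 1) ≤ ack (r + 1) (ack 2 a) := ack_mono_right _ (by simp; omega)
    _ ≤ ack (max (r + 1) 2 + 2) a := (ack_ack_lt_ack_max_add_two _ _ _).le
    _ = ack (r + 3) a := by rw [max_eq_left (by omega)]
    _ ≤ b := hab

-- Split the interval from `k` to `B k` repeatedly, with the invariant `ack (k - 3 * n) (a n k) ≤ b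
-- n k` for `k ≥ 3 * n + 1`. For fixed `n` and `m` the remaining level eventually exceeds `m`, so `a
-- (n + 1)` dominates `ack m` applied to `a n`.
open Filter in
theorem exists_cut {B : ℕ → ℕ} (hB : ∀ k, ack k k ≤ B k) (G : ℕ → ℕ → ℕ → ℕ) :
    ∃ a b : ℕ → ℕ → ℕ, (∀ k, a 0 k = k) ∧ (∀ k, b 0 k = B k) ∧
      ∀ n, (∀ m, ∀ᶠ k in atTop, ack m (a n k) ≤ a (n + 1) k) ∧
        (∀ᶠ k in atTop, b (n + 1) k ≤ b n k) ∧ (∀ᶠ k in atTop, a n k < b n k) ∧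
        ∀ᶠ k in atTop, ∀ p ≤ a n k, ¬ (a (n + 1) k < G n k p ∧ G n k p < b (n + 1) k) := by
  have hsplit (r : ℕ) (ab : ℕ × ℕ) (G : ℕ → ℕ) : ∃ ab' : ℕ × ℕ, 1 ≤ r → ack (r + 3) ab.1 ≤ ab.2 →
      ack (r + 1) ab.1 ≤ ab'.1 ∧ ack r ab'.1 ≤ ab'.2 ∧ ab'.2 ≤ ab.2 ∧
      ∀ p ≤ ab.1, ¬ (ab'.1 < G p ∧ G p < ab'.2) := by
    by_cases h : 1 ≤ r ∧ ack (r + 3) ab.1 ≤ ab.2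
    · obtain ⟨a', b', h'⟩ := exists_split h.1 h.2 G
      exact ⟨(a', b'), fun _ _ => h'⟩
    · exact ⟨ab, fun h₁ h₂ => (h ⟨h₁, h₂⟩).elim⟩
  choose next hnext using hsplit
  let c : ℕ → ℕ → ℕ × ℕ := fun n k =>
    Nat.rec (k, B k) (fun n ab => next (k - 3 * (n + 1)) ab (G n k)) n
  have hc (n k : ℕ) : c (n + 1) k = next (k - 3 * (n + 1)) (c n k) (G n k) := rfl
  have hinv (n : ℕ) : ∀ k, 3 * n + 1 ≤ k → ack (k - 3 * n) (c n k).1 ≤ (c n k).2 := by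
    induction n with
    | zero => exact fun k _ => hB k
    | succ n ih =>
      intro k hk
      have := ih k (by omega)
      rw [show k - 3 * n = k - 3 * (n + 1) + 3 by omega] at this
      exact (hnext _ _ (G n k) (by omega) this).2.1
  have hstep (n k : ℕ) (hk : 3 * (n + 1) + 1 ≤ k) := hnext (k - 3 * (n + 1)) (c n k) (G n k)
    (by omega) (by
      have := hinv n k (by omega)
      rwa [show k - 3 * n = k - 3 * (n + 1) + 3 by omega] at this)
  refine ⟨fun n k => (c n k).1, fun n k => (c n k).2, fun _ => rfl, fun _ => rfl, fun n =>
    ⟨fun m => ?_, ?_, ?_, ?_⟩⟩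
  · filter_upwards [eventually_ge_atTop (3 * (n + 1) + 1 + m)] with k hk
    exact (ack_mono_left _ (by omega)).trans (hstep n k (by omega)).1
  · filter_upwards [eventually_ge_atTop (3 * (n + 1) + 1)] with k hk
    exact (hstep n k hk).2.2.1
  · filter_upwards [eventually_ge_atTop (3 * n + 1)] with k hk
    exact (lt_ack_right _ _).trans_le (hinv n k hk)
  · filter_upwards [eventually_ge_atTop (3 * (n + 1) + 1)] with k hk
    exact (hstep n k hk).2.2.2

open Filter

/-! ### Codes of sets -/

/-- The `i`-th entry of the infinite sequence coded by a number. -/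
def dec : ℕ → ℕ → ℕ
  | p, 0 => p.unpair.1
  | p, i + 1 => dec p.unpair.2 i

@[simp] theorem dec_pair_zero (x p : ℕ) : dec (Nat.pair x p) 0 = x := by simp [dec]

@[simp] theorem dec_pair_succ (x p i : ℕ) : dec (Nat.pair x p) (i + 1) = dec p i := by simp [dec]

/-- The number of set parameters. -/
def arity : Bool ⊕ (Fm × Fm × ℕ) → ℕ
  | .inl _ => 0
  | .inr c => c.2.2

/-- Codes of sets that are built from two basic sets. -/
abbrev Code : Type := WType fun c => Fin (arity c)

/-- Number parameters are kept out of the codes. Countability lets a single sequence of intervals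
meet all gap conditions. -/
instance : Countable Code := by
  have := Encodable.ofCountable Fm
  infer_instance

/-- The set given by a code, where the bounded formulas in the code are evaluated with the
parameters that are coded by the last argument. -/
def Code.eval (D : Bool → Set ℕ) (B : ℕ) : Code → ℕ → Set ℕ
  | ⟨.inl t, _⟩, _ => D t
  | ⟨.inr (θ, χ, n), f⟩, p =>
    let s : ℕ → Set ℕ := fun j =>
      if h : j < n then Code.eval D B (f ⟨j, h⟩) (dec p (j + 1)) else ∅
    {z | ∃ y < B, θ.Sat (scons y (scons z (dec (dec p 0)))) s ∧
      ∀ y' ≤ y, χ.Sat (scons y' (scons z (dec (dec p 0)))) s}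

/-- The sets given by a finite sequence of codes, with the parameters that are coded by the last
argument. -/
def codeEnv (D : Bool → Set ℕ) (B : ℕ) {n : ℕ} (f : Fin n → Code) (p j : ℕ) : Set ℕ :=
  if h : j < n then (f ⟨j, h⟩).eval D B (dec p (j + 1)) else ∅

/-- The least witness of a formula. -/
noncomputable def leastWitness (D : Bool → Set ℕ) (B : ℕ) (θ : Fm) {n : ℕ} (f : Fin n → Code)
    (p : ℕ) : ℕ :=
  sInf {y | θ.Sat (scons y (dec (dec p 0))) (codeEnv D B f p)}

/-! ### Cuts in an ultrapower of the natural numbers -/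

/-- Sequences `a n` and `b n` in an ultrapower that approach a cut from below and above. The cut
is closed under all primitive recursive functions, and it is regular with respect to sets with
codes. -/
structure Cut where
  U : Ultrafilter ℕ
  D : ℕ → Bool → Set ℕ
  a : ℕ → ℕ → ℕ
  b : ℕ → ℕ → ℕ
  ack_le : ∀ n m, ∀ᶠ k in U, ack m (a n k) ≤ a (n + 1) k
  b_anti : ∀ n, ∀ᶠ k in U, b (n + 1) k ≤ b n k
  lt : ∀ n, ∀ᶠ k in U, a n k < b n k
  gap : ∀ (θ : Fm) {n : ℕ} (f : Fin n → Code) (m : ℕ), ∃ l ≥ m, ∀ᶠ k in U, ∀ p ≤ a l k,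
    ¬ (a (l + 1) k < leastWitness (D k) (b 0 k) θ f p ∧
      leastWitness (D k) (b 0 k) θ f p < b (l + 1) k)

theorem Cut.exists (D : ℕ → Bool → Set ℕ) {B : ℕ → ℕ} (hB : ∀ k, ack k k ≤ B k) :
    ∃ C : Cut, C.D = D ∧ (∀ k, C.a 0 k = k) ∧ ∀ k, C.b 0 k = B k := by
  have : Nonempty (Fm × (Σ n, Fin n → Code)) := ⟨.falsum, 0, Fin.elim0⟩
  obtain ⟨r, hr⟩ := exists_surjective_nat (Fm × (Σ n, Fin n → Code))
  obtain ⟨a, b, ha, hb, h⟩ := exists_cut hB fun n k =>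
    leastWitness (D k) (B k) (r n.unpair.1).1 (r n.unpair.1).2.2
  have hU : (hyperfilter ℕ : Filter ℕ) ≤ atTop := Nat.cofinite_eq_atTop ▸ hyperfilter_le_cofinite
  refine ⟨⟨hyperfilter ℕ, D, a, b, fun n m => hU ((h n).1 m), fun n => hU (h n).2.1,
    fun n => hU (h n).2.2.1, fun θ n f m => ?_⟩, rfl, ha, hb⟩
  obtain ⟨i, hi⟩ := hr (θ, ⟨n, f⟩)
  -- Requirement `i` is treated at every stage `Nat.pair i m`, hence arbitrarily late, once the
  -- relevant parameters lie below `a`.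
  refine ⟨Nat.pair i m, Nat.right_le_pair i m, ?_⟩
  filter_upwards [hU (h (Nat.pair i m)).2.2.2] with k hk p hp
  have e : r (Nat.pair i m).unpair.1 = (θ, ⟨n, f⟩) := by rw [Nat.unpair_pair, hi]
  have := hk p hp
  rw [e] at this
  rwa [hb]

namespace Cut

variable (C : Cut)

/-- The sequence represents an element of the cut. -/
def Bdd (f : ℕ → ℕ) : Prop := ∃ n, ∀ᶠ k in C.U, f k ≤ C.a n k

variable {C}

theorem Bdd.mono {f g : ℕ → ℕ} (hg : C.Bdd g) (h : ∀ᶠ k in C.U, f k ≤ g k) : C.Bdd f := by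
  obtain ⟨n, hn⟩ := hg
  exact ⟨n, (h.and hn).mono fun k hk => hk.1.trans hk.2⟩

theorem eventually_a_le {n m : ℕ} (h : n ≤ m) : ∀ᶠ k in C.U, C.a n k ≤ C.a m k := by
  induction m, h using Nat.le_induction with
  | base => exact .of_forall fun _ => le_rfl
  | succ m _ ih =>
    filter_upwards [ih, C.ack_le m 0] with k h₁ h₂
    exact h₁.trans ((lt_ack_right 0 _).le.trans h₂)

theorem eventually_b_le {n m : ℕ} (h : n ≤ m) : ∀ᶠ k in C.U, C.b m k ≤ C.b n k := by
  induction m, h using Nat.le_induction with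
  | base => exact .of_forall fun _ => le_rfl
  | succ m _ ih => filter_upwards [ih, C.b_anti m] with k h₁ h₂ using h₂.trans h₁

theorem Bdd.exists_ge {f : ℕ → ℕ} (hf : C.Bdd f) (m : ℕ) :
    ∃ n ≥ m, ∀ᶠ k in C.U, f k ≤ C.a n k := by
  obtain ⟨n, hn⟩ := hf
  refine ⟨max n m, le_max_right _ _, ?_⟩
  filter_upwards [hn, eventually_a_le (le_max_left n m)] with k h₁ h₂ using h₁.trans h₂

theorem Bdd.lt_b {f : ℕ → ℕ} (hf : C.Bdd f) (m : ℕ) : ∀ᶠ k in C.U, f k < C.b m k := by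
  obtain ⟨n, hm, hn⟩ := hf.exists_ge m
  filter_upwards [hn, C.lt n, eventually_b_le hm] with k h₁ h₂ h₃ using (h₁.trans_lt h₂).trans_le h₃

theorem bdd_a (n : ℕ) : C.Bdd (C.a n) := ⟨n, .of_forall fun _ => le_rfl⟩

theorem Bdd.max {f g : ℕ → ℕ} (hf : C.Bdd f) (hg : C.Bdd g) : C.Bdd fun k => max (f k) (g k) := by
  obtain ⟨n, hn⟩ := hf
  obtain ⟨m, hm, h⟩ := hg.exists_ge n
  refine ⟨m, ?_⟩
  filter_upwards [hn, h, eventually_a_le hm] with k h₁ h₂ h₃ using max_le (h₁.trans h₃) h₂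

/-- `(x + 2) ^ 2 ≤ ack 3 x`, so one step from `a n` to `a (n + 1)` absorbs a square. -/
theorem Bdd.sq {f : ℕ → ℕ} (hf : C.Bdd f) : C.Bdd fun k => (f k + 2) ^ 2 := by
  obtain ⟨n, hn⟩ := hf
  refine ⟨n + 1, ?_⟩
  filter_upwards [hn, C.ack_le n 3] with k h₁ h₂
  have := ack_add_one_sq_lt_ack_add_three 0 (C.a n k)
  simp only [ack_zero, zero_add] at this
  exact ((Nat.pow_le_pow_left (by omega) 2).trans this).trans h₂

theorem Bdd.add {f g : ℕ → ℕ} (hf : C.Bdd f) (hg : C.Bdd g) : C.Bdd fun k => f k + g k :=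
  (hf.max hg).sq.mono (.of_forall fun k => by
    nlinarith [le_max_left (f k) (g k), le_max_right (f k) (g k)])

theorem Bdd.mul {f g : ℕ → ℕ} (hf : C.Bdd f) (hg : C.Bdd g) : C.Bdd fun k => f k * g k :=
  (hf.max hg).sq.mono (.of_forall fun k => by
    refine (Nat.mul_le_mul (le_max_left (f k) (g k)) (le_max_right (f k) (g k))).trans ?_
    rw [← pow_two]
    exact Nat.pow_le_pow_left (Nat.le_add_right _ 2) 2)

theorem Bdd.pair {f g : ℕ → ℕ} (hf : C.Bdd f) (hg : C.Bdd g) :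
    C.Bdd fun k => Nat.pair (f k) (g k) :=
  (hf.max hg).sq.mono (.of_forall fun k =>
    (Nat.pair_lt_max_add_one_sq _ _).le.trans (Nat.pow_le_pow_left (by omega) 2))

theorem bdd_const (n : ℕ) : C.Bdd fun _ => n := by
  induction n with
  | zero => exact ⟨0, .of_forall fun _ => Nat.zero_le _⟩
  | succ n ih => exact ih.sq.mono (.of_forall fun k => by nlinarith)

theorem exists_enc (n : ℕ) : ∀ {v : ℕ → ℕ → ℕ}, (∀ i, C.Bdd (v i)) →
    ∃ p, C.Bdd p ∧ ∀ k, ∀ i < n, dec (p k) i = v i k := by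
  induction n with
  | zero => exact fun _ => ⟨_, bdd_const 0, fun k i hi => (Nat.not_lt_zero i hi).elim⟩
  | succ n ih =>
    intro v hv
    obtain ⟨p, hp, h⟩ := ih fun i => hv (i + 1)
    refine ⟨_, (hv 0).pair hp, fun k i hi => ?_⟩
    rcases i with _ | i
    · simp
    · simpa using h k i (by omega)

/-! ### The structure given by a cut -/

variable (C)

/-- The elements of the cut. -/
def Num : Type := {g : Germ (C.U : Filter ℕ) ℕ // ∃ f, C.Bdd f ∧ (f : Germ (C.U : Filter ℕ) ℕ) = g}

variable {C}

/-- The element of the cut that is represented by a sequence. -/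
def ofSeq (f : ℕ → ℕ) (hf : C.Bdd f) : C.Num := ⟨f, f, hf, rfl⟩

/-- A representing sequence for an element of the cut. -/
noncomputable def rep (x : C.Num) : ℕ → ℕ := x.2.choose

theorem bdd_rep (x : C.Num) : C.Bdd (rep x) := x.2.choose_spec.1

theorem rep_ofSeq (f : ℕ → ℕ) (hf : C.Bdd f) : ∀ᶠ k in C.U, rep (ofSeq f hf) k = f k :=
  Germ.coe_eq.1 (ofSeq f hf).2.choose_spec.2

theorem eq_iff {x y : C.Num} : x = y ↔ ∀ᶠ k in C.U, rep x k = rep y k := by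
  have h : x = y ↔ x.1 = y.1 := Subtype.ext_iff
  rw [h, ← x.2.choose_spec.2, ← y.2.choose_spec.2]
  exact Germ.coe_eq

noncomputable instance : Zero C.Num := ⟨ofSeq _ (bdd_const 0)⟩
noncomputable instance : One C.Num := ⟨ofSeq _ (bdd_const 1)⟩
noncomputable instance : Add C.Num := ⟨fun x y => ofSeq _ ((bdd_rep x).add (bdd_rep y))⟩
noncomputable instance : Mul C.Num := ⟨fun x y => ofSeq _ ((bdd_rep x).mul (bdd_rep y))⟩
instance : LT C.Num := ⟨fun x y => ∀ᶠ k in C.U, rep x k < rep y k⟩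

theorem rep_zero : ∀ᶠ k in C.U, rep (0 : C.Num) k = 0 := rep_ofSeq _ _
theorem rep_one : ∀ᶠ k in C.U, rep (1 : C.Num) k = 1 := rep_ofSeq _ _
theorem rep_add (x y : C.Num) : ∀ᶠ k in C.U, rep (x + y) k = rep x k + rep y k := rep_ofSeq _ _
theorem rep_mul (x y : C.Num) : ∀ᶠ k in C.U, rep (x * y) k = rep x k * rep y k := rep_ofSeq _ _
theorem lt_iff {x y : C.Num} : x < y ↔ ∀ᶠ k in C.U, rep x k < rep y k := Iff.rfl

variable (C)

/-- The sets of the structure, given by a code and a parameter. -/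
def Sets : Type := Code × C.Num

variable {C}

instance : Nonempty C.Sets := ⟨WType.mk (.inl true) Fin.elim0, 0⟩

/-- The components of a set in the ultrapower. -/
noncomputable def Sets.comp (X : C.Sets) (k : ℕ) : Set ℕ :=
  X.1.eval (C.D k) (C.b 0 k) (rep X.2 k)

instance : Membership C.Num C.Sets := ⟨fun X x => ∀ᶠ k in C.U, rep x k ∈ X.comp k⟩

theorem mem_iff {x : C.Num} {X : C.Sets} : x ∈ X ↔ ∀ᶠ k in C.U, rep x k ∈ X.comp k := Iff.rfl

theorem rep_val (t : Tm) (v : ℕ → C.Num) :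
    ∀ᶠ k in C.U, rep (t.val v) k = t.val fun i => rep (v i) k := by
  induction t with
  | var i => exact .of_forall fun _ => rfl
  | zero => exact rep_zero
  | one => exact rep_one
  | add s t hs ht =>
    filter_upwards [hs, ht, rep_add (s.val v) (t.val v)] with k h₁ h₂ h₃
    rw [Tm.val, h₃, h₁, h₂, Tm.val]
  | mul s t hs ht =>
    filter_upwards [hs, ht, rep_mul (s.val v) (t.val v)] with k h₁ h₂ h₃
    rw [Tm.val, h₃, h₁, h₂, Tm.val]

theorem rep_scons (x : C.Num) (v : ℕ → C.Num) (k : ℕ) :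
    (fun i => rep (scons x v i) k) = scons (rep x k) fun i => rep (v i) k := by
  funext i; cases i <;> rfl

/-- The theorem of Łoś for bounded formulas. -/
theorem sat_iff_of_isBounded {θ : Fm} (hθ : IsBounded θ) : ∀ (v : ℕ → C.Num) (s : ℕ → C.Sets),
    θ.Sat v s ↔ ∀ᶠ k in C.U, θ.Sat (fun i => rep (v i) k) fun i => (s i).comp k := by
  induction hθ with
  | falsum => intro v s; simp [Filter.NeBot.ne]
  | eq t u =>
    intro v s
    rw [sat_eq, eq_iff]
    refine eventually_congr ?_
    filter_upwards [rep_val t v, rep_val u v] with k h₁ h₂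
    rw [h₁, h₂, sat_eq]
  | lt t u =>
    intro v s
    rw [sat_lt, lt_iff]
    refine eventually_congr ?_
    filter_upwards [rep_val t v, rep_val u v] with k h₁ h₂
    rw [h₁, h₂, sat_lt]
  | mem t X =>
    intro v s
    rw [sat_mem, mem_iff]
    refine eventually_congr ?_
    filter_upwards [rep_val t v] with k h₁
    rw [h₁, sat_mem]
  | imp _ _ h₁ h₂ =>
    intro v s
    simp only [sat_imp, h₁, h₂]
    exact Ultrafilter.eventually_imp.symm
  | @ballN t φ _ ih =>
    intro v s
    simp only [sat_ballN, ih, rep_scons]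
    constructor
    · intro h
      by_contra hn
      have hn := Ultrafilter.eventually_not.2 hn
      push Not at hn
      -- Counterexamples chosen in each component lie below the bound, so they represent an element
      -- of the cut.
      let x : ℕ → ℕ := fun k => sInf {x | x < t.val (fun i => rep (v i) k) ∧
        ¬ φ.Sat (scons x fun i => rep (v i) k) fun i => (s i).comp k}
      have hx : ∀ᶠ k in C.U, x k < t.val (fun i => rep (v i) k) ∧
        ¬ φ.Sat (scons (x k) fun i => rep (v i) k) fun i => (s i).comp k := hn.mono fun k hk =>
          Nat.sInf_mem hk
      have hb : C.Bdd x := (bdd_rep (t.val v)).mono (by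
        filter_upwards [hx, rep_val t v] with k h₁ h₂
        exact h₂ ▸ h₁.1.le)
      have hlt : ofSeq x hb < t.val v := by
        filter_upwards [hx, rep_val t v, rep_ofSeq x hb] with k h₁ h₂ h₃
        rw [h₂, h₃]
        exact h₁.1
      obtain ⟨k, h₁, h₂, h₃⟩ := ((h _ hlt).and (hx.and (rep_ofSeq x hb))).exists
      rw [h₃] at h₁
      exact h₂.2 h₁
    · intro h x hx
      filter_upwards [h, rep_val t v, lt_iff.1 hx] with k h₁ h₂ h₃
      exact h₁ _ (h₂ ▸ h₃)

end Cut

theorem Code.eval_inl (D : Bool → Set ℕ) (B : ℕ) (t : Bool) (f : Fin 0 → Code) (p : ℕ) :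
    Code.eval D B (WType.mk (.inl t) f) p = D t := by
  rfl

theorem Code.eval_inr (D : Bool → Set ℕ) (B : ℕ) (θ χ : Fm) {n : ℕ} (f : Fin n → Code) (p : ℕ) :
    Code.eval D B (WType.mk (.inr (θ, χ, n)) f) p =
      {z | ∃ y < B, θ.Sat (scons y (scons z (dec (dec p 0)))) (codeEnv D B f p) ∧
        ∀ y' ≤ y, χ.Sat (scons y' (scons z (dec (dec p 0)))) (codeEnv D B f p)} := by
  rfl

/-! ### Σ⁰₁-induction and Δ⁰₁-comprehension in the cut -/

namespace Cut

variable {C : Cut}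

theorem exists_params (n m : ℕ) (v : ℕ → C.Num) (s : ℕ → C.Sets) :
    ∃ (f : Fin m → Code) (p q : ℕ → ℕ), C.Bdd p ∧ C.Bdd q ∧
      (∀ k, ∀ i < n, dec (p k) i = rep (v i) k) ∧
      ∀ k z, ∀ j < m, codeEnv (C.D k) (C.b 0 k) f (Nat.pair z (q k)) j = (s j).comp k := by
  obtain ⟨p, hp, h⟩ := exists_enc n fun i => bdd_rep (v i)
  obtain ⟨q, hq, h'⟩ := exists_enc m fun i => bdd_rep (s i).2
  refine ⟨fun j => (s j).1, p, q, hp, hq, h, fun k z j hj => ?_⟩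
  simp only [codeEnv, hj, dif_pos, dec_pair_succ, h' k j hj]
  rfl

/-- The least witness avoids the interval between some `a (l + 1)` and `b (l + 1)` on all relevant
parameters. A witness below `b (l + 1)` therefore forces one up to `a (l + 1)`, which lies in the
cut. -/
theorem exists_bound (θ : Fm) (v : ℕ → C.Num) (s : ℕ → C.Sets) {c : ℕ → ℕ} (hc : C.Bdd c) :
    ∃ α β : ℕ → ℕ, C.Bdd α ∧ (∀ f, C.Bdd f → ∀ᶠ k in C.U, f k < β k) ∧
      ∀ᶠ k in C.U, ∀ x ≤ c k, ∀ y < β k,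
        θ.Sat (scons y (scons x fun i => rep (v i) k)) (fun i => (s i).comp k) →
        ∃ y ≤ α k, θ.Sat (scons y (scons x fun i => rep (v i) k)) fun i => (s i).comp k := by
  obtain ⟨f, p, q, hp, hq, h, h'⟩ := exists_params θ.boundN θ.boundS v s
  obtain ⟨m, hm⟩ := (hc.pair hp).pair hq
  obtain ⟨l, hl, hgap⟩ := C.gap θ f m
  refine ⟨C.a (l + 1), C.b (l + 1), bdd_a _, fun g hg => hg.lt_b _, ?_⟩
  filter_upwards [hm, hgap, eventually_a_le hl] with k h₁ h₂ h₃ x hx y hy hxy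
  -- Layout expected by `leastWitness`: component `0` codes the number arguments, headed by `x`; the
  -- other components are the parameters of the sets.
  let r := Nat.pair (Nat.pair x (p k)) (q k)
  have hr : r ≤ C.a l k := by
    refine le_trans ?_ (h₁.trans h₃)
    have mono {x y : ℕ} (z : ℕ) (h : x ≤ y) : Nat.pair x z ≤ Nat.pair y z := by
      rcases h.eq_or_lt with rfl | h
      · exact le_rfl
      · exact (Nat.pair_lt_pair_left z h).le
    exact mono _ (mono _ hx)
  have sat (y : ℕ) : θ.Sat (scons y (dec (dec r 0))) (codeEnv (C.D k) (C.b 0 k) f r) ↔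
      θ.Sat (scons y (scons x fun i => rep (v i) k)) fun i => (s i).comp k := by
    refine θ.sat_congr (fun i hi => ?_) fun j hj => h' k _ j hj
    rcases i with _ | _ | i
    · rfl
    · simp [r]
    · simpa [r] using h k i (by omega)
  have hle : leastWitness (C.D k) (C.b 0 k) θ f r ≤ y := Nat.sInf_le ((sat y).2 hxy)
  have hmem := Nat.sInf_mem (s := {y | θ.Sat (scons y (dec (dec r 0)))
    (codeEnv (C.D k) (C.b 0 k) f r)}) ⟨y, (sat y).2 hxy⟩
  exact ⟨_, not_lt.1 fun h => h₂ r hr ⟨h, hle.trans_lt hy⟩, (sat _).1 hmem⟩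

theorem sat_exN_iff {θ : Fm} (hθ : IsBounded θ) (v : ℕ → C.Num) (s : ℕ → C.Sets) (x : C.Num) :
    θ.exN.Sat (scons x v) s ↔ ∃ y, C.Bdd y ∧ ∀ᶠ k in C.U,
      θ.Sat (scons (y k) (scons (rep x k) fun i => rep (v i) k)) fun i => (s i).comp k := by
  simp only [sat_exN, sat_iff_of_isBounded hθ, rep_scons]
  refine ⟨fun ⟨y, hy⟩ => ⟨_, bdd_rep y, hy⟩, fun ⟨y, hy, h⟩ => ⟨ofSeq y hy, ?_⟩⟩
  filter_upwards [h, rep_ofSeq y hy] with k h₁ h₂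
  rwa [h₂]

theorem sat_allN_iff {θ : Fm} (hθ : IsBounded θ) (v : ℕ → C.Num) (s : ℕ → C.Sets) (x : C.Num) :
    θ.allN.Sat (scons x v) s ↔ ∀ y, C.Bdd y → ∀ᶠ k in C.U,
      θ.Sat (scons (y k) (scons (rep x k) fun i => rep (v i) k)) fun i => (s i).comp k := by
  simp only [sat_allN, sat_iff_of_isBounded hθ, rep_scons]
  refine ⟨fun h y hy => ?_, fun h y => h _ (bdd_rep y)⟩
  filter_upwards [h (ofSeq y hy), rep_ofSeq y hy] with k h₁ h₂
  rwa [h₂] at h₁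

/-- Up to `c` the formula is equivalent to the predicate `P` with bounded witnesses, evaluated in
each component. A failure at `c` then has a least counterexample `z k ≤ rep c k` in almost every
component, and its predecessor contradicts the induction step. -/
theorem sat_induction {φ : Fm} (hφ : IsSigma1 φ) (v : ℕ → C.Num) (s : ℕ → C.Sets) :
    (induction φ).Sat v s := by
  obtain ⟨θ, hθ, rfl⟩ := hφ
  simp only [induction, sat_imp, sat_and, Fm.sat_instN, Tm.val_zero]
  rw [sat_allN, sat_allN]
  simp only [sat_imp, Fm.sat_instSucc]
  rintro ⟨zero, succ⟩ c
  obtain ⟨α, β, hα, hβ, h⟩ := exists_bound θ v s (bdd_rep c)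
  let P (k x : ℕ) : Prop := ∃ y ≤ α k,
    θ.Sat (scons y (scons x fun i => rep (v i) k)) fun i => (s i).comp k
  have key {x : C.Num} (hx : ∀ᶠ k in C.U, rep x k ≤ rep c k) :
      θ.exN.Sat (scons x v) s ↔ ∀ᶠ k in C.U, P k (rep x k) := by
    rw [sat_exN_iff hθ]
    constructor
    · rintro ⟨y, hy, hxy⟩
      filter_upwards [h, hx, hβ y hy, hxy] with k h₁ h₂ h₃ h₄ using h₁ _ h₂ _ h₃ h₄
    · intro hP
      let y : ℕ → ℕ := fun k => sInf {y | y ≤ α k ∧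
        θ.Sat (scons y (scons (rep x k) fun i => rep (v i) k)) fun i => (s i).comp k}
      have hy : ∀ᶠ k in C.U, y k ≤ α k ∧
          θ.Sat (scons (y k) (scons (rep x k) fun i => rep (v i) k)) fun i => (s i).comp k :=
        hP.mono fun k hk => Nat.sInf_mem hk
      exact ⟨y, hα.mono (hy.mono fun k hk => hk.1), hy.mono fun k hk => hk.2⟩
  by_contra hn
  rw [key (.of_forall fun _ => le_rfl), ← Ultrafilter.eventually_not] at hn
  rw [key (rep_zero.mono fun k hk => hk ▸ Nat.zero_le _)] at zero
  let z : ℕ → ℕ := fun k => sInf {z | ¬ P k z}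
  have hz : ∀ᶠ k in C.U, ¬ P k (z k) ∧ z k ≤ rep c k ∧ z k = z k - 1 + 1 ∧ P k (z k - 1) := by
    filter_upwards [hn, zero, rep_zero] with k h₁ h₂ h₃
    have h₄ : ¬ P k (z k) := Nat.sInf_mem (s := {z | ¬ P k z}) ⟨_, h₁⟩
    have h₅ : z k ≠ 0 := fun h => h₄ (by rwa [h, ← h₃])
    refine ⟨h₄, Nat.sInf_le h₁, by omega, ?_⟩
    by_contra h₆
    have : z k ≤ z k - 1 := Nat.sInf_le h₆
    omega
  have hb : C.Bdd fun k => z k - 1 := (bdd_rep c).mono (hz.mono fun k hk => by omega)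
  let x := ofSeq _ hb
  have hx := rep_ofSeq _ hb
  have h₁ : θ.exN.Sat (scons x v) s := by
    rw [key]
    · filter_upwards [hx, hz] with k h₁ h₂
      exact h₁ ▸ h₂.2.2.2
    · filter_upwards [hx, hz] with k h₁ h₂
      exact (h₁ : rep x k = _) ▸ (by omega)
  have h₂ := succ x h₁
  have hx' : ∀ᶠ k in C.U, rep (x + 1) k = z k := by
    filter_upwards [hx, hz, rep_add x 1, rep_one] with k h₁ h₂ h₃ h₄
    rw [h₃, h₄, h₂.2.2.1]
    exact congrArg (· + 1) h₁
  rw [key] at h₂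
  · obtain ⟨k, h₁, h₂, h₃⟩ := (h₂.and (hx'.and hz)).exists
    exact h₃.1 (h₂ ▸ h₁)
  · filter_upwards [hx', hz] with k h₁ h₂
    exact h₁ ▸ h₂.2.1

/-- `X` collects those `z` with a `y` such that θ holds at `y` and χ holds up to `y`, evaluated in
the ultrapower. A `y` inside the cut proves the Σ⁰₁-formula; a `y` above the cut makes χ true
throughout the cut, which proves the Π⁰₁-formula. -/
theorem sat_comprehension {φ ψ : Fm} (hφ : IsSigma1 φ) (hψ : IsPi1 ψ) (v : ℕ → C.Num)
    (s : ℕ → C.Sets) : (comprehension φ ψ).Sat v s := by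
  obtain ⟨θ, hθ, rfl⟩ := hφ
  obtain ⟨χ, hχ, rfl⟩ := hψ
  obtain ⟨f, p, q, hp, hq, h, h'⟩ := exists_params (max θ.boundN χ.boundN)
    (max θ.boundS χ.boundS) v s
  rw [comprehension, sat_imp, sat_exS, sat_allN]
  intro hiff
  let X : C.Sets := (WType.mk (.inr (θ, χ, _)) f, ofSeq _ (hp.pair hq))
  have sat (θ' : Fm) (hN : θ'.boundN ≤ max θ.boundN χ.boundN)
      (hS : θ'.boundS ≤ max θ.boundS χ.boundS) (k y z : ℕ) :
      θ'.Sat (scons y (scons z (dec (p k))))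
        (codeEnv (C.D k) (C.b 0 k) f (Nat.pair (p k) (q k))) ↔
      θ'.Sat (scons y (scons z fun i => rep (v i) k)) fun i => (s i).comp k := by
    refine θ'.sat_congr (fun i hi => ?_) fun j hj => h' k _ j (hj.trans_le hS)
    rcases i with _ | _ | i
    · rfl
    · rfl
    · exact h k i (by omega)
  have hX : ∀ᶠ k in C.U, X.comp k = {z | ∃ y < C.b 0 k,
      θ.Sat (scons y (scons z fun i => rep (v i) k)) (fun i => (s i).comp k) ∧
      ∀ y' ≤ y, χ.Sat (scons y' (scons z fun i => rep (v i) k)) fun i => (s i).comp k} := by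
    filter_upwards [rep_ofSeq _ (hp.pair hq)] with k hk
    have : X.comp k = Code.eval (C.D k) (C.b 0 k) (WType.mk (.inr (θ, χ, _)) f)
      (Nat.pair (p k) (q k)) := congrArg _ hk
    rw [this, Code.eval_inr]
    simp only [dec_pair_zero, sat θ (le_max_left _ _) (le_max_left _ _),
      sat χ (le_max_right _ _) (le_max_right _ _)]
  refine ⟨X, fun x => ?_⟩
  rw [sat_iff, Fm.sat_liftS, sat_mem, Tm.val_var]
  have hx := hiff x
  rw [sat_iff, sat_exN_iff hθ, sat_allN_iff hχ] at hx
  rw [sat_exN_iff hθ]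
  change x ∈ X ↔ _
  rw [mem_iff]
  constructor
  · intro hmem
    let y : ℕ → ℕ := fun k => sInf {y | y < C.b 0 k ∧
      θ.Sat (scons y (scons (rep x k) fun i => rep (v i) k)) (fun i => (s i).comp k) ∧
      ∀ y' ≤ y, χ.Sat (scons y' (scons (rep x k) fun i => rep (v i) k)) fun i => (s i).comp k}
    have hy : ∀ᶠ k in C.U, y k < C.b 0 k ∧
        θ.Sat (scons (y k) (scons (rep x k) fun i => rep (v i) k)) (fun i => (s i).comp k) ∧
        ∀ y' ≤ y k, χ.Sat (scons y' (scons (rep x k) fun i => rep (v i) k))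
          fun i => (s i).comp k := by
      filter_upwards [hX, hmem] with k h₁ h₂
      rw [h₁] at h₂
      exact Nat.sInf_mem h₂
    by_cases hb : C.Bdd y
    · exact ⟨y, hb, hy.mono fun k hk => hk.2.1⟩
    · refine hx.2 fun z ⟨n, hz⟩ => ?_
      -- As `U` is an ultrafilter, a `y` outside the cut lies above every `a n`.
      have hlt : ∀ᶠ k in C.U, ¬ y k ≤ C.a n k :=
        Ultrafilter.eventually_not.2 fun h => hb ⟨n, h⟩
      filter_upwards [hy, hz, hlt] with k h₁ h₂ h₃
      exact h₁.2.2 _ (h₂.trans (not_le.1 h₃).le)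
  · intro hsat
    have hall := hx.1 hsat
    obtain ⟨y, hy, hxy⟩ := hsat
    -- Counterexamples up to `y` would represent an element of the cut, where χ holds.
    have hχy : ∀ᶠ k in C.U, ∀ y' ≤ y k, χ.Sat (scons y' (scons (rep x k) fun i => rep (v i) k))
        fun i => (s i).comp k := by
      by_contra hn
      have hn := Ultrafilter.eventually_not.2 hn
      push Not at hn
      let z : ℕ → ℕ := fun k => sInf {z | z ≤ y k ∧
        ¬ χ.Sat (scons z (scons (rep x k) fun i => rep (v i) k)) fun i => (s i).comp k}
      have hz : ∀ᶠ k in C.U, z k ≤ y k ∧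
          ¬ χ.Sat (scons (z k) (scons (rep x k) fun i => rep (v i) k)) fun i => (s i).comp k :=
        hn.mono fun k hk => Nat.sInf_mem hk
      obtain ⟨k, h₁, h₂⟩ := ((hall z (hy.mono (hz.mono fun k hk => hk.1))).and hz).exists
      exact h₂.2 h₁
    filter_upwards [hX, hxy, hχy, hy.lt_b 0] with k h₁ h₂ h₃ h₄
    rw [h₁]
    exact ⟨y k, h₄, h₂, h₃⟩

theorem isModel : IsModel C.Num C.Sets := by
  intro φ hφ v s
  cases hφ with
  | succ_ne_zero =>
    exact (sat_iff_of_isBounded (.imp (.eq _ _) .falsum) v s).2 (.of_forall fun k => by simp)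
  | succ_inj =>
    rw [sat_iff_of_isBounded (.imp (.eq _ _) (.eq _ _))]
    exact .of_forall fun k => by simp
  | add_zero =>
    rw [sat_iff_of_isBounded (.eq _ _)]
    exact .of_forall fun k => by simp
  | add_succ =>
    rw [sat_iff_of_isBounded (.eq _ _)]
    exact .of_forall fun k => by simp [add_assoc]
  | mul_zero =>
    rw [sat_iff_of_isBounded (.eq _ _)]
    exact .of_forall fun k => by simp
  | mul_succ =>
    rw [sat_iff_of_isBounded (.eq _ _)]
    exact .of_forall fun k => by simp [mul_add]
  | not_lt_zero =>
    exact (sat_iff_of_isBounded (.imp (.lt _ _) .falsum) v s).2 (.of_forall fun k => by simp)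
  | lt_succ =>
    rw [sat_iff_of_isBounded]
    · refine .of_forall fun k => ?_
      rw [sat_iff, sat_or]
      simp [Order.lt_add_one_iff, le_iff_lt_or_eq]
    · have neg {φ : Fm} (h : IsBounded φ) : IsBounded φ.neg := .imp h .falsum
      have imp := @IsBounded.imp
      exact neg (.imp (.imp (.lt _ _) (.imp (neg (.lt _ _)) (.eq _ _)))
        (neg (.imp (.imp (neg (.lt _ _)) (.eq _ _)) (.lt _ _))))
  | induction h => exact sat_induction h v s
  | comprehension h h' => exact sat_comprehension h h' v s

end Cut

/-! ### The descent inside the cut -/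

/-- If `len i` and `e i j` are the lengths and entries of non-increasing sequences that descend
lexicographically, and are given by sets of the structure, then `ω(ω)` is not a well order. -/
def DescentRefutes {N S : Type} [Membership N S] (len : N → N) (e : N → N → N) (Λ E : S)
    (v : ℕ → N) (s : ℕ → S) [Zero N] [One N] [Add N] [Mul N] [LT N] : Prop :=
  (∀ i l, (i + l) * (i + l) + i ∈ Λ ↔ l = len i) →
  (∀ i j x, ((i + j) * (i + j) + i + x) * ((i + j) * (i + j) + i + x) +
    ((i + j) * (i + j) + i) ∈ E ↔ x = e i j) →
  (∀ i j, j + 1 < len i → ¬ e i j < e i (j + 1)) →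
  (∀ i, (len (i + 1) < len i ∧ ∀ j, j < len (i + 1) → e i j = e (i + 1) j) ∨
    ∃ j, j < len i ∧ j < len (i + 1) ∧ e (i + 1) j < e i j ∧
      ∀ k, k < j → e i k = e (i + 1) k) →
  ¬ (omegaOmegaSatisfies isWellOrder).Sat v s

/-- `DescentRefutes` writes out the pairing and avoids `≤`, so it refers only to the raw operations
and can pass through `IsModel.elim`. -/
theorem IsModel.descentRefutes {N S : Type} [Zero N] [One N] [Add N] [Mul N] [LT N]
    [Membership N S] [Nonempty S] (H : IsModel N S) (len : N → N) (e : N → N → N) (Λ E : S)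
    (v : ℕ → N) (s : ℕ → S) : DescentRefutes len e Λ E v s := by
  refine H.elim (C := fun _ _ _ _ _ => DescentRefutes len e Λ E v s) ?_
  intro _ _ _ _ _ _ hΛ hE hmono hdesc
  exact not_sat_wellOrder hΛ hE (fun i j h => not_lt.1 (hmono i j h)) hdesc v s

namespace Cut

theorem not_sat_wellOrder {C : Cut} {L : ℕ → ℕ → ℕ} {R : ℕ → ℕ → ℕ → ℕ}
    (hL : ∀ i, C.Bdd i → C.Bdd fun k => L k (i k))
    (hR : ∀ i j, C.Bdd i → C.Bdd j → C.Bdd fun k => R k (i k) (j k))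
    (htrue : ∀ k, C.D k true = {z | ∃ i, z = pr i (L k i)})
    (hfalse : ∀ k, C.D k false = {z | ∃ i j, z = pr (pr i j) (R k i j)})
    (hmono : ∀ k i j, j + 1 < L k i → R k i (j + 1) ≤ R k i j)
    (hdesc : ∀ k i, k + i < C.b 0 k →
      (L k (i + 1) < L k i ∧ ∀ j < L k (i + 1), R k i j = R k (i + 1) j) ∨
      ∃ j, j < L k i ∧ j < L k (i + 1) ∧ R k (i + 1) j < R k i j ∧
        ∀ l < j, R k i l = R k (i + 1) l)
    (hid : C.Bdd id) (v : ℕ → C.Num) (s : ℕ → C.Sets) :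
    ¬ (omegaOmegaSatisfies isWellOrder).Sat v s := by
  let len : C.Num → C.Num := fun i => ofSeq _ (hL _ (bdd_rep i))
  let e : C.Num → C.Num → C.Num := fun i j => ofSeq _ (hR _ _ (bdd_rep i) (bdd_rep j))
  let Λ : C.Sets := (WType.mk (.inl true) Fin.elim0, 0)
  let E : C.Sets := (WType.mk (.inl false) Fin.elim0, 0)
  have rep_len (i : C.Num) : ∀ᶠ k in C.U, rep (len i) k = L k (rep i k) := rep_ofSeq _ _
  have rep_e (i j : C.Num) : ∀ᶠ k in C.U, rep (e i j) k = R k (rep i k) (rep j k) := rep_ofSeq _ _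
  have rep_succ (i : C.Num) : ∀ᶠ k in C.U, rep (i + 1) k = rep i k + 1 := by
    filter_upwards [rep_add i 1, rep_one] with k h₁ h₂
    rw [h₁, h₂]
  have rep_pr (i j : C.Num) : ∀ᶠ k in C.U,
      rep ((i + j) * (i + j) + i) k = pr (rep i k) (rep j k) := by
    filter_upwards [rep_add ((i + j) * (i + j)) i, rep_mul (i + j) (i + j), rep_add i j]
      with k h₁ h₂ h₃
    rw [h₁, h₂, h₃, pr]
  refine isModel.descentRefutes len e Λ E v s (fun i l => ?_) (fun i j x => ?_) (fun i j h => ?_) fun i => ?_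
  · rw [mem_iff, eq_iff]
    refine eventually_congr ?_
    filter_upwards [rep_pr i l, rep_len i] with k h₁ h₂
    have : Λ.comp k = _ := (Code.eval_inl _ _ _ _ _).trans (htrue k)
    rw [h₁, h₂, this]
    refine ⟨fun ⟨i', h⟩ => ?_, fun h => ⟨_, by rw [h]⟩⟩
    obtain ⟨h, h'⟩ := pr_inj.1 h
    rw [h', h]
  · rw [mem_iff, eq_iff]
    refine eventually_congr ?_
    filter_upwards [rep_pr i j, rep_pr ((i + j) * (i + j) + i) x, rep_e i j] with k h₁ h₂ h₃
    have : E.comp k = _ := (Code.eval_inl _ _ _ _ _).trans (hfalse k)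
    rw [h₂, h₁, h₃, this]
    refine ⟨fun ⟨i', j', h⟩ => ?_, fun h => ⟨_, _, by rw [h]⟩⟩
    obtain ⟨h, h'⟩ := pr_inj.1 h
    obtain ⟨h₁, h₂⟩ := pr_inj.1 h
    rw [h', h₁, h₂]
  · rw [lt_iff] at *
    refine Ultrafilter.eventually_not.1 ?_
    filter_upwards [h, rep_e i j, rep_e i (j + 1), rep_succ j, rep_len i] with k h₁ h₂ h₃ h₄ h₅
    rw [h₂, h₃, h₄]
    rw [h₄, h₅] at h₁
    exact not_lt.2 (hmono _ _ _ h₁)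
  -- For `i` in the cut, `k + i` is still in the cut and hence below `b 0`, so the descent has not
  -- ended. The ultrafilter then selects one of the two ways to descend.
  · have h := ((hid.add (bdd_rep i)).lt_b 0).mono fun k hk => hdesc k _ hk
    rcases Ultrafilter.eventually_or.1 h with h | h
    · refine .inl ⟨?_, fun j hj => eq_iff.2 ?_⟩
      · rw [lt_iff]
        filter_upwards [h, rep_succ i, rep_len i, rep_len (i + 1)] with k h₁ h₂ h₃ h₄
        rw [h₄, h₃, h₂]
        exact h₁.1
      · filter_upwards [h, lt_iff.1 hj, rep_succ i, rep_len (i + 1), rep_e i j, rep_e (i + 1) j]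
          with k h₁ h₂ h₃ h₄ h₅ h₆
        rw [h₄, h₃] at h₂
        rw [h₅, h₆, h₃]
        exact h₁.2 _ h₂
    · obtain ⟨j, hj⟩ := skolem.1 h
      have hb : C.Bdd j := (hL _ (bdd_rep i)).mono (hj.mono fun k hk => hk.1.le)
      have rep_j := rep_ofSeq j hb
      refine .inr ⟨ofSeq j hb, ?_, ?_, ?_, fun l hl => eq_iff.2 ?_⟩
      · rw [lt_iff]
        filter_upwards [hj, rep_j, rep_len i] with k h₁ h₂ h₃
        rw [h₂, h₃]
        exact h₁.1
      · rw [lt_iff]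
        filter_upwards [hj, rep_j, rep_succ i, rep_len (i + 1)] with k h₁ h₂ h₃ h₄
        rw [h₂, h₄, h₃]
        exact h₁.2.1
      · rw [lt_iff]
        filter_upwards [hj, rep_j, rep_succ i, rep_e i (ofSeq j hb), rep_e (i + 1) (ofSeq j hb)]
          with k h₁ h₂ h₃ h₄ h₅
        rw [h₄, h₅, h₂, h₃]
        exact h₁.2.2.1
      · filter_upwards [hj, rep_j, lt_iff.1 hl, rep_succ i, rep_e i l, rep_e (i + 1) l]
          with k h₁ h₂ h₃ h₄ h₅ h₆
        rw [h₂] at h₃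
        rw [h₅, h₆, h₄]
        exact h₁.2.2.2 _ h₃

end Cut

theorem not_proves_wellOrder : ¬ Proves RCA₀ (omegaOmegaSatisfies isWellOrder) := by
  intro h
  -- Entry `k` and counter `k`: the descent stays nonempty for `n k` steps, and `B k` is the counter
  -- `k + n k` reached afterwards, at least `ack k k`.
  choose n _ hB hn using fun k => exists_descent_eq k [] k
  let L (k i : ℕ) : ℕ := (descent k [k] i).length
  let R (k i j : ℕ) : ℕ := revEntry (descent k [k] i) j
  obtain ⟨C, hD, ha, hb⟩ := Cut.exists (fun k t => match t with
    | true => {z | ∃ i, z = pr i (L k i)}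
    | false => {z | ∃ i j, z = pr (pr i j) (R k i j)}) hB
  have hid : C.Bdd id := ⟨0, .of_forall fun k => (ha k).ge⟩
  refine Cut.not_sat_wellOrder (C := C) (L := L) (R := R) (fun i hi => ?_) (fun i j _ _ => ?_)
    (fun k => by rw [hD]) (fun k => by rw [hD]) (fun k i j hj => ?_) (fun k i hi => ?_) hid
    (fun _ => 0) (fun _ => Classical.arbitrary _)
    (soundness (fun φ hφ => Cut.isModel φ hφ) h _ _ (by simp))
  -- Lengths grow only polynomially in `k` and `i`, and entries never exceed `k`, so both remain in
  -- the cut.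
  · exact ((Cut.bdd_const 1).add (hi.mul (hid.add hi))).mono (.of_forall fun k =>
      descent_length_le k [k] (i k))
  · exact hid.mono (.of_forall fun k => revEntry_le (descent_le (by simp) _) _)
  · exact revEntry_anti (descent_sorted k (List.pairwise_singleton _ _) i) hj
  · rw [hb] at hi
    exact descend_lt (k + i) (List.length_pos_iff.1 (hn k i (by omega)))

end SOA

theorem mainTheorem10 :
    SOA.Proves SOA.RCA₀ (SOA.omegaOmegaSatisfies SOA.isWeakWellOrder) ∧
      ¬ SOA.Proves SOA.RCA₀ (SOA.omegaOmegaSatisfies SOA.isWellOrder) :=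
  ⟨SOA.proves_weakWellOrder, SOA.not_proves_wellOrder⟩
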